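/- Let $F_0,\dots,F_5\in\mathbb{C}[x_0,\dots,x_4]$ be quadratic forms without a common factor of positive degree, and suppose that $\varphi=[F_0,\dots,F_5]:\mathbb{P}^4\dashrightarrow\mathbb{P}^5$ is birational onto its image and that the closure of this image is a quadric hypersurface $Q=\overline{\varphi(\mathbb{P}^4)}\subset\mathbb{P}^5$ of rank $\operatorname{rk}(Q)\ge 5$. Let $B\subset\mathbb{P}^4$ be the base locus of $\varphi$, that is, the closed subscheme defined by $F_0=\dots=F_5=0$, and suppose that $B$ is nonempty and reduced. Say that $\varphi$ is of type $(2,d)$ if $d$ is the least integer such that $\varphi^{-1}:Q\dashrightarrow\mathbb{P}^4$ can be defined by the restrictions to $Q$ of forms of degree $d$ on $\mathbb{P}^5$. Then one of the following holds: (i) $\varphi$ is of type $(2,1)$; (ii) $\varphi$ is of type $(2,2)$, $Q$ is smooth, and $B$ is one of the following: (a) a rational normal quartic curve in $\mathbb{P}^4$; (b) the union of a twisted cubic curve contained in a hyperplane $H\subset\mathbb{P}^4$ and a line that is not contained in $H$ and meets the twisted cubic; (c) the union of an irreducible conic and two skew lines, each of which meets the conic; (d) the union of three pairwise skew lines and another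 line that meets each of them. -/

import Mathlib

open MvPolynomial

namespace QuadBir

/-- Complex projective space of dimension `n`. -/
abbrev ProjSpace (n : ℕ) := Projectivization ℂ (Fin (n + 1) → ℂ)

/-! ### Subsets of projective space -/

/-- The common zeros in projective space of a set of (homogeneous) polynomials. -/
def zeroLocus {n : ℕ} (S : Set (MvPolynomial (Fin (n + 1)) ℂ)) : Set (ProjSpace n) :=
  {p | ∀ f ∈ S, ∀ v ∈ p.submodule, eval v f = 0}

/-- `L` is a linear subspace of dimension `k`: the projectivization of a vector subspace of
dimension `k + 1`. -/
def IsLinearSubspace {n : ℕ} (k : ℕ) (L : Set (ProjSpace n)) : Prop :=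
  ∃ W : Submodule ℂ (Fin (n + 1) → ℂ),
    Module.finrank ℂ W = k + 1 ∧ L = {p : ProjSpace n | p.submodule ≤ W}

/-- `L` is a line. -/
def IsLine {n : ℕ} (L : Set (ProjSpace n)) : Prop := IsLinearSubspace 1 L

/-- `C` is a rational normal curve of degree `d` in some `d`-dimensional linear subspace: in
suitable coordinates of that subspace it is the image of
`[s, t] ↦ [s ^ d, s ^ (d - 1) * t, …, t ^ d]`. Since `p.submodule` has dimension one, the equation
below forces the point `(s, t)` to be nonzero. -/
def IsRationalNormalCurve {n : ℕ} (d : ℕ) (C : Set (ProjSpace n)) : Prop :=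
  ∃ v : Fin (d + 1) → (Fin (n + 1) → ℂ), LinearIndependent ℂ v ∧
    C = {p : ProjSpace n | ∃ s t : ℂ,
      p.submodule = Submodule.span ℂ {∑ i : Fin (d + 1), (s ^ (d - (i : ℕ)) * t ^ (i : ℕ)) • v i}}

/-- `C` is an irreducible conic: the zero set of an irreducible quadratic form in the homogeneous
coordinates of some plane, the plane being spanned by the points `v 0`, `v 1`, `v 2`. -/
def IsIrreducibleConic {n : ℕ} (C : Set (ProjSpace n)) : Prop :=
  ∃ v : Fin 3 → (Fin (n + 1) → ℂ), LinearIndependent ℂ v ∧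
    ∃ f : MvPolynomial (Fin 3) ℂ, f.IsHomogeneous 2 ∧ Irreducible f ∧
      C = {p : ProjSpace n | ∃ a : Fin 3 → ℂ, eval a f = 0 ∧
        p.submodule = Submodule.span ℂ {∑ i, a i • v i}}

/-! ### Quadric hypersurfaces -/

/-- The rank of the quadric `q = 0`, for a quadratic form `q`: the rank of its Hessian matrix, which
is twice the symmetric matrix of `q`. -/
noncomputable def quadricRank {m : ℕ} (q : MvPolynomial (Fin m) ℂ) : ℕ :=
  (Matrix.of fun i j : Fin m => constantCoeff (pderiv i (pderiv j q))).rank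

/-- The projective hypersurface `q = 0` is smooth (Jacobian criterion). -/
def IsSmoothHypersurface {m : ℕ} (q : MvPolynomial (Fin m) ℂ) : Prop :=
  ∀ y : Fin m → ℂ, y ≠ 0 → eval y q = 0 → ∃ i, eval y (pderiv i q) ≠ 0

/-! ### Rational maps from `ℙⁿ` onto a hypersurface of `ℙⁿ⁺¹`

A rational map from `ℙⁿ` to `ℙⁿ⁺¹` is given by a tuple `F` of `n + 2` forms of equal degree in
`n + 1` variables. -/

/-- The homogeneous ideal of the closure of the image of the rational map given by `F`: the
polynomials `g` with `g(F₀, …, Fₙ₊₁) = 0`. -/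
noncomputable def imageIdeal {n : ℕ} (F : Fin (n + 2) → MvPolynomial (Fin (n + 1)) ℂ) :
    Ideal (MvPolynomial (Fin (n + 2)) ℂ) :=
  RingHom.ker (bind₁ F : MvPolynomial (Fin (n + 2)) ℂ →ₐ[ℂ] MvPolynomial (Fin (n + 1)) ℂ)

/-- The forms `G` of degree `d` on `ℙⁿ⁺¹` define, by restriction to the hypersurface `q = 0`, a
rational map from that hypersurface to `ℙⁿ` which is inverse to the rational map given by `F`.
Both composites are the identity as rational maps: the composite on `ℙⁿ` sends `x` to `h(x) x` with
`h` not identically zero, and the composite on the hypersurface sends `y` to `k(y) y` with `k` not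
identically zero on the hypersurface. -/
structure IsInverseOfDegree {n : ℕ} (F : Fin (n + 2) → MvPolynomial (Fin (n + 1)) ℂ)
    (q : MvPolynomial (Fin (n + 2)) ℂ) (d : ℕ)
    (G : Fin (n + 1) → MvPolynomial (Fin (n + 2)) ℂ) : Prop where
  homogeneous : ∀ i, (G i).IsHomogeneous d
  left_inverse : ∃ h : MvPolynomial (Fin (n + 1)) ℂ, h ≠ 0 ∧ ∀ i, bind₁ F (G i) = h * X i
  right_inverse : ∃ k : MvPolynomial (Fin (n + 2)) ℂ, k ∉ Ideal.span {q} ∧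
    ∀ j, bind₁ G (F j) - k * X j ∈ Ideal.span {q}

/-- `F` defines a quadratic birational map from `ℙⁿ` onto the hypersurface `q = 0` of `ℙⁿ⁺¹`: it
consists of quadratic forms without common factor (no fixed component), the closure of the image is
the hypersurface, and there is an inverse rational map. -/
structure IsQuadraticBirationalOnto {n : ℕ} (F : Fin (n + 2) → MvPolynomial (Fin (n + 1)) ℂ)
    (q : MvPolynomial (Fin (n + 2)) ℂ) : Prop where
  homogeneous : ∀ j, (F j).IsHomogeneous 2
  no_fixed_component : ∀ g : MvPolynomial (Fin (n + 1)) ℂ, (∀ j, g ∣ F j) → IsUnit g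
  image_closure : imageIdeal F = Ideal.span {q}
  birational : ∃ d G, IsInverseOfDegree F q d G

/-- The quadratic birational map given by `F` is of type `(2, d)`: the number `d` is the least
degree of forms which define the inverse. -/
def IsOfType {n : ℕ} (F : Fin (n + 2) → MvPolynomial (Fin (n + 1)) ℂ)
    (q : MvPolynomial (Fin (n + 2)) ℂ) (d : ℕ) : Prop :=
  IsLeast {e : ℕ | ∃ G, IsInverseOfDegree F q e G} d

/-- The support of the base locus of the linear system spanned by `F`. -/
def baseLocus {n : ℕ} (F : Fin (n + 2) → MvPolynomial (Fin (n + 1)) ℂ) : Set (ProjSpace n) :=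
  zeroLocus (Set.range F)

/-- The base locus, as the closed subscheme of `ℙⁿ` defined by `F`, is reduced: on each standard
chart `xᵢ = 1` its coordinate ring, the quotient of the polynomial ring by the forms `F` and
`xᵢ - 1`, is reduced. -/
def HasReducedBaseLocus {n : ℕ} (F : Fin (n + 2) → MvPolynomial (Fin (n + 1)) ℂ) : Prop :=
  ∀ i : Fin (n + 1), (Ideal.span (Set.range F) ⊔ Ideal.span {X i - 1}).IsRadical

end QuadBir

/-!
Write `Φ : ℂ⁵ → ℂ⁶` for the quadratic map given by the `F j`. Everything is deduced from a few
consequences of the hypotheses, collected in `IsQuadricParametrization`: the image of `Φ` spans and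
lies on the quadric, `Φ` is generically injective up to scalars, the radical of the quadric is at
most a line, and, by the Nullstellensatz, a linear form vanishing on the base locus vanishes on
arcs of second order in the base scheme, because that scheme is reduced.

The image of the differential `polar Φ p` at a base point `p` is isotropic for the quadric `q`. A
maximal isotropic subspace containing it writes `q` as `∑ fᵢ gᵢ`, a sum of three products of linear
forms, such that polarizing `q (Φ (x + s p)) = 0` gives the syzygy `∑ gᵢ(polar Φ p x) fᵢ(Φ x) = 0`,
with linear coefficients, between three of the components of `Φ`
(`IsQuadricParametrization.exists_split`). Either the three coefficients are independent, and then
the Koszul complex (`koszul_three`) and the Hilbert–Burch theorem for a `3 × 2` matrix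
(`hilbert_burch`) apply, or the three components have a common linear factor.

* If `q` has rank six, then in both cases the components of `Φ` span the `2 × 2` minors of a `2 × 4`
  matrix of linear forms, the first row of which may be chosen with independent entries, unless
  `Φ` contains all products `m ξ` of one linear form `m` with the linear forms `ξ`
  (`IsQuadricParametrization.exists_minorForm`). In the latter case these products form a linear
  inverse.
* If `q` has rank five, then only the second case occurs, and reducedness up to second order forces
  a linear inverse (`IsQuadricParametrization.hasLinearInverse`).

There remain the maps given by the minors of a `2 × 4` matrix, that is, by a pencil of linear maps
`r₂ - s r₁ : ℂ⁵ → ℂ⁴` with `r₁` surjective. Its base locus is the union of the kernels, including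
the one of `r₁` for `s = ∞`. Reducedness excludes Jordan blocks in the part of the pencil not
controlled by the kernel of `r₁`
(`IsMinorForm.exists_apply_ne_zero`), so that four base points with independent images under `r₁`
can be chosen as eigenvectors of the pencil (`IsMinorForm.exists_eigenbasis`). In the resulting
coordinates `(z, t)` the rows are `z` and `(lᵢ zᵢ + t wᵢ)ᵢ` with distinct `lᵢ` and `w ≠ 0`
(`IsMinorForm.exists_diagonal`). For this normal form a quadratic inverse is written down in the
exterior algebra (`IsDiagonalMinorForm.hasInverse`); the base locus consists of a rational curve,
whose degree is the number of nonzero `wᵢ`, and of a line meeting it for each `wᵢ = 0`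
(`map_rep_eq_zero_iff`). The values `4, 3, 2, 1` of this number are the four possible base loci.
-/

open MvPolynomial
namespace QuadBir
open QuadraticMap Module

/-! ### Linear and quadratic forms vanishing on linear subspaces -/

section Forms
variable {V Y : Type*} [AddCommGroup V] [Module ℂ V] [AddCommGroup Y] [Module ℂ Y]

theorem map_add_smul (Q : QuadraticMap ℂ V Y) (x y : V) (s : ℂ) :
    Q (x + s • y) = Q x + s • polar Q x y + (s * s) • Q y := by
  rw [QuadraticMap.map_add Q, QuadraticMap.map_smul, QuadraticMap.polar_smul_right]; abel

/-- A family of linear forms is either jointly surjective or linearly dependent. -/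
theorem pi_surjective_or_dependent {n : ℕ} (f : Fin n → Dual ℂ V) :
    Function.Surjective (LinearMap.pi f) ∨ ∃ c : Fin n → ℂ, c ≠ 0 ∧ ∀ x, ∑ i, c i * f i x = 0 := by
  by_cases h : LinearMap.range (LinearMap.pi f) = ⊤
  · exact Or.inl (LinearMap.range_eq_top.mp h)
  · right
    obtain ⟨g, hg, hle⟩ := Submodule.exists_le_ker_of_lt_top _ (lt_top_iff_ne_top.mpr h)
    have key : ∀ v : Fin n → ℂ, g v = ∑ i, g (Pi.single i 1) * v i := fun v => by
      conv_lhs => rw [LinearMap.pi_apply_eq_sum_univ g v]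
      refine Finset.sum_congr rfl fun i _ => ?_
      rw [smul_eq_mul, mul_comm]
      congr 2
      ext j; simp [Pi.single_apply, eq_comm]
    refine ⟨fun i => g (Pi.single i 1), fun h0 => hg ?_, fun x => ?_⟩
    · ext i
      simpa using congrFun h0 i
    · have := hle (LinearMap.mem_range_self (LinearMap.pi f) x)
      rw [LinearMap.mem_ker, key] at this
      simpa using this

theorem not_dependent_of_surjective {n : ℕ} {f : Fin n → Dual ℂ V}
    (h : Function.Surjective (LinearMap.pi f)) {c : Fin n → ℂ} (hc : ∀ x, ∑ i, c i * f i x = 0) :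
    c = 0 := by
  ext i
  obtain ⟨x, hx⟩ := h (Pi.single i 1)
  have := hc x
  have hfi : ∀ j, f j x = (Pi.single i 1 : Fin n → ℂ) j := fun j => congrFun hx j
  simpa [hfi, Pi.single_apply] using this

/-- A linear form vanishing on the common kernel of finitely many is a combination of them. -/
theorem exists_combination {n : ℕ} (f : Fin n → Dual ℂ V) (g : Dual ℂ V)
    (h : ∀ x, (∀ i, f i x = 0) → g x = 0) : ∃ c : Fin n → ℂ, ∀ x, g x = ∑ i, c i * f i x := by
  have : g ∈ Submodule.span ℂ (Set.range f) := by
    apply mem_span_of_iInf_ker_le_ker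
    intro x hx
    simp only [Submodule.mem_iInf, LinearMap.mem_ker] at hx ⊢
    exact h x hx
  obtain ⟨c, hc⟩ := (Submodule.mem_span_range_iff_exists_fun ℂ).mp this
  exact ⟨c, fun x => by simp [← hc]⟩

theorem exists_apply_eq_one {f : Dual ℂ V} (h : f ≠ 0) : ∃ e, f e = 1 := by
  obtain ⟨x, hx⟩ := DFunLike.ne_iff.mp h
  exact ⟨(f x)⁻¹ • x, by simp at hx; simp [hx]⟩

/-- A quadratic form vanishing on the common kernel of linear forms lies in the ideal they
generate. -/
theorem exists_eq_sum_mul {n : ℕ} (f : Fin n → Dual ℂ V) (Q : QuadraticForm ℂ V)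
    (h : ∀ x, (∀ i, f i x = 0) → Q x = 0) :
    ∃ g : Fin n → Dual ℂ V, ∀ x, Q x = ∑ i, f i x * g i x := by
  obtain ⟨r, hr⟩ := (LinearMap.pi f).rangeRestrict.exists_rightInverse_of_surjective
    (LinearMap.range_rangeRestrict _)
  obtain ⟨s, hs⟩ := LinearMap.exists_extend r
  have hfs : ∀ x, LinearMap.pi f (s (LinearMap.pi f x)) = LinearMap.pi f x := fun x => by
    have h1 := LinearMap.congr_fun hs ((LinearMap.pi f).rangeRestrict x)
    have h2 := LinearMap.congr_fun hr ((LinearMap.pi f).rangeRestrict x)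
    simp only [LinearMap.comp_apply, Submodule.subtype_apply] at h1 h2
    have h3 : s (LinearMap.pi f x) = r ((LinearMap.pi f).rangeRestrict x) := h1
    rw [h3]
    exact congrArg Subtype.val h2
  -- `P x` is a vector on which all `f i` take the same values as on `x`
  let P : V →ₗ[ℂ] V := s ∘ₗ LinearMap.pi f
  refine ⟨fun i => (polarBilin Q).flip (s (Pi.single i 1)) ∘ₗ (LinearMap.id - (1 / 2 : ℂ) • P),
    fun x => ?_⟩
  have h0 : Q (x - P x) = 0 := h _ fun i => by
    have := congrFun (hfs x) i
    simp only [LinearMap.pi_apply] at this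
    simp [P, this]
  have h1 : Q x = polar Q (x - (1 / 2 : ℂ) • P x) (P x) := by
    have h2 := QuadraticMap.map_add Q (x - P x) (P x)
    have h3 := polar_self Q (P x)
    rw [sub_add_cancel, h0, polar_sub_left] at h2
    rw [polar_sub_left, polar_smul_left, h2, h3]
    simp only [smul_eq_mul, two_nsmul]; ring
  have h4 : P x = ∑ i, f i x • s (Pi.single i 1) := by
    simp only [P, LinearMap.comp_apply]
    conv_lhs => rw [LinearMap.pi_apply_eq_sum_univ s]
    refine Finset.sum_congr rfl fun i _ => ?_
    congr 2
    ext j; simp [Pi.single_apply, eq_comm]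
  rw [h1]
  have h5 : ∀ v, polar Q v (P x) = ∑ i, f i x * polar Q v (s (Pi.single i 1)) := fun v => by
    have : polar Q v (P x) = polarBilin Q v (P x) := rfl
    rw [this, h4, map_sum]
    simp
  rw [h5]
  simp

/-- The case of one linear form: a quadratic form vanishing on a hyperplane is divisible by its
equation. -/
theorem exists_eq_mul (f : Dual ℂ V) (Q : QuadraticForm ℂ V) (h : ∀ x, f x = 0 → Q x = 0) :
    ∃ g : Dual ℂ V, ∀ x, Q x = f x * g x := by
  obtain ⟨g, hg⟩ := exists_eq_sum_mul ![f] Q (fun x hx => h x (by simpa using hx 0))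
  exact ⟨g 0, fun x => by simpa using hg x⟩

/-- On a subspace, a linear form is not a zero divisor for quadratic forms unless it vanishes. -/
theorem quad_eq_zero_of_mul_eq_zero (W : Submodule ℂ V) (f : Dual ℂ V) (Q : QuadraticForm ℂ V)
    (hf : ∃ e ∈ W, f e ≠ 0) (h : ∀ x ∈ W, f x * Q x = 0) : ∀ x ∈ W, Q x = 0 := by
  intro x hx
  by_cases hfx : f x = 0
  · obtain ⟨e, he, hfe⟩ := hf
    have key : ∀ s : ℂ, s ≠ 0 → Q x + s * polar Q x e + (s * s) * Q e = 0 := fun s hs => by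
      have h1 := h (x + s • e) (W.add_mem hx (W.smul_mem s he))
      rw [map_add_smul] at h1
      simpa [hfx, hs, hfe] using h1
    have h1 := key 1 one_ne_zero
    have h2 := key (-1) (by norm_num)
    have h3 := key 2 two_ne_zero
    linear_combination h1 + (1 / 3) * h2 - (1 / 3) * h3
  · exact (mul_eq_zero.mp (h x hx)).resolve_left hfx

theorem quad_mul_quad_eq_zero (W : Submodule ℂ V) (Q R : QuadraticForm ℂ V)
    (h : ∀ x ∈ W, Q x * R x = 0) : (∀ x ∈ W, Q x = 0) ∨ ∀ x ∈ W, R x = 0 := by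
  by_contra! hc
  obtain ⟨⟨a, ha, hQa⟩, b, hb, hRb⟩ := hc
  have hRa := (mul_eq_zero.mp (h a ha)).resolve_left hQa
  have hQb := (mul_eq_zero.mp (h b hb)).resolve_right hRb
  have key : ∀ s : ℂ, s ≠ 0 → (Q a + s * polar Q a b) * (polar R a b + s * R b) = 0 :=
    fun s hs => by
      have h1 := h (a + s • b) (W.add_mem ha (W.smul_mem s hb))
      rw [map_add_smul, map_add_smul, hRa, hQb] at h1
      simp only [smul_eq_mul, mul_zero, add_zero, zero_add] at h1
      apply mul_left_cancel₀ hs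
      linear_combination h1
  have h1 := key 1 one_ne_zero
  have h2 := key (-1) (by norm_num)
  have h3 := key 2 two_ne_zero
  have c0 : Q a * polar R a b = 0 := by linear_combination h1 + (1 / 3) * h2 - (1 / 3) * h3
  have c2 : polar Q a b * R b = 0 := by
    linear_combination (-1 / 2) * h1 + (1 / 6) * h2 + (1 / 3) * h3
  have p1 := (mul_eq_zero.mp c0).resolve_left hQa
  have p2 := (mul_eq_zero.mp c2).resolve_right hRb
  rw [p1, p2] at h1
  have : Q a * R b = 0 := by linear_combination h1
  exact (mul_ne_zero hQa hRb) this

theorem lin_mul_lin_eq_zero (W : Submodule ℂ V) (f g : Dual ℂ V)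
    (h : ∀ x ∈ W, f x * g x = 0) : (∀ x ∈ W, f x = 0) ∨ ∀ x ∈ W, g x = 0 := by
  by_contra! hc
  obtain ⟨⟨a, ha, hfa⟩, b, hb, hgb⟩ := hc
  have hga := (mul_eq_zero.mp (h a ha)).resolve_left hfa
  have hfb := (mul_eq_zero.mp (h b hb)).resolve_right hgb
  have := h (a + b) (W.add_mem ha hb)
  simp [hga, hfb, hfa, hgb] at this

/-- Koszul syzygies of two linear forms. -/
theorem koszul_two (a b : Dual ℂ V) (hab : ∃ e, b e = 0 ∧ a e ≠ 0) (hb : b ≠ 0)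
    (Q R : QuadraticForm ℂ V) (h : ∀ x, a x * Q x + b x * R x = 0) :
    ∃ m : Dual ℂ V, (∀ x, Q x = b x * m x) ∧ ∀ x, R x = -(a x * m x) := by
  obtain ⟨e, hbe, hae⟩ := hab
  have hQ : ∀ x ∈ LinearMap.ker b, Q x = 0 :=
    quad_eq_zero_of_mul_eq_zero _ a Q ⟨e, hbe, hae⟩ fun x hx => by
      have := h x; rw [LinearMap.mem_ker.mp hx] at this; simpa using this
  obtain ⟨m, hm⟩ := exists_eq_mul b Q hQ
  refine ⟨m, hm, fun x => ?_⟩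
  have hR := quad_eq_zero_of_mul_eq_zero ⊤ b (R + linMulLin a m)
    (by obtain ⟨e, he⟩ := exists_apply_eq_one hb; exact ⟨e, trivial, by simp [he]⟩)
    (fun x _ => by
      have := h x; rw [hm] at this
      simp only [_root_.add_apply, linMulLin_apply]; linear_combination this) x trivial
  simp only [_root_.add_apply, linMulLin_apply] at hR
  linear_combination hR

/-- Koszul syzygies of three linear forms: the vector of quadratic forms is a cross product
`l × a`. -/
theorem koszul_three (a : Fin 3 → Dual ℂ V) (ha : Function.Surjective (LinearMap.pi a))
    (Q : Fin 3 → QuadraticForm ℂ V) (h : ∀ x, ∑ i, a i x * Q i x = 0) :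
    ∃ l : Fin 3 → Dual ℂ V, (∀ x, Q 0 x = l 1 x * a 2 x - l 2 x * a 1 x) ∧
      (∀ x, Q 1 x = l 2 x * a 0 x - l 0 x * a 2 x) ∧
      ∀ x, Q 2 x = l 0 x * a 1 x - l 1 x * a 0 x := by
  simp only [Fin.sum_univ_three] at h
  have hsurj : ∀ u v w : ℂ, ∃ e, a 0 e = u ∧ a 1 e = v ∧ a 2 e = w := fun u v w => by
    obtain ⟨e, he⟩ := ha ![u, v, w]
    exact ⟨e, by simpa using congrFun he 0, by simpa using congrFun he 1,
      by simpa using congrFun he 2⟩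
  have h2 : ∀ x ∈ LinearMap.ker (a 0) ⊓ LinearMap.ker (a 1), Q 2 x = 0 :=
    quad_eq_zero_of_mul_eq_zero _ (a 2) (Q 2)
      (by obtain ⟨e, h0, h1, h2⟩ := hsurj 0 0 1; exact ⟨e, ⟨h0, h1⟩, by simp [h2]⟩)
      fun x hx => by
        have := h x
        rw [LinearMap.mem_ker.mp hx.1, LinearMap.mem_ker.mp hx.2] at this
        simpa using this
  obtain ⟨g, hg⟩ := exists_eq_sum_mul ![a 0, a 1] (Q 2) fun x hx =>
    h2 x ⟨by simpa using hx 0, by simpa using hx 1⟩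
  simp only [Fin.sum_univ_two, Matrix.cons_val_zero, Matrix.cons_val_one] at hg
  obtain ⟨m, hm0, hm1⟩ := koszul_two (a 0) (a 1)
    (by obtain ⟨e, h0, h1, -⟩ := hsurj 1 0 0; exact ⟨e, h1, by simp [h0]⟩)
    (by obtain ⟨e, -, h1, -⟩ := hsurj 0 1 0; intro h; simp [h] at h1)
    (Q 0 + linMulLin (a 2) (g 0)) (Q 1 + linMulLin (a 2) (g 1)) (fun x => by
      simp only [_root_.add_apply, linMulLin_apply]
      linear_combination h x - a 2 x * hg x)
  simp only [_root_.add_apply, linMulLin_apply] at hm0 hm1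
  refine ⟨![g 1, -g 0, -m], fun x => ?_, fun x => ?_, fun x => ?_⟩ <;> simp
  · linear_combination hm0 x
  · linear_combination hm1 x
  · rw [hg]; ring

end Forms
end QuadBir

open MvPolynomial
namespace QuadBir
open QuadraticMap Module

/-! ### Polynomials attached to linear and quadratic forms -/

section Polynomials
variable {n : ℕ}

/-- The homogeneous polynomial of degree one with the values of a linear form. -/
noncomputable def linPoly (f : Dual ℂ (Fin n → ℂ)) : MvPolynomial (Fin n) ℂ :=
  ∑ i, C (f (Pi.single i 1)) * X i

theorem eval_linPoly (f : Dual ℂ (Fin n → ℂ)) (x : Fin n → ℂ) : eval x (linPoly f) = f x := by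
  conv_rhs => rw [LinearMap.pi_apply_eq_sum_univ f x]
  simp only [linPoly, map_sum, map_mul, eval_C, eval_X, smul_eq_mul]
  refine Finset.sum_congr rfl fun i _ => ?_
  rw [mul_comm]
  congr 2
  ext j; simp [Pi.single_apply, eq_comm]

theorem isHomogeneous_linPoly (f : Dual ℂ (Fin n → ℂ)) : (linPoly f).IsHomogeneous 1 :=
  IsHomogeneous.sum _ _ _ fun i _ => isHomogeneous_C_mul_X _ i

theorem exists_poly_of_quadraticForm (Q : QuadraticForm ℂ (Fin n → ℂ)) :
    ∃ P : MvPolynomial (Fin n) ℂ, P.IsHomogeneous 2 ∧ ∀ x, eval x P = Q x := by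
  refine ⟨∑ i, ∑ j, C (1 / 2 * polar Q (Pi.single i 1) (Pi.single j 1)) * X i * X j, ?_, ?_⟩
  · exact IsHomogeneous.sum _ _ _ fun i _ => IsHomogeneous.sum _ _ _ fun j _ =>
      (isHomogeneous_C_mul_X _ i).mul (isHomogeneous_X _ j)
  · intro x
    have hx : x = ∑ i, x i • (Pi.single i 1 : Fin n → ℂ) := by
      ext j; simp [Finset.sum_apply, Pi.single_apply]
    have h1 : polarBilin Q x x = 2 * Q x := by simp [polar_self]
    have h2 : polarBilin Q x x
        = ∑ i, ∑ j, x i * x j * polar Q (Pi.single i 1) (Pi.single j 1) := by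
      conv_lhs => rw [hx]
      simp only [map_sum, LinearMap.sum_apply, map_smul, LinearMap.smul_apply, smul_eq_mul,
        polarBilin_apply_apply, Finset.mul_sum]
      rw [Finset.sum_comm]
      refine Finset.sum_congr rfl fun i _ => Finset.sum_congr rfl fun j _ => ?_
      ring
    have h3 : Q x = 1 / 2 * polarBilin Q x x := by rw [h1]; ring
    rw [h3, h2, Finset.mul_sum]
    simp only [map_sum, map_mul, eval_C, eval_X]
    refine Finset.sum_congr rfl fun i _ => ?_
    rw [Finset.mul_sum]
    refine Finset.sum_congr rfl fun j _ => ?_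
    ring

theorem exists_eq_C_of_isHomogeneous_zero {P : MvPolynomial (Fin n) ℂ} (h : P.IsHomogeneous 0) :
    P = C (constantCoeff P) :=
  totalDegree_eq_zero_iff_eq_C.mp (Nat.le_zero.mp h.totalDegree_le)

theorem exists_linearForm_of_isHomogeneous {P : MvPolynomial (Fin n) ℂ} (h : P.IsHomogeneous 1) :
    ∃ f : Dual ℂ (Fin n → ℂ), ∀ x, eval x P = f x := by
  refine ⟨∑ i, constantCoeff (pderiv i P) • LinearMap.proj i, fun x => ?_⟩
  have h1 := h.sum_X_mul_pderiv
  have h2 : ∀ i, pderiv i P = C (constantCoeff (pderiv i P)) := fun i =>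
    exists_eq_C_of_isHomogeneous_zero h.pderiv
  have h3 := congrArg (eval x) h1
  simp only [one_smul, map_sum, map_mul, eval_X] at h3
  rw [← h3]
  simp only [LinearMap.sum_apply, LinearMap.smul_apply, LinearMap.proj_apply, smul_eq_mul]
  refine Finset.sum_congr rfl fun i _ => ?_
  rw [h2 i]; simp [mul_comm]

theorem homogeneousComponent_mul_of_isHomogeneous {P : MvPolynomial (Fin n) ℂ} {d : ℕ}
    (h : P.IsHomogeneous d) (e : ℕ) (B : MvPolynomial (Fin n) ℂ) :
    homogeneousComponent (e + d) (B * P) = homogeneousComponent e B * P := by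
  conv_lhs => rw [← sum_homogeneousComponent B, Finset.sum_mul, map_sum]
  have h1 : ∀ i, homogeneousComponent (e + d) (homogeneousComponent i B * P)
      = if i = e then homogeneousComponent e B * P else 0 := fun i => by
    rw [homogeneousComponent_of_mem ((homogeneousComponent_isHomogeneous i B).mul h)]
    by_cases hi : i = e
    · simp [hi]
    · simp [hi, Ne.symm hi]
  simp only [h1]
  by_cases he : e ∈ Finset.range (B.totalDegree + 1)
  · rw [Finset.sum_ite_eq' _ e]; simp [he]
  · rw [Finset.sum_ite_eq' _ e]
    rw [homogeneousComponent_eq_zero]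
    · simp
    · simpa [Nat.lt_succ_iff] using he

theorem eq_mul_components_of_isHomogeneous {P d u : MvPolynomial (Fin n) ℂ}
    (hP : P.IsHomogeneous 2) (hd : d.totalDegree ≤ 1) (hu : u.totalDegree ≤ 1) (h : P = d * u) :
    P = homogeneousComponent 1 d * homogeneousComponent 1 u := by
  have h0 : d = homogeneousComponent 0 d + homogeneousComponent 1 d := by
    conv_lhs => rw [← sum_homogeneousComponent d]
    interval_cases hdd : d.totalDegree
    · have : homogeneousComponent 1 d = 0 := homogeneousComponent_eq_zero _ _ (by omega)
      simp [this]
    · simp [Finset.sum_range_succ]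
  have h1 : homogeneousComponent 2 P = P := by
    rw [homogeneousComponent_of_mem hP]; simp
  rw [← h1, h]
  conv_lhs => rw [h0, add_mul, map_add]
  have h2 : homogeneousComponent 2 (homogeneousComponent 0 d * u) = 0 := by
    rw [homogeneousComponent_zero, homogeneousComponent_C_mul,
      homogeneousComponent_eq_zero _ _ (by omega), mul_zero]
  have h3 := homogeneousComponent_mul_of_isHomogeneous
    (homogeneousComponent_isHomogeneous 1 d) 1 u
  rw [h2, zero_add, mul_comm, h3, mul_comm]

/-- In a factorial domain, a vector proportional to a primitive vector of length three is a
multiple of it. -/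
theorem exists_eq_mul_of_proportional {R : Type*} [CommRing R] [IsDomain R]
    [UniqueFactorizationMonoid R] (P G : Fin 3 → R) (h0 : P 0 ≠ 0)
    (hP : ∀ d, d ∣ P 0 → d ∣ P 1 → d ∣ P 2 → IsUnit d)
    (h : ∀ i j, G i * P j = G j * P i) : ∃ b, ∀ i, G i = b * P i := by
  obtain ⟨u, v, c, huv, hu, hv⟩ := UniqueFactorizationMonoid.exists_reduced_factors (P 0) h0 (P 1)
  have hc : c ≠ 0 := by rintro rfl; simp at hu; exact h0 hu.symm
  have hu0 : u ≠ 0 := by rintro rfl; simp at hu; exact h0 hu.symm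
  have h1 : G 0 * v = G 1 * u := by
    apply mul_left_cancel₀ hc
    have := h 0 1
    rw [← hu, ← hv] at this
    linear_combination this
  obtain ⟨b', hb'⟩ : u ∣ G 0 := huv.dvd_of_dvd_mul_right ⟨G 1, by rw [h1]; ring⟩
  have h2 : b' * P 2 = c * G 2 := by
    apply mul_left_cancel₀ hu0
    have := h 0 2
    rw [← hu, hb'] at this
    linear_combination this
  have hrel : IsRelPrime c (P 2) := fun d hd hd2 =>
    hP d (hu ▸ dvd_mul_of_dvd_left hd u) (hv ▸ dvd_mul_of_dvd_left hd v) hd2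
  obtain ⟨b, hb⟩ : c ∣ b' := hrel.dvd_of_dvd_mul_right ⟨G 2, h2⟩
  have e0 : G 0 = b * P 0 := by rw [hb', hb, ← hu]; ring
  refine ⟨b, fun i => ?_⟩
  apply mul_right_cancel₀ h0
  rw [← h 0 i, e0]; ring

/-- Linear syzygies of three independent linear forms: the entries of such a syzygy are themselves
linearly dependent. -/
theorem dependent_of_linear_syzygy {V : Type*} [AddCommGroup V] [Module ℂ V]
    (a u : Fin 3 → Dual ℂ V) (ha : Function.Surjective (LinearMap.pi a)) (hu : u ≠ 0)
    (h : ∀ x, ∑ i, a i x * u i x = 0) : ∃ c : Fin 3 → ℂ, c ≠ 0 ∧ ∀ x, ∑ i, c i * u i x = 0 := by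
  simp only [Fin.sum_univ_three] at h ⊢
  have hsurj : ∀ u v w : ℂ, ∃ e, a 0 e = u ∧ a 1 e = v ∧ a 2 e = w := fun u v w => by
    obtain ⟨e, he⟩ := ha ![u, v, w]
    exact ⟨e, by simpa using congrFun he 0, by simpa using congrFun he 1,
      by simpa using congrFun he 2⟩
  have h2 : ∀ x, a 0 x = 0 → a 1 x = 0 → u 2 x = 0 := fun x h0 h1 => by
    have := lin_mul_lin_eq_zero (LinearMap.ker (a 0) ⊓ LinearMap.ker (a 1)) (a 2) (u 2)
      fun y hy => by
        have := h y
        rw [LinearMap.mem_ker.mp hy.1, LinearMap.mem_ker.mp hy.2] at this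
        simpa using this
    refine (this.resolve_left fun h' => ?_) x ⟨h0, h1⟩
    obtain ⟨e, h0, h1, h2⟩ := hsurj 0 0 1
    rw [h' e ⟨h0, h1⟩] at h2
    exact zero_ne_one h2
  obtain ⟨c, hc⟩ := exists_combination ![a 0, a 1] (u 2) fun x hx =>
    h2 x (by simpa using hx 0) (by simpa using hx 1)
  simp only [Fin.sum_univ_two, Matrix.cons_val_zero, Matrix.cons_val_one] at hc
  have h3 : ∀ x, a 0 x * (u 0 + c 0 • a 2) x + a 1 x * (u 1 + c 1 • a 2) x = 0 := fun x => by
    simp only [LinearMap.add_apply, LinearMap.smul_apply, smul_eq_mul]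
    linear_combination h x - a 2 x * hc x
  have h4 : ∀ x, a 1 x = 0 → (u 0 + c 0 • a 2) x = 0 := fun x h1 => by
    have := lin_mul_lin_eq_zero (LinearMap.ker (a 1)) (a 0) (u 0 + c 0 • a 2)
      fun y hy => by
        have := h3 y
        rw [LinearMap.mem_ker.mp hy] at this
        simpa using this
    refine (this.resolve_left fun h' => ?_) x h1
    obtain ⟨e, h0, h1, -⟩ := hsurj 1 0 0
    rw [h' e h1] at h0
    exact zero_ne_one h0
  obtain ⟨d, hd⟩ := exists_combination ![a 1] (u 0 + c 0 • a 2) fun x hx =>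
    h4 x (by simpa using hx 0)
  simp only [Fin.sum_univ_one, Matrix.cons_val_zero, LinearMap.add_apply, LinearMap.smul_apply,
    smul_eq_mul] at hd
  have h5 : ∀ x, u 1 x = -(d 0 * a 0 x) - c 1 * a 2 x := fun x => by
    have := lin_mul_lin_eq_zero ⊤ (a 1) (u 1 + c 1 • a 2 + d 0 • a 0) fun y _ => by
      have := h3 y
      simp only [LinearMap.add_apply, LinearMap.smul_apply, smul_eq_mul] at this ⊢
      linear_combination this - a 0 y * hd y
    have h6 := (this.resolve_left fun h' => by
      obtain ⟨e, -, h1, -⟩ := hsurj 0 1 0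
      rw [h' e trivial] at h1
      exact zero_ne_one h1) x trivial
    simp only [LinearMap.add_apply, LinearMap.smul_apply, smul_eq_mul] at h6
    linear_combination h6
  refine ⟨![c 1, -c 0, -d 0], fun h0 => hu ?_, fun x => ?_⟩
  · have e0 : c 1 = 0 := by simpa using congrFun h0 0
    have e1 : c 0 = 0 := by simpa using congrFun h0 1
    have e2 : d 0 = 0 := by simpa using congrFun h0 2
    ext i x
    fin_cases i
    · simpa [e1, e2] using hd x
    · simpa [e0, e2] using h5 x
    · simpa [e0, e1] using hc x
  · simp
    linear_combination c 1 * hd x - c 0 * h5 x - d 0 * hc x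

/-- Hilbert–Burch for a `3 × 2` matrix of linear forms: if the `2 × 2` minors are linearly
independent then every quadratic syzygy of them is a combination of the two columns. The cross
product of the syzygy with the first column is orthogonal to both, hence proportional to the vector
of minors, and a multiple of it since the minors have no common factor. -/
theorem hilbert_burch (a l : Fin 3 → Dual ℂ (Fin n → ℂ))
    (ha : Function.Surjective (LinearMap.pi a)) (Q R : Fin 3 → QuadraticForm ℂ (Fin n → ℂ))
    (hQ0 : ∀ x, Q 0 x = l 1 x * a 2 x - l 2 x * a 1 x)
    (hQ1 : ∀ x, Q 1 x = l 2 x * a 0 x - l 0 x * a 2 x)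
    (hQ2 : ∀ x, Q 2 x = l 0 x * a 1 x - l 1 x * a 0 x)
    (hind : ∀ c : Fin 3 → ℂ, (∀ x, ∑ i, c i * Q i x = 0) → c = 0)
    (h : ∀ x, ∑ i, Q i x * R i x = 0) :
    ∃ s t : Dual ℂ (Fin n → ℂ), ∀ i x, R i x = s x * a i x + t x * l i x := by
  choose P hP hPe using fun i => exists_poly_of_quadraticForm (Q i)
  choose S hS hSe using fun i => exists_poly_of_quadraticForm (R i)
  let A := fun i => linPoly (a i)
  have hAe : ∀ i x, eval x (A i) = a i x := fun i x => eval_linPoly _ _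
  have hA : ∀ i, (A i).IsHomogeneous 1 := fun i => isHomogeneous_linPoly _
  -- the cross product of the syzygy with the first column
  let G : Fin 3 → MvPolynomial (Fin n) ℂ :=
    ![S 1 * A 2 - S 2 * A 1, S 2 * A 0 - S 0 * A 2, S 0 * A 1 - S 1 * A 0]
  have haP : ∀ x, a 0 x * Q 0 x + a 1 x * Q 1 x + a 2 x * Q 2 x = 0 := fun x => by
    rw [hQ0, hQ1, hQ2]; ring
  simp only [Fin.sum_univ_three] at h hind
  have hP0 : ∀ i, P i ≠ 0 := fun i hi => by
    have hq : ∀ x, Q i x = 0 := fun x => by rw [← hPe, hi, map_zero]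
    have := hind (Pi.single i 1) fun x => by
      fin_cases i <;> simpa [Pi.single_apply] using hq x
    simpa using congrFun this i
  have hprop : ∀ i j, G i * P j = G j * P i := by
    have h01 : G 0 * P 1 = G 1 * P 0 := MvPolynomial.funext fun x => by
      simp only [G, Matrix.cons_val_zero, Matrix.cons_val_one, map_mul, map_sub, hSe, hAe, hPe]
      linear_combination a 2 x * h x - R 2 x * haP x
    have h02 : G 0 * P 2 = G 2 * P 0 := MvPolynomial.funext fun x => by
      simp only [G, Matrix.cons_val, map_mul, map_sub, hSe, hAe, hPe]
      linear_combination -a 1 x * h x + R 1 x * haP x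
    have h12 : G 1 * P 2 = G 2 * P 1 := MvPolynomial.funext fun x => by
      simp only [G, Matrix.cons_val, map_mul, map_sub, hSe, hAe, hPe]
      linear_combination a 0 x * h x - R 0 x * haP x
    intro i j
    match i, j with
    | 0, 0 => rfl
    | 0, 1 => exact h01
    | 0, 2 => exact h02
    | 1, 0 => exact h01.symm
    | 1, 1 => rfl
    | 1, 2 => exact h12
    | 2, 0 => exact h02.symm
    | 2, 1 => exact h12.symm
    | 2, 2 => rfl
  have hprim : ∀ d, d ∣ P 0 → d ∣ P 1 → d ∣ P 2 → IsUnit d := by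
    intro d h0 h1 h2
    have hd : ∀ i, d ∣ P i := fun i => by
      match i with
      | 0 => exact h0
      | 1 => exact h1
      | 2 => exact h2
    choose u hu using hd
    have hd0 : d ≠ 0 := by rintro rfl; exact hP0 0 (by rw [hu, zero_mul])
    have hu0 : ∀ i, u i ≠ 0 := fun i hi => hP0 i (by rw [hu, hi, mul_zero])
    have hdeg : ∀ i, d.totalDegree + (u i).totalDegree = 2 := fun i => by
      rw [← totalDegree_mul_of_isDomain hd0 (hu0 i), ← hu, (hP i).totalDegree (hP0 i)]
    rcases Nat.lt_or_ge d.totalDegree 1 with h1 | h1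
    · have hc := totalDegree_eq_zero_iff_eq_C.mp (Nat.lt_one_iff.mp h1)
      rw [hc]
      refine IsUnit.map C (isUnit_iff_ne_zero.mpr fun h0 => hd0 ?_)
      rw [hc, h0, C_0]
    · exfalso
      rcases Nat.lt_or_ge d.totalDegree 2 with h2 | h2
      · have e : ∀ i, P i = homogeneousComponent 1 d * homogeneousComponent 1 (u i) := fun i =>
          eq_mul_components_of_isHomogeneous (hP i) (by omega) (by have := hdeg i; omega) (hu i)
        obtain ⟨δ, hδ⟩ := exists_linearForm_of_isHomogeneous
          (homogeneousComponent_isHomogeneous 1 d)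
        choose υ hυ using fun i => exists_linearForm_of_isHomogeneous
          (homogeneousComponent_isHomogeneous 1 (u i))
        have e' : ∀ i x, Q i x = δ x * υ i x := fun i x => by
          rw [← hPe, e, map_mul, hδ, hυ]
        have hsyz : ∀ x ∈ (⊤ : Submodule ℂ (Fin n → ℂ)), (∑ i, linMulLin (a i) (υ i)) x = 0 := by
          refine quad_eq_zero_of_mul_eq_zero ⊤ δ _ ?_ fun x _ => ?_
          · by_contra! hz
            exact hP0 0 (MvPolynomial.funext fun x => by
              rw [hPe, e', hz x trivial, zero_mul, map_zero])
          · simp only [Fin.sum_univ_three, _root_.add_apply, linMulLin_apply]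
            have := haP x
            simp only [e'] at this
            linear_combination this
        obtain ⟨c, hc0, hc⟩ := dependent_of_linear_syzygy a υ ha
          (fun hz => hP0 0 (MvPolynomial.funext fun x => by
            rw [hPe, e', hz]; simp))
          (fun x => by simpa [Fin.sum_univ_three] using hsyz x trivial)
        refine hc0 (hind c fun x => ?_)
        have := hc x
        simp only [Fin.sum_univ_three] at this
        simp only [e']
        linear_combination δ x * this
      · have hc : ∀ i, u i = C (coeff 0 (u i)) := fun i =>
          totalDegree_eq_zero_iff_eq_C.mp (by have := hdeg i; omega)
        have := hind ![coeff 0 (u 1), -coeff 0 (u 0), 0] fun x => by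
          have e : ∀ i, Q i x = eval x d * coeff 0 (u i) := fun i => by
            rw [← hPe, hu i, map_mul]
            conv_lhs => rw [hc i]
            simp
          simp only [e, Matrix.cons_val]
          ring
        apply hu0 1
        have h1 := congrFun this 0
        simp only [Matrix.cons_val_zero, Pi.zero_apply] at h1
        rw [hc 1, h1, C_0]
  obtain ⟨b, hb⟩ := exists_eq_mul_of_proportional P G (hP0 0) hprim hprop
  have hG : ∀ i, (G i).IsHomogeneous 3 := fun i => by
    match i with
    | 0 => exact ((hS 1).mul (hA 2)).sub ((hS 2).mul (hA 1))
    | 1 => exact ((hS 2).mul (hA 0)).sub ((hS 0).mul (hA 2))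
    | 2 => exact ((hS 0).mul (hA 1)).sub ((hS 1).mul (hA 0))
  have hb1 : ∀ i, G i = homogeneousComponent 1 b * P i := fun i => by
    rw [← homogeneousComponent_mul_of_isHomogeneous (hP i), ← hb,
      homogeneousComponent_of_mem (hG i)]
    simp
  obtain ⟨β, hβ⟩ := exists_linearForm_of_isHomogeneous (homogeneousComponent_isHomogeneous 1 b)
  have hGe : ∀ i x, eval x (G i) = β x * Q i x := fun i x => by
    rw [hb1, map_mul, hβ, hPe]
  have g0 : ∀ x, R 1 x * a 2 x - R 2 x * a 1 x = β x * Q 0 x := fun x => by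
    rw [← hGe]; simp [G, hSe, hAe]
  have g1 : ∀ x, R 2 x * a 0 x - R 0 x * a 2 x = β x * Q 1 x := fun x => by
    rw [← hGe]; simp [G, hSe, hAe]
  have g2 : ∀ x, R 0 x * a 1 x - R 1 x * a 0 x = β x * Q 2 x := fun x => by
    rw [← hGe]; simp [G, hSe, hAe]
  have hsurj : ∀ u v w : ℂ, ∃ e, a 0 e = u ∧ a 1 e = v ∧ a 2 e = w := fun u v w => by
    obtain ⟨e, he⟩ := ha ![u, v, w]
    exact ⟨e, by simpa using congrFun he 0, by simpa using congrFun he 1,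
      by simpa using congrFun he 2⟩
  -- the difference with `β` times the second column is proportional to the first column
  let D := fun i => R i - linMulLin β (l i)
  have hD : ∀ i x, D i x = R i x - β x * l i x := fun i x => by simp [D]
  obtain ⟨s, hs0, hs1⟩ := koszul_two (a 1) (a 0)
    (by obtain ⟨e, h0, h1, -⟩ := hsurj 0 1 0; exact ⟨e, h0, by simp [h1]⟩)
    (by obtain ⟨e, h0, -⟩ := hsurj 1 0 0; intro h; simp [h] at h0)
    (D 0) (-D 1) (fun x => by
      simp only [_root_.neg_apply, hD]
      have := g2 x; rw [hQ2] at this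
      linear_combination this)
  refine ⟨s, β, fun i x => ?_⟩
  have e0 := hs0 x
  have e1 := hs1 x
  simp only [_root_.neg_apply, hD] at e0 e1
  match i with
  | 0 => linear_combination e0
  | 1 => linear_combination -e1
  | 2 =>
    have := quad_eq_zero_of_mul_eq_zero ⊤ (a 0) (D 2 - linMulLin s (a 2))
      (by obtain ⟨e, h0, -⟩ := hsurj 1 0 0; exact ⟨e, trivial, by simp [h0]⟩)
      (fun y _ => by
        have e0 := hs0 y
        simp only [hD] at e0
        simp only [_root_.sub_apply, hD, linMulLin_apply]
        have := g1 y; rw [hQ1] at this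
        linear_combination this + a 2 y * e0) x trivial
    simp only [_root_.sub_apply, hD, linMulLin_apply] at this
    linear_combination this

end Polynomials
end QuadBir

open MvPolynomial
namespace QuadBir
open QuadraticMap Module

/-! ### Isotropic subspaces and split forms of a quadric -/

section Isotropic
variable {Y : Type*} [AddCommGroup Y] [Module ℂ Y] [FiniteDimensional ℂ Y]

theorem finrank_le_finrank_commonKernel_add {n : ℕ} (f : Fin n → Dual ℂ Y) :
    finrank ℂ Y ≤ finrank ℂ (LinearMap.ker (LinearMap.pi f)) + n := by
  have h1 := LinearMap.finrank_range_add_finrank_ker (LinearMap.pi f)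
  have h2 := Submodule.finrank_le (LinearMap.range (LinearMap.pi f))
  rw [Module.finrank_fin_fun] at h2
  omega

theorem polar_eq_of_eq_sum_mul {V : Type*} [AddCommGroup V] [Module ℂ V] {n : ℕ}
    {q : QuadraticForm ℂ V} {f g : Fin n → Dual ℂ V}
    (h : ∀ y, q y = ∑ i, f i y * g i y) (x y : V) :
    polar q x y = ∑ i, (f i x * g i y + f i y * g i x) := by
  simp only [polar, h, map_add, ← Finset.sum_sub_distrib]
  exact Finset.sum_congr rfl fun i _ => by ring

/-- A quadratic form with small radical is not a sum of few products of linear forms. -/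
theorem finrank_le_of_eq_sum_mul {n : ℕ} (q : QuadraticForm ℂ Y)
    (hrad : finrank ℂ (LinearMap.ker q.polarBilin) ≤ 1) (f g : Fin n → Dual ℂ Y)
    (h : ∀ y, q y = ∑ i, f i y * g i y) : finrank ℂ Y ≤ 2 * n + 1 := by
  have h1 := finrank_le_finrank_commonKernel_add (Fin.append f g)
  have h2 : LinearMap.ker (LinearMap.pi (Fin.append f g)) ≤ LinearMap.ker q.polarBilin := by
    intro y hy
    have hy' : ∀ i, Fin.append f g i y = 0 := fun i => congrFun (LinearMap.mem_ker.mp hy) i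
    have hf : ∀ i, f i y = 0 := fun i => by simpa using hy' (Fin.castAdd n i)
    have hg : ∀ i, g i y = 0 := fun i => by
      have := hy' (Fin.natAdd n i)
      rwa [Fin.append_right] at this
    rw [LinearMap.mem_ker]
    ext z
    simp [polar_eq_of_eq_sum_mul h, hf, hg]
  have h3 := Submodule.finrank_mono h2
  omega

theorem exists_isotropic_combination {V : Type*} [AddCommGroup V] [Module ℂ V]
    (q : QuadraticForm ℂ V) (y z : V) :
    ∃ s t : ℂ, (s ≠ 0 ∨ t ≠ 0) ∧ q (s • y + t • z) = 0 := by
  by_cases hy : q y = 0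
  · exact ⟨1, 0, Or.inl one_ne_zero, by simp [hy]⟩
  · obtain ⟨s, hs⟩ := exists_quadratic_eq_zero (b := polar q z y) (c := q z) hy
      (IsAlgClosed.exists_eq_mul_self _)
    refine ⟨s, 1, Or.inr one_ne_zero, ?_⟩
    rw [one_smul, add_comm, map_add_smul]
    simp only [smul_eq_mul]
    linear_combination hs

/-- An isotropic subspace `W` whose orthogonal space exceeds it by at least two dimensions can be
enlarged: a binary quadratic form over `ℂ` has a zero. -/
theorem exists_isotropic_lt (q : QuadraticForm ℂ Y) (W : Submodule ℂ Y)
    (hW : ∀ w ∈ W, q w = 0) (hdim : 2 * finrank ℂ W + 2 ≤ finrank ℂ Y) :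
    ∃ W' : Submodule ℂ Y, W < W' ∧ ∀ w ∈ W', q w = 0 := by
  let B : LinearMap.BilinForm ℂ Y := q.polarBilin
  have hB : B.IsRefl := fun x y h => by
    have : polar q x y = 0 := h
    show polar q y x = 0
    rw [polar_comm, this]
  let U := B.orthogonal W
  have hWpol : ∀ w ∈ W, ∀ w' ∈ W, polar q w w' = 0 := fun w hw w' hw' => by
    simp [polar, hW _ (W.add_mem hw hw'), hW _ hw, hW _ hw']
  have hWU : W ≤ U := fun w hw w' hw' => hWpol w' hw' w hw
  have hU : finrank ℂ Y ≤ finrank ℂ W + finrank ℂ U := by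
    rw [LinearMap.BilinForm.finrank_add_finrank_orthogonal hB]
    exact Nat.le_add_right _ _
  have hex : ∀ W' : Submodule ℂ Y, finrank ℂ W' < finrank ℂ U → ∃ y ∈ U, y ∉ W' := by
    intro W' h'
    by_contra! hc
    exact absurd (Submodule.finrank_mono (s := U) (t := W') hc) (by omega)
  obtain ⟨y, hyU, hyW⟩ := hex W (by omega)
  obtain ⟨z, hzU, hzW⟩ := hex (W ⊔ Submodule.span ℂ {y}) (by
    have := Submodule.finrank_add_le_finrank_add_finrank W (Submodule.span ℂ {y})
    have h1 : finrank ℂ (Submodule.span ℂ {y}) ≤ 1 := (finrank_span_le_card {y}).trans (by simp)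
    omega)
  obtain ⟨s, t, hst, hq⟩ := exists_isotropic_combination q y z
  have hmem : s • y + t • z ∉ W := fun hm => by
    by_cases ht : t = 0
    · subst ht
      have hs : s ≠ 0 := hst.resolve_right (by simp)
      rw [zero_smul, add_zero] at hm
      exact hyW ((W.smul_mem_iff hs).mp hm)
    · refine hzW ?_
      have h1 : t • z ∈ W ⊔ Submodule.span ℂ {y} := by
        have h2 : s • y ∈ W ⊔ Submodule.span ℂ {y} :=
          Submodule.smul_mem _ _ (Submodule.mem_sup_right (Submodule.mem_span_singleton_self y))
        have h3 : s • y + t • z ∈ W ⊔ Submodule.span ℂ {y} := Submodule.mem_sup_left hm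
        simpa using Submodule.sub_mem _ h3 h2
      exact (Submodule.smul_mem_iff _ ht).mp h1
  refine ⟨W ⊔ Submodule.span ℂ {s • y + t • z}, ?_, fun w hw => ?_⟩
  · refine lt_of_le_of_ne le_sup_left fun h => hmem ?_
    rw [h]
    exact Submodule.mem_sup_right (Submodule.mem_span_singleton_self _)
  · obtain ⟨w₁, hw₁, w₂, hw₂, rfl⟩ := Submodule.mem_sup.mp hw
    obtain ⟨c, rfl⟩ := Submodule.mem_span_singleton.mp hw₂
    have hp : polar q w₁ (s • y + t • z) = 0 :=
      (U.add_mem (U.smul_mem s hyU) (U.smul_mem t hzU)) w₁ hw₁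
    rw [map_add_smul, hW _ hw₁, hp, hq]
    simp

theorem exists_isotropic_ge (q : QuadraticForm ℂ Y) (hY : finrank ℂ Y = 6) (W : Submodule ℂ Y)
    (hW : ∀ w ∈ W, q w = 0) :
    ∃ W' : Submodule ℂ Y, W ≤ W' ∧ (∀ w ∈ W', q w = 0) ∧ 3 ≤ finrank ℂ W' := by
  by_cases h : 3 ≤ finrank ℂ W
  · exact ⟨W, le_rfl, hW, h⟩
  · obtain ⟨W₁, hlt, h₁⟩ := exists_isotropic_lt q W hW (by omega)
    have := Submodule.finrank_lt_finrank_of_lt hlt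
    obtain ⟨W₂, hle, h₂, h₃⟩ := exists_isotropic_ge q hY W₁ h₁
    exact ⟨W₂, hlt.le.trans hle, h₂, h₃⟩
termination_by 3 - finrank ℂ W

/-- A quadratic form of rank at least five in six variables is a sum of three products of linear
forms, the first factors being independent and vanishing on a given isotropic subspace. -/
theorem exists_split_form (q : QuadraticForm ℂ Y) (hY : finrank ℂ Y = 6)
    (hrad : finrank ℂ (LinearMap.ker q.polarBilin) ≤ 1) (W : Submodule ℂ Y)
    (hW : ∀ w ∈ W, q w = 0) :
    ∃ f g : Fin 3 → Dual ℂ Y, Function.Surjective (LinearMap.pi f) ∧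
      (∀ w ∈ W, ∀ i, f i w = 0) ∧ ∀ y, q y = ∑ i, f i y * g i y := by
  obtain ⟨W', hle, hq', hdim⟩ := exists_isotropic_ge q hY W hW
  have hann := Subspace.finrank_add_finrank_dualAnnihilator_eq W'
  generalize hn : finrank ℂ W'.dualAnnihilator = n at hann
  let b : Basis (Fin n) ℂ W'.dualAnnihilator := finBasisOfFinrankEq ℂ _ hn
  let f : Fin n → Dual ℂ Y := fun i => (b i : Dual ℂ Y)
  have hker : ∀ y, (∀ i, f i y = 0) → y ∈ W' := fun y hy => by
    rw [← Subspace.dualAnnihilator_dualCoannihilator_eq (W := W'),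
      Submodule.mem_dualCoannihilator]
    intro φ hφ
    have h1 := b.sum_repr ⟨φ, hφ⟩
    have h2 := congrArg (fun ψ : W'.dualAnnihilator => (ψ : Dual ℂ Y) y) h1
    simp only [Submodule.coe_sum, LinearMap.sum_apply, Submodule.coe_smul,
      LinearMap.smul_apply] at h2
    rw [← h2]
    exact Finset.sum_eq_zero fun i _ => by rw [hy i, smul_zero]
  obtain ⟨g, hg⟩ := exists_eq_sum_mul f q fun y hy => hq' y (hker y hy)
  have h6 := finrank_le_of_eq_sum_mul q hrad f g hg
  obtain rfl : n = 3 := by omega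
  refine ⟨f, g, (pi_surjective_or_dependent f).resolve_right ?_, fun w hw i => ?_, hg⟩
  · rintro ⟨c, hc, h⟩
    have hli : LinearIndependent ℂ f :=
      b.linearIndependent.map' W'.dualAnnihilator.subtype (Submodule.ker_subtype _)
    refine hc (funext fun i => ?_)
    refine Fintype.linearIndependent_iff.mp hli c ?_ i
    ext x
    simpa using h x
  · exact (Submodule.mem_dualAnnihilator _).mp (b i).2 w (hle hw)

end Isotropic

/-! ### Quadratic maps into a quadric -/

section Tangent
variable {V Y : Type*} [AddCommGroup V] [Module ℂ V] [AddCommGroup Y] [Module ℂ Y]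

/-- At a zero `p` of a quadratic map into a quadric, the image of the differential is isotropic,
and orthogonal to the map in the sense of the second conclusion. -/
theorem isotropic_polar {Φ : QuadraticMap ℂ V Y} {q : QuadraticForm ℂ Y} (h : ∀ x, q (Φ x) = 0)
    {p : V} (hp : Φ p = 0) (x : V) :
    q (polar Φ p x) = 0 ∧ polar q (Φ x) (polar Φ p x) = 0 := by
  have key : ∀ s : ℂ, s * polar q (Φ x) (polar Φ p x) + s * s * q (polar Φ p x) = 0 := fun s => by
    have h1 := h (x + s • p)
    rw [map_add_smul, hp, smul_zero, add_zero, map_add_smul, h, polar_comm Φ x p] at h1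
    simpa using h1
  have h1 := key 1
  have h2 := key (-1)
  constructor
  · linear_combination (1 / 2) * h1 + (1 / 2) * h2
  · linear_combination (1 / 2) * h1 - (1 / 2) * h2

end Tangent
end QuadBir

open MvPolynomial
namespace QuadBir
open QuadraticMap Module

/-! ### Splitting a quadratic parametrization of a quadric at a base point -/

/-- The linear algebra content of the hypotheses on a quadratic birational map onto a quadric
`q = 0` of rank at least five, with reduced base locus: the image spans and lies on the quadric,
the map is generically injective up to scalars, and `reduced` says that a linear form vanishing on
the zeros of `Φ` vanishes on every arc `v + ε u₁ + ε² u₂` (modulo `ε³`) of zeros of `Φ` with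
`v ≠ 0`. In `generically_injective`, the forms `ξ` and `η` allow for avoiding two given
hyperplanes. -/
structure IsQuadricParametrization (Φ : QuadraticMap ℂ (Fin 5 → ℂ) (Fin 6 → ℂ))
    (q : QuadraticForm ℂ (Fin 6 → ℂ)) : Prop where
  on_quadric : ∀ x, q (Φ x) = 0
  spans : ∀ ρ : Dual ℂ (Fin 6 → ℂ), (∀ x, ρ (Φ x) = 0) → ρ = 0
  generically_injective : ∀ ξ η : Dual ℂ (Fin 5 → ℂ), ξ ≠ 0 → η ≠ 0 →
    ∃ x, ξ x ≠ 0 ∧ η x ≠ 0 ∧ ∀ x', Φ x' = Φ x → ∃ c : ℂ, x' = c • x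
  reduced : ∀ ξ : Dual ℂ (Fin 5 → ℂ), (∀ x, Φ x = 0 → ξ x = 0) →
    ∀ v u₁ u₂, v ≠ 0 → Φ v = 0 → polar Φ v u₁ = 0 → Φ u₁ + polar Φ v u₂ = 0 → ξ u₂ = 0
  finrank_radical : finrank ℂ (LinearMap.ker q.polarBilin) ≤ 1

theorem exists_dual_ne_zero_of_lt_top {V : Type*} [AddCommGroup V] [Module ℂ V]
    {W : Submodule ℂ V} (h : W < ⊤) : ∃ ξ : Dual ℂ V, ξ ≠ 0 ∧ ∀ w ∈ W, ξ w = 0 := by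
  obtain ⟨ξ, h0, hle⟩ := Submodule.exists_le_ker_of_lt_top W h
  exact ⟨ξ, h0, fun w hw => hle hw⟩

theorem exists_ne_zero_of_four_forms (a : Fin 4 → Dual ℂ (Fin 5 → ℂ)) :
    ∃ v, v ≠ 0 ∧ ∀ i, a i v = 0 := by
  have h := finrank_le_finrank_commonKernel_add a
  rw [Module.finrank_fin_fun] at h
  obtain ⟨v, hv, h0⟩ := Submodule.exists_mem_ne_zero_of_ne_bot
    (p := LinearMap.ker (LinearMap.pi a)) (by
      intro hb; rw [hb, finrank_bot] at h; omega)
  exact ⟨v, h0, fun i => congrFun (LinearMap.mem_ker.mp hv) i⟩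

namespace IsQuadricParametrization

variable {Φ : QuadraticMap ℂ (Fin 5 → ℂ) (Fin 6 → ℂ)} {q : QuadraticForm ℂ (Fin 6 → ℂ)}

/-- No direction is forgotten by the map. -/
theorem eq_zero_of_invariant (H : IsQuadricParametrization Φ q) {v : Fin 5 → ℂ}
    (h : ∀ x, Φ (x + v) = Φ x) : v = 0 := by
  have hlt : Submodule.span ℂ {v} < ⊤ := by
    refine Ne.lt_top fun ht => ?_
    have h1 : finrank ℂ (Submodule.span ℂ {v}) ≤ 1 := (finrank_span_le_card {v}).trans (by simp)
    rw [ht, finrank_top, Module.finrank_fin_fun] at h1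
    omega
  obtain ⟨ξ, h0, hξ⟩ := exists_dual_ne_zero_of_lt_top hlt
  obtain ⟨x, hx, -, hinj⟩ := H.generically_injective ξ ξ h0 h0
  obtain ⟨c, hc⟩ := hinj _ (h x)
  have hv : v = (c - 1) • x := by rw [sub_smul, one_smul, ← hc]; abel
  have h1 := hξ v (Submodule.mem_span_singleton_self v)
  rw [hv, map_smul, smul_eq_mul, mul_eq_zero] at h1
  rw [hv, h1.resolve_right hx, zero_smul]

theorem eq_zero_of_polar_eq_zero (H : IsQuadricParametrization Φ q) {v : Fin 5 → ℂ}
    (h : ∀ x, polar Φ v x = 0) : v = 0 := by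
  have h0 : Φ v = 0 := by
    have := polar_self Φ v
    rw [h v, two_nsmul] at this
    have h2 : (2 : ℂ) • Φ v = 0 := by rw [two_smul]; exact this.symm
    exact (smul_eq_zero.mp h2).resolve_left two_ne_zero
  refine H.eq_zero_of_invariant fun x => ?_
  have := map_add_smul Φ x v 1
  rw [one_smul, polar_comm, h, h0] at this
  simpa using this

theorem dependent_of_comp (H : IsQuadricParametrization Φ q) {n : ℕ}
    {f : Fin n → Dual ℂ (Fin 6 → ℂ)} (hf : Function.Surjective (LinearMap.pi f))
    {c : Fin n → ℂ} (hc : ∀ x, ∑ i, c i * f i (Φ x) = 0) : c = 0 := by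
  refine not_dependent_of_surjective hf fun y => ?_
  have := H.spans (∑ i, c i • f i) fun x => by simpa using hc x
  simpa using LinearMap.congr_fun this y

end IsQuadricParametrization

/-- A split form `∑ i, f i * g i` of `q` adapted to a base point `p` of `Φ`: the common kernel of
the `f i` contains the image of the differential of `Φ` at `p`. -/
structure IsSplitAt (Φ : QuadraticMap ℂ (Fin 5 → ℂ) (Fin 6 → ℂ))
    (q : QuadraticForm ℂ (Fin 6 → ℂ)) (p : Fin 5 → ℂ)
    (f g : Fin 3 → Dual ℂ (Fin 6 → ℂ)) : Prop where
  surjective : Function.Surjective (LinearMap.pi f)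
  vanish : ∀ x i, f i (polar Φ p x) = 0
  eq_sum : ∀ y, q y = ∑ i, f i y * g i y

namespace IsSplitAt

variable {Φ : QuadraticMap ℂ (Fin 5 → ℂ) (Fin 6 → ℂ)} {q : QuadraticForm ℂ (Fin 6 → ℂ)}
  {p : Fin 5 → ℂ} {f g : Fin 3 → Dual ℂ (Fin 6 → ℂ)}

/-- The image of the differential is orthogonal to the map, which is a syzygy between the
components `f i ∘ Φ` with linear coefficients. -/
theorem sum_mul_polar (h : IsSplitAt Φ q p f g) (H : IsQuadricParametrization Φ q)
    (hp : Φ p = 0) (x : Fin 5 → ℂ) : ∑ i, g i (polar Φ p x) * f i (Φ x) = 0 := by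
  have h1 := (isotropic_polar H.on_quadric hp x).2
  rw [polar_eq_of_eq_sum_mul h.eq_sum] at h1
  rw [← h1]
  exact Finset.sum_congr rfl fun i _ => by rw [h.vanish]; ring

/-- Change of the split form making the last second factor a prescribed combination. -/
theorem exists_reduce (h : IsSplitAt Φ q p f g) {d : Fin 3 → ℂ} (hd : d ≠ 0) :
    ∃ f' g', IsSplitAt Φ q p f' g' ∧ ∀ y, g' 2 y = ∑ i, d i * g i y := by
  obtain ⟨i₀, hi₀⟩ := Function.ne_iff.mp hd
  let σ := Equiv.swap i₀ 2
  have hσ : d (σ 2) ≠ 0 := by simpa [σ] using hi₀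
  let F := fun i => f (σ i)
  let G := fun i => g (σ i)
  let D := fun i => d (σ i)
  have hD : D 2 ≠ 0 := hσ
  have hFind : ∀ c : Fin 3 → ℂ, (∀ y, ∑ i, c i * F i y = 0) → c = 0 := fun c hc => by
    have := not_dependent_of_surjective h.surjective (c := fun i => c (σ i)) fun y => by
      rw [← hc y, ← Equiv.sum_comp σ]
      simp [F, σ]
    ext i
    have h1 := congrFun this (σ i)
    simpa [σ] using h1
  simp only [Fin.sum_univ_three] at hFind
  refine ⟨![F 0 - (D 0 / D 2) • F 2, F 1 - (D 1 / D 2) • F 2, (D 2)⁻¹ • F 2],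
    ![G 0, G 1, ∑ i, d i • g i], ⟨?_, ?_, ?_⟩, fun y => by simp⟩
  · refine (pi_surjective_or_dependent _).resolve_right ?_
    rintro ⟨c, hc0, hc⟩
    have := hFind ![c 0, c 1, (c 2 - c 0 * D 0 - c 1 * D 1) / D 2] fun y => by
      have := hc y
      simp only [Fin.sum_univ_three, Matrix.cons_val, LinearMap.sub_apply, LinearMap.smul_apply,
        smul_eq_mul] at this ⊢
      rw [← this]; field_simp; ring
    have e0 : c 0 = 0 := by simpa using congrFun this 0
    have e1 : c 1 = 0 := by simpa using congrFun this 1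
    have e2 : c 2 = 0 := by simpa [e0, e1, hD] using congrFun this 2
    refine hc0 (funext fun i => ?_)
    match i with
    | 0 => exact e0
    | 1 => exact e1
    | 2 => exact e2
  · intro x i
    have hF : ∀ i, F i (polar Φ p x) = 0 := fun i => h.vanish x _
    match i with
    | 0 => simp [hF]
    | 1 => simp [hF]
    | 2 => simp [hF]
  · intro y
    have e1 : q y = ∑ i, F i y * G i y := by
      rw [h.eq_sum y, ← Equiv.sum_comp σ]
    have e2 : ∑ i, d i * g i y = ∑ i, D i * G i y := by
      rw [← Equiv.sum_comp σ]
    rw [e1]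
    simp only [Fin.sum_univ_three, Matrix.cons_val, LinearMap.sub_apply, LinearMap.smul_apply,
      smul_eq_mul, LinearMap.add_apply] at e2 ⊢
    rw [e2]; field_simp; ring

/-- If `g 2` also kills the image of the differential, it may be exchanged with `f 2`: the forms
`f 0`, `f 1`, `g 2` are independent since `q` has rank at least five. -/
theorem exists_swap (h : IsSplitAt Φ q p f g) (H : IsQuadricParametrization Φ q)
    (hg : ∀ x, g 2 (polar Φ p x) = 0) : IsSplitAt Φ q p ![f 0, f 1, g 2] ![g 0, g 1, f 2] := by
  refine ⟨(pi_surjective_or_dependent _).resolve_right ?_, fun x i => ?_, fun y => ?_⟩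
  · rintro ⟨c, hc0, hc⟩
    simp only [Fin.sum_univ_three, Matrix.cons_val] at hc
    by_cases h2 : c 2 = 0
    · have := not_dependent_of_surjective h.surjective (c := c) fun y => by
        have := hc y
        rw [h2] at this
        rw [Fin.sum_univ_three, h2]
        linear_combination this
      exact hc0 this
    · have := finrank_le_of_eq_sum_mul q H.finrank_radical ![f 0, f 1]
        ![g 0 - (c 0 / c 2) • f 2, g 1 - (c 1 / c 2) • f 2] fun y => by
          have e1 := h.eq_sum y
          have e2 : g 2 y = -(c 0 / c 2) * f 0 y - (c 1 / c 2) * f 1 y := by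
            field_simp
            linear_combination hc y
          simp only [Fin.sum_univ_three, Fin.sum_univ_two, Matrix.cons_val, LinearMap.sub_apply,
            LinearMap.smul_apply, smul_eq_mul] at e1 ⊢
          rw [e1, e2]; ring
      rw [Module.finrank_fin_fun] at this
      omega
  · match i with
    | 0 => exact h.vanish x 0
    | 1 => exact h.vanish x 1
    | 2 => exact hg x
  · rw [h.eq_sum y]
    simp [Fin.sum_univ_three, mul_comm]

end IsSplitAt

/-- A split form at a base point where the differential has rank two modulo the radical of `q`. The
components `f i ∘ Φ` are multiples of one linear form `m`, and the cofactors of the first two are,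
up to order and sign, the linear forms `a 0`, `a 1` describing the differential. -/
structure IsDegenerateSplitAt (Φ : QuadraticMap ℂ (Fin 5 → ℂ) (Fin 6 → ℂ))
    (q : QuadraticForm ℂ (Fin 6 → ℂ)) (p : Fin 5 → ℂ)
    (f g : Fin 3 → Dual ℂ (Fin 6 → ℂ)) (a : Fin 3 → Dual ℂ (Fin 5 → ℂ))
    (m : Dual ℂ (Fin 5 → ℂ)) : Prop extends IsSplitAt Φ q p f g where
  polar_zero : ∀ x, g 0 (polar Φ p x) = a 0 x
  polar_one : ∀ x, g 1 (polar Φ p x) = a 1 x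
  polar_two : ∀ x, g 2 (polar Φ p x) = 0
  comp_zero : ∀ x, f 0 (Φ x) = a 1 x * m x
  comp_one : ∀ x, f 1 (Φ x) = -(a 0 x * m x)
  comp_two : ∀ x, f 2 (Φ x) = a 2 x * m x
  ne_zero : m ≠ 0
  surj : Function.Surjective (LinearMap.pi a)

variable {Φ : QuadraticMap ℂ (Fin 5 → ℂ) (Fin 6 → ℂ)} {q : QuadraticForm ℂ (Fin 6 → ℂ)}

/-- Split forms at a base point where the differential does not map into the radical: modulo the
radical, the rank of the differential is three or two. -/
theorem IsQuadricParametrization.exists_split (H : IsQuadricParametrization Φ q)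
    {p : Fin 5 → ℂ} (hp : Φ p = 0) (hpr : ∃ x y, polar q (polar Φ p x) y ≠ 0) :
    (∃ f g, IsSplitAt Φ q p f g ∧
      Function.Surjective (LinearMap.pi fun i => g i ∘ₗ polarBilin Φ p)) ∨
    ∃ f g a m, IsDegenerateSplitAt Φ q p f g a m := by
  obtain ⟨f, g, hf, hv, hs⟩ := exists_split_form q (Module.finrank_fin_fun ℂ) H.finrank_radical
    (LinearMap.range (polarBilin Φ p)) (by
      rintro _ ⟨x, rfl⟩
      exact (isotropic_polar H.on_quadric hp x).1)
  have h₀ : IsSplitAt Φ q p f g := ⟨hf, fun x i => hv _ ⟨x, rfl⟩ i, hs⟩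
  rcases pi_surjective_or_dependent (fun i => g i ∘ₗ polarBilin Φ p) with hsurj | ⟨d, hd0, hd⟩
  · exact Or.inl ⟨f, g, h₀, hsurj⟩
  right
  obtain ⟨f, g, h, hg⟩ := h₀.exists_reduce hd0
  have hg2 : ∀ x, g 2 (polar Φ p x) = 0 := fun x => by rw [hg]; exact hd x
  let a₀ := g 0 ∘ₗ polarBilin Φ p
  let a₁ := g 1 ∘ₗ polarBilin Φ p
  let φ := fun i => (f i).compQuadraticMap Φ
  have hφ : ∀ i x, φ i x = f i (Φ x) := fun i x => rfl
  have hsyz : ∀ x, a₀ x * φ 0 x + a₁ x * φ 1 x = 0 := fun x => by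
    have := h.sum_mul_polar H hp x
    rw [Fin.sum_univ_three, hg2, zero_mul, add_zero] at this
    exact this
  have hind : ∀ c : Fin 3 → ℂ, (∀ x, c 0 * φ 0 x + c 1 * φ 1 x + c 2 * φ 2 x = 0) → c = 0 :=
    fun c hc => H.dependent_of_comp h.surjective fun x => by
      rw [Fin.sum_univ_three]; exact hc x
  -- proportional `a₀`, `a₁` would both vanish, and the differential would map into the radical
  have hprop : ∀ (a : Dual ℂ (Fin 5 → ℂ)) (e₀ e₁ : ℂ), (e₀ ≠ 0 ∨ e₁ ≠ 0) →
      (∀ x, a₀ x = e₀ * a x) → (∀ x, a₁ x = e₁ * a x) → False := by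
    intro a e₀ e₁ he h0 h1
    by_cases ha : a = 0
    · obtain ⟨x, y, hxy⟩ := hpr
      apply hxy
      have e0 : g 0 (polar Φ p x) = 0 := by
        have := h0 x; rw [ha] at this; simpa [a₀] using this
      have e1 : g 1 (polar Φ p x) = 0 := by
        have := h1 x; rw [ha] at this; simpa [a₁] using this
      rw [polar_eq_of_eq_sum_mul h.eq_sum, Fin.sum_univ_three]
      simp [h.vanish, e0, e1, hg2]
    · obtain ⟨e, hae⟩ := exists_apply_eq_one ha
      have := quad_eq_zero_of_mul_eq_zero ⊤ a (e₀ • φ 0 + e₁ • φ 1) ⟨e, trivial, by simp [hae]⟩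
        fun x _ => by
          have := hsyz x
          rw [h0, h1] at this
          simp only [_root_.add_apply, _root_.smul_apply, smul_eq_mul]
          linear_combination this
      have := hind ![e₀, e₁, 0] fun x => by simpa using this x trivial
      rcases he with he | he
      · exact he (by simpa using congrFun this 0)
      · exact he (by simpa using congrFun this 1)
  have hnd : ∀ c : Fin 2 → ℂ, (∀ x, c 0 * a₀ x + c 1 * a₁ x = 0) → c = 0 := by
    intro c hc
    by_contra hc0
    by_cases h0 : c 0 = 0
    · have h1 : c 1 ≠ 0 := fun h1 => hc0 (by ext i; match i with | 0 => exact h0 | 1 => exact h1)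
      exact hprop a₀ 1 0 (Or.inl one_ne_zero) (fun x => by ring) fun x => by
        have := hc x
        rw [h0] at this
        simpa [h1] using this
    · exact hprop a₁ (-c 1 / c 0) 1 (Or.inr one_ne_zero)
        (fun x => by field_simp; linear_combination hc x) (fun x => by ring)
  have hsurj2 : Function.Surjective (LinearMap.pi ![a₀, a₁]) :=
    (pi_surjective_or_dependent _).resolve_right fun ⟨c, hc0, hc⟩ =>
      hc0 (hnd c fun x => by simpa using hc x)
  obtain ⟨m, hm0, hm1⟩ := koszul_two a₀ a₁
    (by obtain ⟨e, he⟩ := hsurj2 ![1, 0]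
        exact ⟨e, by simpa using congrFun he 1, by
          have : a₀ e = 1 := by simpa using congrFun he 0
          simp [this]⟩)
    (fun h1 => by
        have := hnd ![0, 1] fun x => by simp [h1]
        simpa using congrFun this 1) (φ 0) (φ 1) hsyz
  have hm : m ≠ 0 := fun hm => by
    have := hind ![1, 0, 0] fun x => by simp [hm0 x, hm]
    simpa using congrFun this 0
  -- on the hyperplane `m = 0` the equation `q (Φ x) = 0` reads `f 2 (Φ x) * g 2 (Φ x) = 0`
  have hcase : (∀ x ∈ LinearMap.ker m, φ 2 x = 0) ∨
      ∀ x ∈ LinearMap.ker m, (g 2).compQuadraticMap Φ x = 0 := by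
    refine quad_mul_quad_eq_zero _ _ _ fun x hx => ?_
    have h1 := H.on_quadric x
    rw [h.eq_sum, Fin.sum_univ_three, ← hφ, ← hφ, hm0, hm1, LinearMap.mem_ker.mp hx] at h1
    show f 2 (Φ x) * g 2 (Φ x) = 0
    simpa using h1
  have main : ∀ f' g' : Fin 3 → Dual ℂ (Fin 6 → ℂ), IsSplitAt Φ q p f' g' → f' 0 = f 0 →
      f' 1 = f 1 → g' 0 = g 0 → g' 1 = g 1 → (∀ x, g' 2 (polar Φ p x) = 0) →
      (∀ x, m x = 0 → f' 2 (Φ x) = 0) → ∃ f g a m, IsDegenerateSplitAt Φ q p f g a m := by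
    intro f' g' h' hf0 hf1 hg0 hg1 hg2' hv
    obtain ⟨n, hn⟩ := exists_eq_mul m ((f' 2).compQuadraticMap Φ) hv
    have hn' : ∀ x, f' 2 (Φ x) = n x * m x := fun x => (hn x).trans (mul_comm _ _)
    refine ⟨f', g', ![a₀, a₁, n], m, ⟨h', fun x => by rw [hg0]; rfl, fun x => by rw [hg1]; rfl,
      hg2', fun x => by rw [hf0]; exact hm0 x, fun x => by rw [hf1]; exact hm1 x, hn', hm, ?_⟩⟩
    refine (pi_surjective_or_dependent _).resolve_right fun ⟨c, hc0, hc⟩ => ?_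
    have := H.dependent_of_comp h'.surjective (c := ![c 1, -c 0, c 2]) fun x => by
      have e := hc x
      simp only [Fin.sum_univ_three, Matrix.cons_val] at e ⊢
      rw [hf0, hf1, hn', ← hφ, ← hφ, hm0, hm1]
      linear_combination m x * e
    refine hc0 (funext fun i => ?_)
    match i with
    | 0 => simpa using congrFun this 1
    | 1 => simpa using congrFun this 0
    | 2 => simpa using congrFun this 2
  rcases hcase with hc | hc
  · exact main f g h rfl rfl rfl rfl hg2 hc
  · exact main _ _ (h.exists_swap H hg2) rfl rfl rfl rfl (fun x => h.vanish x 2) hc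

end QuadBir

open MvPolynomial
namespace QuadBir
open QuadraticMap Module

/-! ### Maps given by the minors of a two-rowed matrix of linear forms -/

/-- The components of `Φ` span the `2 × 2` minors of the matrix of linear forms with the two rows
`r₁`, `r₂`. The minors are encoded as the skew-symmetric matrix `r₁ r₂ᵀ - r₂ r₁ᵀ`. -/
def IsMinorForm (Φ : QuadraticMap ℂ (Fin 5 → ℂ) (Fin 6 → ℂ))
    (r₁ r₂ : (Fin 5 → ℂ) →ₗ[ℂ] (Fin 4 → ℂ)) : Prop :=
  ∃ Θ : (Fin 6 → ℂ) →ₗ[ℂ] Matrix (Fin 4) (Fin 4) ℂ, Function.Injective Θ ∧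
    ∀ x, Θ (Φ x) = Matrix.of fun i j => r₁ x i * r₂ x j - r₁ x j * r₂ x i

/-- The products of some linear form with all linear forms are components of `Φ`; then `Φ` is
inverted by a linear projection. -/
def HasLinearInverse (Φ : QuadraticMap ℂ (Fin 5 → ℂ) (Fin 6 → ℂ)) : Prop :=
  ∃ m : Dual ℂ (Fin 5 → ℂ), m ≠ 0 ∧ ∀ ξ : Dual ℂ (Fin 5 → ℂ),
    ∃ ρ : Dual ℂ (Fin 6 → ℂ), ∀ x, ρ (Φ x) = m x * ξ x

/-- Independent linear forms `a i` stay independent under the perturbation `a i + c • l i`, unless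
`-c⁻¹` belongs to the finitely many eigenvalues of an endomorphism. -/
theorem exists_perturb_surjective {V : Type*} [AddCommGroup V] [Module ℂ V] {n : ℕ}
    (a l : Fin n → Dual ℂ V) (ha : Function.Surjective (LinearMap.pi a)) :
    ∃ c : ℂ, c ≠ 0 ∧ Function.Surjective (LinearMap.pi fun i => a i + c • l i) := by
  obtain ⟨s, hs⟩ := (LinearMap.pi a).exists_rightInverse_of_surjective
    (LinearMap.range_eq_top.mpr ha)
  let T : Module.End ℂ (Fin n → ℂ) := LinearMap.pi l ∘ₗ s
  obtain ⟨μ, hμ⟩ :=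
    ((Module.End.finite_hasEigenvalue T).union (Set.finite_singleton 0)).exists_notMem
  simp only [Set.mem_union, Set.mem_singleton_iff, not_or] at hμ
  have h1 : ¬ T.HasEigenvalue μ := hμ.1
  have hμ0 : μ ≠ 0 := hμ.2
  have hinj : Function.Injective (LinearMap.id + (-μ⁻¹) • T : (Fin n → ℂ) →ₗ[ℂ] (Fin n → ℂ)) := by
    rw [injective_iff_map_eq_zero]
    intro v hv
    by_contra hv0
    refine h1 (Module.End.hasEigenvalue_of_hasEigenvector (x := v) ⟨?_, hv0⟩)
    rw [Module.End.mem_eigenspace_iff]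
    have h2 : v = μ⁻¹ • T v := by
      have : v + (-μ⁻¹) • T v = 0 := hv
      rw [neg_smul, ← sub_eq_add_neg, sub_eq_zero] at this
      exact this
    conv_rhs => rw [h2]
    rw [smul_smul, mul_inv_cancel₀ hμ0, one_smul]
  refine ⟨-μ⁻¹, by simpa using hμ0, fun v => ?_⟩
  obtain ⟨w, hw⟩ := LinearMap.surjective_of_injective hinj v
  refine ⟨s w, ?_⟩
  rw [← hw]
  ext i
  have h3 : a i (s w) = w i := congrFun (LinearMap.congr_fun hs w) i
  simp [h3, T]

/-- If `r p` is a multiple of the `k`-th unit vector, surjectivity of `r` can be tested on the other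
components. -/
theorem surjective_of_skip {V : Type*} [AddCommGroup V] [Module ℂ V] {n : ℕ}
    (r : V →ₗ[ℂ] (Fin n → ℂ)) (k : Fin n) {p : V} {s : ℂ} (hs : s ≠ 0) (hp : r p = Pi.single k s)
    (h : ∀ v : Fin n → ℂ, ∃ x, ∀ i, i ≠ k → r x i = v i) : Function.Surjective r := by
  intro v
  obtain ⟨x, hx⟩ := h v
  refine ⟨x + ((v k - r x k) / s) • p, ?_⟩
  rw [map_add, map_smul, hp]
  ext i
  by_cases hi : i = k
  · subst hi
    simp; field_simp; ring
  · simp [hi, hx i hi]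

theorem exists_apply_eq_three {V : Type*} [AddCommGroup V] [Module ℂ V] {a : Fin 3 → Dual ℂ V}
    (ha : Function.Surjective (LinearMap.pi a)) (u v w : ℂ) :
    ∃ e, a 0 e = u ∧ a 1 e = v ∧ a 2 e = w := by
  obtain ⟨e, he⟩ := ha ![u, v, w]
  exact ⟨e, by simpa using congrFun he 0, by simpa using congrFun he 1,
    by simpa using congrFun he 2⟩

namespace IsMinorForm

variable {Φ : QuadraticMap ℂ (Fin 5 → ℂ) (Fin 6 → ℂ)} {q : QuadraticForm ℂ (Fin 6 → ℂ)}
  {r₁ r₂ : (Fin 5 → ℂ) →ₗ[ℂ] (Fin 4 → ℂ)}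

theorem add_smul_left (h : IsMinorForm Φ r₁ r₂) (c : ℂ) : IsMinorForm Φ (r₁ + c • r₂) r₂ := by
  obtain ⟨Θ, hΘ, e⟩ := h
  refine ⟨Θ, hΘ, fun x => ?_⟩
  rw [e]
  ext i j
  simp; ring

theorem add_smul_right (h : IsMinorForm Φ r₁ r₂) (c : ℂ) : IsMinorForm Φ r₁ (r₂ + c • r₁) := by
  obtain ⟨Θ, hΘ, e⟩ := h
  refine ⟨Θ, hΘ, fun x => ?_⟩
  rw [e]
  ext i j
  simp; ring

/-- Column operations. -/
theorem mulVec (h : IsMinorForm Φ r₁ r₂) {P P' : Matrix (Fin 4) (Fin 4) ℂ} (hP : P' * P = 1) :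
    IsMinorForm Φ (P.mulVecLin ∘ₗ r₁) (P.mulVecLin ∘ₗ r₂) := by
  obtain ⟨Θ, hΘ, e⟩ := h
  refine ⟨{ toFun := fun y => P * Θ y * P.transpose,
            map_add' := fun y z => by rw [map_add, mul_add, add_mul]
            map_smul' := fun c y => by
              rw [map_smul, Matrix.mul_smul, Matrix.smul_mul, RingHom.id_apply] }, ?_, fun x => ?_⟩
  · intro y z hyz
    apply hΘ
    have h1 : P * Θ y * P.transpose = P * Θ z * P.transpose := hyz
    have h2 : P.transpose * P'.transpose = 1 := by
      rw [← Matrix.transpose_mul, hP, Matrix.transpose_one]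
    calc Θ y = (P' * P) * Θ y * (P.transpose * P'.transpose) := by rw [hP, h2]; simp
      _ = P' * (P * Θ y * P.transpose) * P'.transpose := by simp only [Matrix.mul_assoc]
      _ = P' * (P * Θ z * P.transpose) * P'.transpose := by rw [h1]
      _ = (P' * P) * Θ z * (P.transpose * P'.transpose) := by simp only [Matrix.mul_assoc]
      _ = Θ z := by rw [hP, h2]; simp
  · show P * Θ (Φ x) * P.transpose = _
    have h3 : (Matrix.of fun i j => r₁ x i * r₂ x j - r₁ x j * r₂ x i)
        = Matrix.vecMulVec (r₁ x) (r₂ x) - Matrix.vecMulVec (r₂ x) (r₁ x) := by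
      ext i j; simp [Matrix.vecMulVec_apply]; ring
    rw [e, h3, mul_sub, sub_mul, Matrix.mul_vecMulVec, Matrix.mul_vecMulVec,
      Matrix.vecMulVec_mul, Matrix.vecMulVec_mul, Matrix.vecMul_transpose,
      Matrix.vecMul_transpose]
    ext i j
    simp [Matrix.vecMulVec_apply]; ring

theorem eq_zero_of_rows_eq_zero (h : IsMinorForm Φ r₁ r₂) (H : IsQuadricParametrization Φ q)
    {v : Fin 5 → ℂ} (h1 : r₁ v = 0) (h2 : r₂ v = 0) : v = 0 := by
  obtain ⟨Θ, hΘ, e⟩ := h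
  refine H.eq_zero_of_invariant fun x => hΘ ?_
  rw [e, e, map_add, map_add, h1, h2, add_zero, add_zero]

theorem exists_component (h : IsMinorForm Φ r₁ r₂) (i j : Fin 4) :
    ∃ ρ : Dual ℂ (Fin 6 → ℂ), ∀ x, ρ (Φ x) = r₁ x i * r₂ x j - r₁ x j * r₂ x i := by
  obtain ⟨Θ, hΘ, e⟩ := h
  refine ⟨{ toFun := fun y => Θ y i j, map_add' := fun y z => by simp
            map_smul' := fun c y => by simp }, fun x => ?_⟩
  show Θ (Φ x) i j = _
  rw [e]; rfl

/-- Six independent components listing the minors give a minor form. -/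
theorem of_components (θ : Fin 6 → Dual ℂ (Fin 6 → ℂ)) (hθ : ∀ y, (∀ i, θ i y = 0) → y = 0)
    (h01 : ∀ x, θ 0 (Φ x) = r₁ x 0 * r₂ x 1 - r₁ x 1 * r₂ x 0)
    (h02 : ∀ x, θ 1 (Φ x) = r₁ x 0 * r₂ x 2 - r₁ x 2 * r₂ x 0)
    (h03 : ∀ x, θ 2 (Φ x) = r₁ x 0 * r₂ x 3 - r₁ x 3 * r₂ x 0)
    (h12 : ∀ x, θ 3 (Φ x) = r₁ x 1 * r₂ x 2 - r₁ x 2 * r₂ x 1)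
    (h13 : ∀ x, θ 4 (Φ x) = r₁ x 1 * r₂ x 3 - r₁ x 3 * r₂ x 1)
    (h23 : ∀ x, θ 5 (Φ x) = r₁ x 2 * r₂ x 3 - r₁ x 3 * r₂ x 2) : IsMinorForm Φ r₁ r₂ := by
  let M : Fin 4 → Fin 4 → Dual ℂ (Fin 6 → ℂ) :=
    ![![0, θ 0, θ 1, θ 2], ![-θ 0, 0, θ 3, θ 4], ![-θ 1, -θ 3, 0, θ 5], ![-θ 2, -θ 4, -θ 5, 0]]
  let Θ : (Fin 6 → ℂ) →ₗ[ℂ] Matrix (Fin 4) (Fin 4) ℂ :=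
    { toFun := fun y => Matrix.of fun i j => M i j y
      map_add' := fun y z => by ext i j; simp
      map_smul' := fun c y => by ext i j; simp }
  refine ⟨Θ, ?_, fun x => ?_⟩
  · rw [injective_iff_map_eq_zero]
    intro y hy
    have e : ∀ i j, Θ y i j = 0 := fun i j => by rw [hy]; rfl
    refine hθ y fun i => ?_
    match i with
    | 0 => exact e 0 1
    | 1 => exact e 0 2
    | 2 => exact e 0 3
    | 3 => exact e 1 2
    | 4 => exact e 1 3
    | 5 => exact e 2 3
  · ext i j
    show M i j (Φ x) = r₁ x i * r₂ x j - r₁ x j * r₂ x i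
    fin_cases i <;> fin_cases j <;> simp [M, h01, h02, h03, h12, h13, h23]

end IsMinorForm

section Rank6

variable {Φ : QuadraticMap ℂ (Fin 5 → ℂ) (Fin 6 → ℂ)} {q : QuadraticForm ℂ (Fin 6 → ℂ)}
  {p : Fin 5 → ℂ} {f g : Fin 3 → Dual ℂ (Fin 6 → ℂ)}

theorem IsSplitAt.eq_zero_of_forall (h : IsSplitAt Φ q p f g)
    (hq : LinearMap.ker q.polarBilin = ⊥) {y : Fin 6 → ℂ} (hf : ∀ i, f i y = 0)
    (hg : ∀ i, g i y = 0) : y = 0 := by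
  have : y ∈ LinearMap.ker q.polarBilin := by
    rw [LinearMap.mem_ker]
    ext z
    simp [polar_eq_of_eq_sum_mul h.eq_sum, hf, hg]
  rwa [hq, Submodule.mem_bot] at this

/-- A base point where the differential has rank three presents `Φ` by minors. By Koszul the
components `f i ∘ Φ` form a cross product `l × a`, and by Hilbert–Burch `q (Φ x) = 0` then yields
`g i ∘ Φ = s a i + t l i`; these are the minors of the matrix with rows `(a, t)` and `(l, -s)`. At
the base point the rows are zero and a unit vector, and so adding a multiple of the second row to
the first makes the latter surjective. -/
theorem IsSplitAt.exists_minorForm (h : IsSplitAt Φ q p f g) (H : IsQuadricParametrization Φ q)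
    (hp : Φ p = 0) (hq : LinearMap.ker q.polarBilin = ⊥)
    (ha : Function.Surjective (LinearMap.pi fun i => g i ∘ₗ polarBilin Φ p)) :
    ∃ r₁ r₂, IsMinorForm Φ r₁ r₂ ∧ Function.Surjective r₁ := by
  let a : Fin 3 → Dual ℂ (Fin 5 → ℂ) := fun i => g i ∘ₗ polarBilin Φ p
  have hae : ∀ i x, a i x = g i (polar Φ p x) := fun i x => rfl
  let φ := fun i => (f i).compQuadraticMap Φ
  let γ := fun i => (g i).compQuadraticMap Φ
  obtain ⟨l, h0, h1, h2⟩ := koszul_three a ha φ fun x => h.sum_mul_polar H hp x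
  have hind : ∀ c : Fin 3 → ℂ, (∀ x, ∑ i, c i * φ i x = 0) → c = 0 :=
    fun c hc => H.dependent_of_comp h.surjective hc
  obtain ⟨s, t, hst⟩ := hilbert_burch a l ha φ γ h0 h1 h2 hind fun x => by
    rw [← H.on_quadric x, h.eq_sum]; rfl
  have hpp : ∀ i, a i p = 0 := fun i => by
    rw [hae, polar_self, hp, smul_zero, map_zero]
  have k0 : ∀ x, l 1 p * a 2 x - l 2 p * a 1 x = 0 := fun x => by
    have e : f 0 (polar Φ p x) = φ 0 (p + x) - φ 0 p - φ 0 x := by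
      simp only [φ, LinearMap.compQuadraticMap_apply, polar, map_sub]
    rw [h.vanish, h0, h0, h0] at e
    simp only [map_add, hpp] at e
    linear_combination -e
  have k1 : ∀ x, l 2 p * a 0 x - l 0 p * a 2 x = 0 := fun x => by
    have e : f 1 (polar Φ p x) = φ 1 (p + x) - φ 1 p - φ 1 x := by
      simp only [φ, LinearMap.compQuadraticMap_apply, polar, map_sub]
    rw [h.vanish, h1, h1, h1] at e
    simp only [map_add, hpp] at e
    linear_combination -e
  obtain ⟨e₁, he10, he11, he12⟩ := exists_apply_eq_three ha 0 1 0
  obtain ⟨e₂, he20, he21, he22⟩ := exists_apply_eq_three ha 0 0 1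
  have l2 : l 2 p = 0 := by
    have := k0 e₁
    simp only [hae] at this
    simp only [LinearMap.comp_apply, polarBilin_apply_apply] at he11 he12
    rw [he11, he12] at this
    simpa using this
  have l1 : l 1 p = 0 := by
    have := k0 e₂
    simp only [hae] at this
    simp only [LinearMap.comp_apply, polarBilin_apply_apply] at he21 he22
    rw [he21, he22] at this
    simpa using this
  have l0 : l 0 p = 0 := by
    have := k1 e₂
    simp only [hae] at this
    simp only [LinearMap.comp_apply, polarBilin_apply_apply] at he20 he22
    rw [he20, he22] at this
    simpa using this
  have hl : ∀ i, l i p = 0 := fun i => by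
    match i with
    | 0 => exact l0
    | 1 => exact l1
    | 2 => exact l2
  have kγ : ∀ i x, a i x = s p * a i x + t p * l i x := fun i x => by
    have e : g i (polar Φ p x) = γ i (p + x) - γ i p - γ i x := by
      simp only [γ, LinearMap.compQuadraticMap_apply, polar, map_sub]
    rw [hst, hst, hst] at e
    simp only [map_add, hpp, hl] at e
    rw [← hae] at e
    linear_combination e
  have ht : t p = 0 := by
    by_contra ht
    have hl' : ∀ i x, l i x = (1 - s p) / t p * a i x := fun i x => by
      field_simp; linear_combination -kγ i x
    have := hind (Pi.single 0 1) fun x => by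
      rw [Fin.sum_univ_three]
      have : φ 0 x = 0 := by rw [h0, hl', hl']; ring
      simp [this]
    simpa using congrFun this 0
  have hs : s p = 1 := by
    have := kγ 1 e₁
    have ha1 : a 1 e₁ = 1 := he11
    rw [ht, ha1] at this
    linear_combination -this
  have hM : IsMinorForm Φ (LinearMap.pi ![a 0, a 1, a 2, t])
      (LinearMap.pi ![l 0, l 1, l 2, -s]) := by
    have hf : ∀ i x, f i (Φ x) = φ i x := fun i x => rfl
    have hg : ∀ i x, g i (Φ x) = γ i x := fun i x => rfl
    refine IsMinorForm.of_components ![-f 2, f 1, -g 0, -f 0, -g 1, -g 2] (fun y hy => ?_)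
      (fun x => ?_) (fun x => ?_) (fun x => ?_) (fun x => ?_) (fun x => ?_) (fun x => ?_)
    · refine h.eq_zero_of_forall hq (fun i => ?_) (fun i => ?_)
      · match i with
        | 0 => simpa using hy 3
        | 1 => simpa using hy 1
        | 2 => simpa using hy 0
      · match i with
        | 0 => simpa using hy 2
        | 1 => simpa using hy 4
        | 2 => simpa using hy 5
    all_goals simp [hf, hg, h0, h1, h2, hst]; try ring
  obtain ⟨c, hc0, hc⟩ := exists_perturb_surjective a l ha
  refine ⟨_, _, hM.add_smul_left c, surjective_of_skip _ 3 (p := p) (s := -c) (by simpa) ?_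
    fun v => ?_⟩
  · ext i
    fin_cases i <;> simp [hpp, hl, ht, hs]
  · obtain ⟨x, hx⟩ := hc ![v 0, v 1, v 2]
    refine ⟨x, fun i hi => ?_⟩
    fin_cases i
    · simpa using congrFun hx 0
    · simpa using congrFun hx 1
    · simpa using congrFun hx 2
    · exact absurd rfl hi

end Rank6

end QuadBir

open MvPolynomial
namespace QuadBir
open QuadraticMap Module

/-! ### Base points where the differential has rank two -/

section Degenerate

variable {Φ : QuadraticMap ℂ (Fin 5 → ℂ) (Fin 6 → ℂ)} {q : QuadraticForm ℂ (Fin 6 → ℂ)}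
  {p : Fin 5 → ℂ}

/-- The case of a matrix with rows `(m, b, n, 0)` and `(l₀, l₁, l₂, m)`. The obstruction to a
surjective row combination is the second row having first entry a multiple of `m`, up to row
operations; then `m` times each of the five linear forms occurring in the matrix is a minor. -/
theorem exists_minorForm_of_repeated (H : IsQuadricParametrization Φ q)
    {m b n l₀ l₁ l₂ : Dual ℂ (Fin 5 → ℂ)}
    (hM : IsMinorForm Φ (LinearMap.pi ![m, b, n, 0]) (LinearMap.pi ![l₀, l₁, l₂, m]))
    (hsurj : Function.Surjective (LinearMap.pi ![m, b, n]))
    (hp₁ : (LinearMap.pi ![m, b, n, 0] : _ →ₗ[ℂ] (Fin 4 → ℂ)) p = 0)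
    (hp₂ : (LinearMap.pi ![l₀, l₁, l₂, m] : _ →ₗ[ℂ] (Fin 4 → ℂ)) p = Pi.single 2 1) :
    HasLinearInverse Φ ∨ ∃ r₁ r₂, IsMinorForm Φ r₁ r₂ ∧ Function.Surjective r₁ := by
  -- a row combination is surjective as soon as its columns other than the third are
  have skip : ∀ {l₀ l₁ l₂ : Dual ℂ (Fin 5 → ℂ)} (c : ℂ), c ≠ 0 →
      IsMinorForm Φ (LinearMap.pi ![m, b, n, 0]) (LinearMap.pi ![l₀, l₁, l₂, m]) →
      (LinearMap.pi ![l₀, l₁, l₂, m] : _ →ₗ[ℂ] (Fin 4 → ℂ)) p = Pi.single 2 1 →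
      (∀ u v w : ℂ, ∃ x, m x + c * l₀ x = u ∧ b x + c * l₁ x = v ∧ c * m x = w) →
      ∃ r₁ r₂, IsMinorForm Φ r₁ r₂ ∧ Function.Surjective r₁ := by
    intro l₀ l₁ l₂ c hc hM hp₂ h
    refine ⟨_, _, hM.add_smul_left c, surjective_of_skip _ 2 hc (p := p) ?_ fun v => ?_⟩
    · rw [LinearMap.add_apply, LinearMap.smul_apply, hp₁, hp₂]
      ext i; fin_cases i <;> simp
    · obtain ⟨x, h0, h1, h2⟩ := h (v 0) (v 1) (v 3)
      refine ⟨x, fun i hi => ?_⟩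
      fin_cases i
      · simpa using h0
      · simpa using h1
      · exact absurd rfl hi
      · simpa using h2
  rcases pi_surjective_or_dependent ![m, b, l₀] with hs | ⟨d, hd0, hd⟩
  · obtain ⟨c, hc0, hc⟩ := exists_perturb_surjective ![m, b, l₀] ![0, l₁, 0] hs
    refine Or.inr (skip c hc0 hM hp₂ fun u v w => ?_)
    obtain ⟨x, h0, h1, h2⟩ := exists_apply_eq_three hc (w / c) v ((u - w / c) / c)
    simp at h0 h1 h2
    refine ⟨x, ?_, h1, ?_⟩
    · rw [h0, h2]; field_simp; ring
    · rw [h0]; field_simp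
  simp only [Fin.sum_univ_three, Matrix.cons_val] at hd
  have hd2 : d 2 ≠ 0 := fun h2 => hd0 (by
    have := not_dependent_of_surjective hsurj (c := ![d 0, d 1, 0]) fun x => by
      simp only [Fin.sum_univ_three, Matrix.cons_val]
      have := hd x
      rw [h2] at this
      linear_combination this
    ext i
    match i with
    | 0 => simpa using congrFun this 0
    | 1 => simpa using congrFun this 1
    | 2 => exact h2)
  -- subtract a multiple of the first row to make the first entry of the second a multiple of `b`
  have hM' := hM.add_smul_right (d 0 / d 2)
  have hrow : (LinearMap.pi ![l₀, l₁, l₂, m] : _ →ₗ[ℂ] (Fin 4 → ℂ))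
      + (d 0 / d 2) • LinearMap.pi ![m, b, n, 0]
      = LinearMap.pi ![(-(d 1 / d 2)) • b, l₁ + (d 0 / d 2) • b, l₂ + (d 0 / d 2) • n, m] := by
    refine LinearMap.ext fun x => funext fun i => ?_
    fin_cases i
    · simp; field_simp; linear_combination hd x
    · simp
    · simp
    · simp
  have hp₂' : (LinearMap.pi ![(-(d 1 / d 2)) • b, l₁ + (d 0 / d 2) • b, l₂ + (d 0 / d 2) • n, m] :
      _ →ₗ[ℂ] (Fin 4 → ℂ)) p = Pi.single 2 1 := by
    rw [← hrow, LinearMap.add_apply, LinearMap.smul_apply, hp₁, hp₂, smul_zero, add_zero]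
  rw [hrow] at hM'
  clear hrow hM hp₂ hd
  generalize -(d 1 / d 2) = μ at *
  generalize l₁ + (d 0 / d 2) • b = l₁ at *
  generalize l₂ + (d 0 / d 2) • n = l₂ at *
  have hzero : ∀ v, m v = 0 → b v = 0 → n v = 0 → l₁ v = 0 → l₂ v = 0 → v = 0 := by
    intro v h0 h1 h2 h3 h4
    refine hM'.eq_zero_of_rows_eq_zero H ?_ ?_ <;> ext i <;> fin_cases i <;> simp [*]
  by_cases hμ : μ = 0
  · subst hμ
    left
    obtain ⟨e, he, -⟩ := exists_apply_eq_three hsurj 1 0 0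
    refine ⟨m, fun h0 => ?_, fun ξ => ?_⟩
    · simp [h0] at he
    · obtain ⟨c, hc⟩ := exists_combination ![m, b, n, l₁, l₂] ξ fun x hx => by
        rw [hzero x (hx 0) (hx 1) (hx 2) (hx 3) (hx 4), map_zero]
      obtain ⟨ρ₀, h₀⟩ := hM'.exists_component 0 3
      obtain ⟨ρ₁, h₁⟩ := hM'.exists_component 1 3
      obtain ⟨ρ₂, h₂⟩ := hM'.exists_component 2 3
      obtain ⟨ρ₃, h₃⟩ := hM'.exists_component 0 1
      obtain ⟨ρ₄, h₄⟩ := hM'.exists_component 0 2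
      refine ⟨c 0 • ρ₀ + c 1 • ρ₁ + c 2 • ρ₂ + c 3 • ρ₃ + c 4 • ρ₄, fun x => ?_⟩
      simp only [LinearMap.add_apply, LinearMap.smul_apply, h₀, h₁, h₂, h₃, h₄, hc,
        Fin.sum_univ_five]
      simp
      ring
  · right
    rcases pi_surjective_or_dependent ![m, b, l₁] with hs | ⟨c, hc0, hc⟩
    · refine skip 1 one_ne_zero hM' hp₂' fun u v w => ?_
      obtain ⟨x, h0, h1, h2⟩ := exists_apply_eq_three hs w ((u - w) / μ) (v - (u - w) / μ)
      simp at h0 h1 h2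
      refine ⟨x, ?_, ?_, ?_⟩
      · simp [h0, h1]; field_simp; ring
      · rw [h1, h2]; ring
      · rw [h0]; ring
    · exfalso
      simp only [Fin.sum_univ_three, Matrix.cons_val] at hc
      have hc2 : c 2 ≠ 0 := fun h2 => hc0 (by
        have := not_dependent_of_surjective hsurj (c := ![c 0, c 1, 0]) fun x => by
          simp only [Fin.sum_univ_three, Matrix.cons_val]
          have := hc x
          rw [h2] at this
          linear_combination this
        ext i
        match i with
        | 0 => simpa using congrFun this 0
        | 1 => simpa using congrFun this 1
        | 2 => exact h2)
      obtain ⟨v, hv0, hv⟩ := exists_ne_zero_of_four_forms ![m, b, n, l₂]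
      refine hv0 (hzero v (hv 0) (hv 1) (hv 2) ?_ (hv 3))
      have h0 : m v = 0 := hv 0
      have h1 : b v = 0 := hv 1
      have := hc v
      rw [h0, h1] at this
      simpa [hc2] using this

/-- A matrix with rows `(b₀, b₁, n, 0)` and `(l₀, l₁, l₂, m)` can be reduced by column operations
to one with `b₀ = m`, unless `b₀`, `b₁`, `m` are independent; in that case a row combination is
surjective. -/
theorem exists_minorForm_of_degenerate_rows (H : IsQuadricParametrization Φ q)
    {m b₀ b₁ n l₀ l₁ l₂ : Dual ℂ (Fin 5 → ℂ)} (hm : m ≠ 0)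
    (hM : IsMinorForm Φ (LinearMap.pi ![b₀, b₁, n, 0]) (LinearMap.pi ![l₀, l₁, l₂, m]))
    (hsurj : Function.Surjective (LinearMap.pi ![b₀, b₁, n]))
    (hp₁ : (LinearMap.pi ![b₀, b₁, n, 0] : _ →ₗ[ℂ] (Fin 4 → ℂ)) p = 0)
    (hp₂ : (LinearMap.pi ![l₀, l₁, l₂, m] : _ →ₗ[ℂ] (Fin 4 → ℂ)) p = Pi.single 2 1) :
    HasLinearInverse Φ ∨ ∃ r₁ r₂, IsMinorForm Φ r₁ r₂ ∧ Function.Surjective r₁ := by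
  rcases pi_surjective_or_dependent ![b₀, b₁, m] with hs | ⟨d, hd0, hd⟩
  · obtain ⟨c, hc0, hc⟩ := exists_perturb_surjective ![b₀, b₁, m] ![l₀, l₁, 0] hs
    refine Or.inr ⟨_, _, hM.add_smul_left c,
      surjective_of_skip _ 2 hc0 (p := p) ?_ fun v => ?_⟩
    · rw [LinearMap.add_apply, LinearMap.smul_apply, hp₁, hp₂]
      ext i; fin_cases i <;> simp
    · obtain ⟨x, h0, h1, h2⟩ := exists_apply_eq_three hc (v 0) (v 1) (v 3 / c)
      simp at h0 h1 h2
      refine ⟨x, fun i hi => ?_⟩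
      fin_cases i
      · simpa using h0
      · simpa using h1
      · exact absurd rfl hi
      · simp [h2]; field_simp
  · simp only [Fin.sum_univ_three, Matrix.cons_val] at hd
    have hd2 : d 2 ≠ 0 := fun h2 => hd0 (by
      have := not_dependent_of_surjective hsurj (c := ![d 0, d 1, 0]) fun x => by
        simp only [Fin.sum_univ_three, Matrix.cons_val]
        have := hd x
        rw [h2] at this
        linear_combination this
      ext i
      match i with
      | 0 => simpa using congrFun this 0
      | 1 => simpa using congrFun this 1
      | 2 => exact h2)
    obtain ⟨α, β, hm'⟩ : ∃ α β : ℂ, m = α • b₀ + β • b₁ :=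
      ⟨-d 0 / d 2, -d 1 / d 2, LinearMap.ext fun x => by
        simp; field_simp; linear_combination hd x⟩
    obtain ⟨α', β', hD⟩ : ∃ α' β' : ℂ, α * β' - β * α' ≠ 0 := by
      by_cases hα : α = 0
      · refine ⟨1, 0, fun hβ => hm ?_⟩
        have hβ : β = 0 := by simpa using hβ
        rw [hm', hα, hβ]; simp
      · exact ⟨0, 1, by simpa using hα⟩
    let D := α * β' - β * α'
    have hD' : D ≠ 0 := hD
    have hP := hM.mulVec
      (P := !![α, β, 0, 0; α', β', 0, 0; 0, 0, 1, 0; 0, 0, 0, 1])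
      (P' := !![β' / D, -β / D, 0, 0; -α' / D, α / D, 0, 0; 0, 0, 1, 0; 0, 0, 0, 1]) (by
        ext i j
        fin_cases i <;> fin_cases j <;> simp [Matrix.mul_apply, Fin.sum_univ_four] <;>
          field_simp <;> simp only [D] <;> ring)
    have e₁ : (!![α, β, 0, 0; α', β', 0, 0; 0, 0, 1, 0; 0, 0, 0, 1]).mulVecLin ∘ₗ
        (LinearMap.pi ![b₀, b₁, n, 0] : _ →ₗ[ℂ] (Fin 4 → ℂ))
        = LinearMap.pi ![m, α' • b₀ + β' • b₁, n, 0] := by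
      refine LinearMap.ext fun x => funext fun i => ?_
      fin_cases i <;> simp [Matrix.mulVec, dotProduct, Fin.sum_univ_four, hm']
    have e₂ : (!![α, β, 0, 0; α', β', 0, 0; 0, 0, 1, 0; 0, 0, 0, 1]).mulVecLin ∘ₗ
        (LinearMap.pi ![l₀, l₁, l₂, m] : _ →ₗ[ℂ] (Fin 4 → ℂ))
        = LinearMap.pi ![α • l₀ + β • l₁, α' • l₀ + β' • l₁, l₂, m] := by
      refine LinearMap.ext fun x => funext fun i => ?_
      fin_cases i <;> simp [Matrix.mulVec, dotProduct, Fin.sum_univ_four]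
    rw [e₁, e₂] at hP
    refine exists_minorForm_of_repeated H (p := p) hP ?_ ?_ ?_
    · intro v
      obtain ⟨x, h0, h1, h2⟩ := exists_apply_eq_three hsurj ((β' * v 0 - β * v 1) / D)
        ((α * v 1 - α' * v 0) / D) (v 2)
      simp only [Matrix.cons_val] at h0 h1 h2
      refine ⟨x, funext fun i => ?_⟩
      fin_cases i
      · simp [hm', h0, h1]; field_simp; simp only [D]; ring
      · simp [h0, h1]; field_simp; simp only [D]; ring
      · simpa using h2
    · rw [← e₁, LinearMap.comp_apply, hp₁, map_zero]
    · rw [← e₂, LinearMap.comp_apply, hp₂]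
      ext i
      fin_cases i <;> simp

namespace IsDegenerateSplitAt

variable {f g : Fin 3 → Dual ℂ (Fin 6 → ℂ)} {a : Fin 3 → Dual ℂ (Fin 5 → ℂ)}
  {m : Dual ℂ (Fin 5 → ℂ)}

/-- The equation `q (Φ x) = 0` divided by `m`. -/
theorem syzygy (h : IsDegenerateSplitAt Φ q p f g a m) (H : IsQuadricParametrization Φ q)
    (x : Fin 5 → ℂ) : a 1 x * g 0 (Φ x) - a 0 x * g 1 (Φ x) + a 2 x * g 2 (Φ x) = 0 := by
  obtain ⟨P, -, hP⟩ := exists_poly_of_quadraticForm ((g 0).compQuadraticMap Φ)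
  obtain ⟨R, -, hR⟩ := exists_poly_of_quadraticForm ((g 1).compQuadraticMap Φ)
  obtain ⟨S, -, hS⟩ := exists_poly_of_quadraticForm ((g 2).compQuadraticMap Φ)
  have key : linPoly m * (linPoly (a 1) * P - linPoly (a 0) * R + linPoly (a 2) * S) = 0 :=
    MvPolynomial.funext fun x => by
      have := H.on_quadric x
      rw [h.eq_sum, Fin.sum_univ_three, h.comp_zero, h.comp_one, h.comp_two] at this
      simp only [map_mul, map_add, map_sub, eval_linPoly, hP, hR, hS,
        LinearMap.compQuadraticMap_apply, map_zero]
      linear_combination this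
  have hm : linPoly m ≠ 0 := fun h0 => h.ne_zero (LinearMap.ext fun x => by
    rw [← eval_linPoly, h0]; simp)
  have := congrArg (eval x) ((mul_eq_zero.mp key).resolve_left hm)
  simpa only [map_mul, map_add, map_sub, eval_linPoly, hP, hR, hS,
    LinearMap.compQuadraticMap_apply, map_zero] using this

theorem apply_base (h : IsDegenerateSplitAt Φ q p f g a m) (hp : Φ p = 0) :
    (∀ i, a i p = 0) ∧ m p = 0 := by
  have hpp : polar Φ p p = 0 := by rw [polar_self, hp, smul_zero]
  have h0 : a 0 p = 0 := by rw [← h.polar_zero, hpp, map_zero]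
  have h1 : a 1 p = 0 := by rw [← h.polar_one, hpp, map_zero]
  have hpolar : ∀ (i : Fin 3) x, f i (Φ (p + x)) = f i (Φ p) + f i (Φ x) := fun i x => by
    have := h.vanish x i
    rw [polar, map_sub, map_sub] at this
    linear_combination this
  obtain ⟨e, -, he, -⟩ := exists_apply_eq_three h.surj 0 1 0
  have hm : m p = 0 := by
    have := hpolar 0 e
    rw [h.comp_zero, h.comp_zero, h.comp_zero, map_add, map_add, h1, he] at this
    linear_combination this
  obtain ⟨e', he'⟩ := exists_apply_eq_one h.ne_zero
  have h2 : a 2 p = 0 := by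
    have := hpolar 2 e'
    rw [h.comp_two, h.comp_two, h.comp_two, map_add, map_add, hm, he'] at this
    linear_combination this
  refine ⟨fun i => ?_, hm⟩
  match i with
  | 0 => exact h0
  | 1 => exact h1
  | 2 => exact h2

/-- The syzygy between the `g i ∘ Φ` has independent coefficients, so by Koszul they form a cross
product, and together with the `f i ∘ Φ` they are the minors of a matrix with the entry `0`. -/
theorem exists_minorForm (h : IsDegenerateSplitAt Φ q p f g a m)
    (H : IsQuadricParametrization Φ q) (hp : Φ p = 0) (hq : LinearMap.ker q.polarBilin = ⊥) :
    HasLinearInverse Φ ∨ ∃ r₁ r₂, IsMinorForm Φ r₁ r₂ ∧ Function.Surjective r₁ := by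
  obtain ⟨hap, hmp⟩ := h.apply_base hp
  have hb : Function.Surjective (LinearMap.pi ![a 1, -a 0, a 2]) := fun v => by
    obtain ⟨x, h0, h1, h2⟩ := exists_apply_eq_three h.surj (-v 1) (v 0) (v 2)
    exact ⟨x, funext fun i => by fin_cases i <;> simp [h0, h1, h2]⟩
  let γ := fun i => (g i).compQuadraticMap Φ
  have hγ : ∀ i x, γ i x = g i (Φ x) := fun i x => rfl
  obtain ⟨l, h0, h1, h2⟩ := koszul_three ![a 1, -a 0, a 2] hb γ fun x => by
    rw [Fin.sum_univ_three]
    simp only [Matrix.cons_val, hγ, LinearMap.neg_apply]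
    linear_combination h.syzygy H x
  simp only [Matrix.cons_val, LinearMap.neg_apply, hγ] at h0 h1 h2
  have hpolar : ∀ i x, g i (polar Φ p x) = g i (Φ (p + x)) - g i (Φ p) - g i (Φ x) := fun i x => by
    rw [polar, map_sub, map_sub]
  have k0 : ∀ x, a 0 x = l 1 p * a 2 x + l 2 p * a 0 x := fun x => by
    have e := hpolar 0 x
    rw [h.polar_zero, h0, h0, h0] at e
    simp only [map_add, hap] at e
    linear_combination e
  have k1 : ∀ x, a 1 x = l 2 p * a 1 x - l 0 p * a 2 x := fun x => by
    have e := hpolar 1 x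
    rw [h.polar_one, h1, h1, h1] at e
    simp only [map_add, hap] at e
    linear_combination e
  obtain ⟨e, he0, he1, he2⟩ := exists_apply_eq_three h.surj 0 0 1
  obtain ⟨e', he0', he1', he2'⟩ := exists_apply_eq_three h.surj 1 0 0
  have l0 : l 0 p = 0 := by have := k1 e; rw [he1, he2] at this; linear_combination this
  have l1 : l 1 p = 0 := by have := k0 e; rw [he0, he2] at this; linear_combination -this
  have l2 : l 2 p = 1 := by have := k0 e'; rw [he0', he2'] at this; linear_combination -this
  refine exists_minorForm_of_degenerate_rows H (p := p) (m := m) (b₀ := a 1) (b₁ := -a 0)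
    (n := a 2) (l₀ := l 0) (l₁ := l 1) (l₂ := l 2) h.ne_zero ?_ hb ?_ ?_
  · refine IsMinorForm.of_components ![-g 2, g 1, f 0, -g 0, f 1, f 2] (fun y hy => ?_)
      (fun x => ?_) (fun x => ?_) (fun x => ?_) (fun x => ?_) (fun x => ?_) (fun x => ?_)
    · refine h.eq_zero_of_forall hq (fun i => ?_) (fun i => ?_)
      · match i with
        | 0 => simpa using hy 2
        | 1 => simpa using hy 4
        | 2 => simpa using hy 5
      · match i with
        | 0 => simpa using hy 3
        | 1 => simpa using hy 1
        | 2 => simpa using hy 0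
    all_goals simp [h0, h1, h2, h.comp_zero, h.comp_one, h.comp_two]
    all_goals ring
  · ext i; fin_cases i <;> simp [hap]
  · ext i; fin_cases i <;> simp [hmp, l0, l1, l2]

end IsDegenerateSplitAt

/-- A parametrization of a smooth quadric with a base point is given by the minors of a two-rowed
matrix of linear forms whose first row may be taken surjective, unless it is inverted by a linear
projection. -/
theorem IsQuadricParametrization.exists_minorForm (H : IsQuadricParametrization Φ q)
    (hq : LinearMap.ker q.polarBilin = ⊥) (hp0 : p ≠ 0) (hp : Φ p = 0) :
    HasLinearInverse Φ ∨ ∃ r₁ r₂, IsMinorForm Φ r₁ r₂ ∧ Function.Surjective r₁ := by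
  have hpr : ∃ x y, polar q (polar Φ p x) y ≠ 0 := by
    by_contra! hc
    refine hp0 (H.eq_zero_of_polar_eq_zero fun x => ?_)
    have : polar Φ p x ∈ LinearMap.ker q.polarBilin := by
      rw [LinearMap.mem_ker]
      ext z
      simp [hc x]
    rwa [hq, Submodule.mem_bot] at this
  rcases H.exists_split hp hpr with ⟨f, g, h, hs⟩ | ⟨f, g, a, m, h⟩
  · exact Or.inr (h.exists_minorForm H hp hq hs)
  · exact h.exists_minorForm H hp hq

end Degenerate
end QuadBir

open MvPolynomial
namespace QuadBir
open QuadraticMap Module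

/-! ### Parametrizations of a quadric of rank five -/

section Rank5

variable {Φ : QuadraticMap ℂ (Fin 5 → ℂ) (Fin 6 → ℂ)} {q : QuadraticForm ℂ (Fin 6 → ℂ)}
  {p : Fin 5 → ℂ} {r : Fin 6 → ℂ} {κ : Dual ℂ (Fin 6 → ℂ)}

theorem exists_dual_ne_zero_of_notMem {V : Type*} [AddCommGroup V] [Module ℂ V]
    {W : Submodule ℂ V} {u : V} (hu : u ∉ W) : ∃ ξ : Dual ℂ V, ξ u ≠ 0 ∧ ∀ w ∈ W, ξ w = 0 := by
  obtain ⟨ξ, h0, hle⟩ := Submodule.exists_le_ker_of_notMem hu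
  exact ⟨ξ, h0, fun w hw => hle hw⟩

theorem exists_dual_ne_zero_apply_eq_zero (v : Fin 5 → ℂ) : ∃ ξ : Dual ℂ (Fin 5 → ℂ),
    ξ ≠ 0 ∧ ξ v = 0 := by
  have hlt : Submodule.span ℂ {v} < ⊤ := by
    refine Ne.lt_top fun ht => ?_
    have h1 : finrank ℂ (Submodule.span ℂ {v}) ≤ 1 := (finrank_span_le_card {v}).trans (by simp)
    rw [ht, finrank_top, Module.finrank_fin_fun] at h1
    omega
  obtain ⟨ξ, h0, hξ⟩ := exists_dual_ne_zero_of_lt_top hlt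
  exact ⟨ξ, h0, hξ v (Submodule.mem_span_singleton_self v)⟩

/-- If only one component of `Φ`, with values along `r`, varies in the direction `v`, then it is
affine in that direction: otherwise `Φ` would identify the points of an involution. -/
theorem IsQuadricParametrization.map_eq_zero_of_polar (H : IsQuadricParametrization Φ q)
    (hκ : κ r = 1) {v : Fin 5 → ℂ} (hv : ∀ x, ∃ c : ℂ, polar Φ v x = c • r) : Φ v = 0 := by
  by_contra hΦ
  have hL : ∀ x, polar Φ v x = κ (polar Φ v x) • r := fun x => by
    obtain ⟨c, hc⟩ := hv x
    rw [hc]; simp [hκ]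
  let L : Dual ℂ (Fin 5 → ℂ) := κ ∘ₗ polarBilin Φ v
  have hLe : ∀ x, polar Φ v x = L x • r := hL
  have hvv : Φ v = (L v / 2) • r := by
    have h1 := polar_self Φ v
    rw [hLe, two_nsmul, ← two_smul ℂ] at h1
    rw [div_eq_inv_mul, ← smul_smul, h1, smul_smul]
    norm_num
  have hLv : L v ≠ 0 := fun h0 => hΦ (by rw [hvv, h0]; simp)
  obtain ⟨η, hη0, hη⟩ := exists_dual_ne_zero_apply_eq_zero v
  obtain ⟨x, hx, hηx, hinj⟩ := H.generically_injective L η (fun h0 => hLv (by simp [h0])) hη0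
  let s := -(2 * L x) / L v
  obtain ⟨c, hc⟩ := hinj (x + s • v) (by
    rw [map_add_smul, polar_comm, hLe, hvv, smul_smul, smul_smul, add_assoc, ← add_smul]
    have : s * L x + s * s * (L v / 2) = 0 := by simp only [s]; field_simp; ring
    rw [this, zero_smul, add_zero])
  have h1 := congrArg η hc
  rw [map_add, map_smul, map_smul, hη, smul_zero, add_zero, smul_eq_mul] at h1
  have hc1 : c = 1 := by
    apply mul_right_cancel₀ hηx
    rw [one_mul]; exact h1.symm
  rw [hc1, one_smul, add_eq_left, smul_eq_zero] at hc
  rcases hc with hs | hv0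
  · have : 2 * L x = 0 := by simpa [s, hLv] using hs
    exact hx (by simpa using this)
  · exact hLv (by rw [hv0, map_zero])

/-- Some base point has a differential that does not map into the radical. Otherwise there would be
only one base point, and its tangent space would be a hyperplane, which is not reduced. -/
theorem IsQuadricParametrization.exists_polar_ne_zero (H : IsQuadricParametrization Φ q)
    (hκ : κ r = 1) (hr : ∀ y, (∀ z, polar q y z = 0) → ∃ c : ℂ, y = c • r)
    (hp0 : p ≠ 0) (hp : Φ p = 0) :
    ∃ p, p ≠ 0 ∧ Φ p = 0 ∧ ∃ x y, polar q (polar Φ p x) y ≠ 0 := by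
  by_contra! hc
  have hpol : ∀ p, Φ p = 0 → ∀ x, polar Φ p x = κ (polar Φ p x) • r := fun p hp x => by
    by_cases h0 : p = 0
    · subst h0; rw [polar_zero_left]; simp
    · obtain ⟨c, hc⟩ := hr _ (hc p h0 hp x)
      rw [hc]; simp [hκ]
  let L := fun p : Fin 5 → ℂ => κ ∘ₗ polarBilin Φ p
  have hL : ∀ p, Φ p = 0 → ∀ x, polar Φ p x = L p x • r := hpol
  have hLne : ∀ p, p ≠ 0 → Φ p = 0 → L p ≠ 0 := fun p hp0 hp h0 => hp0 <|
    H.eq_zero_of_polar_eq_zero fun x => by rw [hL p hp x, h0]; simp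
  -- two base points are proportional
  have huniq : ∀ p', Φ p' = 0 → ∃ c : ℂ, p' = c • p := by
    intro p' hp'
    have h12 : L p p' = 0 := by
      have h1 : Φ (p + p') = L p p' • r := by
        rw [QuadraticMap.map_add Φ, hp, hp', hL p hp]; simp
      have h2 := H.map_eq_zero_of_polar hκ (v := p + p') fun x =>
        ⟨L p x + L p' x, by rw [polar_add_left, hL p hp, hL p' hp', add_smul]⟩
      rw [h1] at h2
      have := congrArg κ h2
      simpa [hκ] using this
    obtain ⟨x, hx, -, hinj⟩ := H.generically_injective (L p) (L p) (hLne p hp0 hp) (hLne p hp0 hp)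
    let d := L p' x • p + (-L p x) • p'
    have hLd : L p d = 0 := by
      have : L p p = 0 := by
        show κ (polar Φ p p) = 0
        rw [polar_self, hp]; simp
      simp [d, this, h12]
    obtain ⟨c, hc⟩ := hinj (x + d) (by
      have h3 : Φ d = 0 := by
        rw [map_add_smul, QuadraticMap.map_smul, hp, hp', polar_smul_left, hL p hp, h12]
        simp
      rw [QuadraticMap.map_add Φ, h3, polar_add_right, polar_smul_right, polar_smul_right,
        polar_comm Φ x p, polar_comm Φ x p', hL p hp, hL p' hp', smul_smul, smul_smul,
        ← add_smul, add_zero]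
      rw [show L p' x * L p x + -L p x * L p' x = 0 by ring, zero_smul, add_zero])
    have h4 := congrArg (L p) hc
    rw [map_add, hLd, add_zero, map_smul, smul_eq_mul] at h4
    have hc1 : c = 1 := by
      apply mul_right_cancel₀ hx
      rw [one_mul]; exact h4.symm
    rw [hc1, one_smul, add_eq_left] at hc
    refine ⟨L p' x / L p x, ?_⟩
    have h5 : L p x • p' = L p' x • p := by
      have : L p' x • p + (-L p x) • p' = 0 := hc
      rw [neg_smul, ← sub_eq_add_neg, sub_eq_zero] at this
      exact this.symm
    rw [div_eq_inv_mul, ← smul_smul, ← h5, smul_smul, inv_mul_cancel₀ hx, one_smul]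
  -- hence the base locus would be a single point with a positive-dimensional tangent space
  have hex : ∃ u ∈ LinearMap.ker (LinearMap.pi ![L p]), u ∉ Submodule.span ℂ {p} := by
    by_contra! hle
    have h1 := finrank_le_finrank_commonKernel_add ![L p]
    have h2 := Submodule.finrank_mono (s := LinearMap.ker (LinearMap.pi ![L p]))
      (t := Submodule.span ℂ {p}) hle
    have h3 : finrank ℂ (Submodule.span ℂ {p}) ≤ 1 := (finrank_span_le_card {p}).trans (by simp)
    rw [Module.finrank_fin_fun] at h1
    omega
  obtain ⟨u, hu, hup⟩ := hex
  have hLu : L p u = 0 := congrFun (LinearMap.mem_ker.mp hu) 0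
  obtain ⟨ξ, hξu, hξ⟩ := exists_dual_ne_zero_of_notMem hup
  refine hξu (H.reduced ξ (fun x hx => ?_) p 0 u hp0 hp (polar_zero_right Φ p) ?_)
  · obtain ⟨c, rfl⟩ := huniq x hx
    rw [map_smul, hξ p (Submodule.mem_span_singleton_self p), smul_zero]
  · rw [QuadraticMap.map_zero, hL p hp, hLu, zero_smul, add_zero]

/-- In the presence of a radical the six forms of a splitting are dependent. -/
theorem IsSplitAt.exists_relation {f g : Fin 3 → Dual ℂ (Fin 6 → ℂ)} (h : IsSplitAt Φ q p f g)
    (hr0 : r ≠ 0) (hr : ∀ z, polar q r z = 0) :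
    ∃ c d : Fin 3 → ℂ, d ≠ 0 ∧ ∀ y, ∑ i, c i * f i y + ∑ i, d i * g i y = 0 := by
  have hsum : ∀ (e : Fin (3 + 3) → ℂ) y, ∑ i, e i * Fin.append f g i y
      = ∑ i, e (Fin.castAdd 3 i) * f i y + ∑ i, e (Fin.natAdd 3 i) * g i y := fun e y => by
    rw [Fin.sum_univ_add]
    simp only [Fin.append_left, Fin.append_right]
  rcases pi_surjective_or_dependent (Fin.append f g) with hs | ⟨e, he0, he⟩
  · exfalso
    have h0 := not_dependent_of_surjective hs (c := Fin.append (fun i => g i r) (fun i => f i r))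
      fun y => by
        rw [hsum]
        simp only [Fin.append_left, Fin.append_right]
        rw [← Finset.sum_add_distrib, ← hr y, polar_eq_of_eq_sum_mul h.eq_sum]
        exact Finset.sum_congr rfl fun i _ => by ring
    have hinj : Function.Injective (LinearMap.pi (Fin.append f g) : _ →ₗ[ℂ] (Fin (3 + 3) → ℂ)) :=
      (LinearMap.injective_iff_surjective
        (f := (LinearMap.pi (Fin.append f g) : (Fin 6 → ℂ) →ₗ[ℂ] (Fin 6 → ℂ)))).mpr hs
    refine hr0 (hinj ?_)
    rw [map_zero]
    ext i
    have hf : ∀ i, f i r = 0 := fun i => by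
      have := congrFun h0 (Fin.natAdd 3 i)
      rwa [Fin.append_right] at this
    have hg : ∀ i, g i r = 0 := fun i => by
      have := congrFun h0 (Fin.castAdd 3 i)
      rwa [Fin.append_left] at this
    refine Fin.addCases (fun i => ?_) (fun i => ?_) i
    · simp only [LinearMap.pi_apply, Fin.append_left, hf]; rfl
    · simp only [LinearMap.pi_apply, Fin.append_right, hg]; rfl
  · refine ⟨fun i => e (Fin.castAdd 3 i), fun i => e (Fin.natAdd 3 i), fun hd => he0 ?_,
      fun y => by rw [← hsum]; exact he y⟩
    have hc := not_dependent_of_surjective h.surjective (c := fun i => e (Fin.castAdd 3 i))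
      fun y => by
        have := he y
        rw [hsum] at this
        have hd' : ∀ i, e (Fin.natAdd 3 i) = 0 := congrFun hd
        simp only [hd', zero_mul, Finset.sum_const_zero, add_zero] at this
        exact this
    ext i
    refine Fin.addCases (fun i => congrFun hc i) (fun i => congrFun hd i) i

namespace IsDegenerateSplitAt

variable {f g : Fin 3 → Dual ℂ (Fin 6 → ℂ)} {a : Fin 3 → Dual ℂ (Fin 5 → ℂ)}
  {m : Dual ℂ (Fin 5 → ℂ)}

/-- The symmetry exchanging the indices zero and one. -/
theorem swap (h : IsDegenerateSplitAt Φ q p f g a m) :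
    IsDegenerateSplitAt Φ q p ![f 1, f 0, f 2] ![g 1, g 0, g 2] ![a 1, a 0, -a 2] (-m) where
  surjective := fun v => by
    obtain ⟨y, h0, h1, h2⟩ := exists_apply_eq_three h.surjective (v 1) (v 0) (v 2)
    exact ⟨y, funext fun i => by fin_cases i <;> simp [h0, h1, h2]⟩
  vanish := fun x i => by
    match i with
    | 0 => exact h.vanish x 1
    | 1 => exact h.vanish x 0
    | 2 => exact h.vanish x 2
  eq_sum := fun y => by
    rw [h.eq_sum]
    simp only [Fin.sum_univ_three, Matrix.cons_val]
    ring
  polar_zero := h.polar_one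
  polar_one := h.polar_zero
  polar_two := h.polar_two
  comp_zero := fun x => by simp [h.comp_one x]
  comp_one := fun x => by simp [h.comp_zero x]
  comp_two := fun x => by simp [h.comp_two x]
  ne_zero := neg_ne_zero.mpr h.ne_zero
  surj := fun v => by
    obtain ⟨y, h0, h1, h2⟩ := exists_apply_eq_three h.surj (v 1) (v 0) (-v 2)
    exact ⟨y, funext fun i => by fin_cases i <;> simp [h0, h1, h2]⟩

/-- On a quadric of rank five the second component of index two is a combination of the first
components. -/
theorem exists_eq_combination (h : IsDegenerateSplitAt Φ q p f g a m)
    (H : IsQuadricParametrization Φ q) (hr0 : r ≠ 0) (hr : ∀ z, polar q r z = 0) :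
    ∃ e : Fin 3 → ℂ, e 2 ≠ 0 ∧ ∀ y, g 2 y = e 0 * f 0 y + e 1 * f 1 y + e 2 * f 2 y := by
  obtain ⟨c, d, hd0, hcd⟩ := h.exists_relation hr0 hr
  have hd := not_dependent_of_surjective h.surj (c := ![d 0, d 1, 0]) fun x => by
    have := hcd (polar Φ p x)
    simp only [Fin.sum_univ_three, h.vanish, h.polar_zero, h.polar_one, h.polar_two] at this
    simp only [Fin.sum_univ_three, Matrix.cons_val]
    linear_combination this
  have h0 : d 0 = 0 := by simpa using congrFun hd 0
  have h1 : d 1 = 0 := by simpa using congrFun hd 1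
  have h2 : d 2 ≠ 0 := fun h2 => hd0 (by
    ext i
    match i with
    | 0 => exact h0
    | 1 => exact h1
    | 2 => exact h2)
  have hg : ∀ y, g 2 y = -c 0 / d 2 * f 0 y + -c 1 / d 2 * f 1 y + -c 2 / d 2 * f 2 y := fun y => by
    have := hcd y
    simp only [Fin.sum_univ_three, h0, h1] at this
    field_simp
    linear_combination this
  refine ⟨fun i => -c i / d 2, fun he => ?_, hg⟩
  have := finrank_le_of_eq_sum_mul q H.finrank_radical ![f 0, f 1]
    ![g 0 + (-c 0 / d 2) • f 2, g 1 + (-c 1 / d 2) • f 2] fun y => by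
      have e1 := h.eq_sum y
      have e2 := hg y
      simp only at he
      rw [he] at e2
      simp only [Fin.sum_univ_three, Fin.sum_univ_two, Matrix.cons_val, LinearMap.add_apply,
        LinearMap.smul_apply, smul_eq_mul] at e1 ⊢
      rw [e1, e2]; ring
  rw [Module.finrank_fin_fun] at this
  omega

/-- On a quadric of rank five the common factor `m` depends on `a 0` and `a 1` only. -/
theorem exists_eq_combination_linear (h : IsDegenerateSplitAt Φ q p f g a m)
    (H : IsQuadricParametrization Φ q) {e : Fin 3 → ℂ} (he : e 2 ≠ 0)
    (hg : ∀ y, g 2 y = e 0 * f 0 y + e 1 * f 1 y + e 2 * f 2 y) :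
    ∃ α β : ℂ, ∀ x, m x = α * a 0 x + β * a 1 x := by
  have hW : ∃ x ∈ LinearMap.ker (a 0) ⊓ LinearMap.ker (a 1), a 2 x ≠ 0 := by
    obtain ⟨x, h0, h1, h2⟩ := exists_apply_eq_three h.surj 0 0 1
    exact ⟨x, ⟨h0, h1⟩, by simp [h2]⟩
  have h1 := quad_eq_zero_of_mul_eq_zero (LinearMap.ker (a 0) ⊓ LinearMap.ker (a 1)) (a 2)
    (linMulLin (a 2) m) hW fun x hx => by
      have := h.syzygy H x
      rw [hg, h.comp_zero, h.comp_one, h.comp_two, LinearMap.mem_ker.mp hx.1,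
        LinearMap.mem_ker.mp hx.2] at this
      apply mul_left_cancel₀ he
      rw [linMulLin_apply]
      linear_combination this
  have h2 := (lin_mul_lin_eq_zero _ (a 2) m h1).resolve_left fun h' => by
    obtain ⟨x, hx, hne⟩ := hW
    exact hne (h' x hx)
  obtain ⟨c, hc⟩ := exists_combination ![a 0, a 1] m fun x hx => h2 x ⟨hx 0, hx 1⟩
  exact ⟨c 0, c 1, fun x => by simpa using hc x⟩

end IsDegenerateSplitAt
end Rank5
end QuadBir

open MvPolynomial
namespace QuadBir
open QuadraticMap Module

section Rank5

variable {Φ : QuadraticMap ℂ (Fin 5 → ℂ) (Fin 6 → ℂ)} {q : QuadraticForm ℂ (Fin 6 → ℂ)}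
  {p : Fin 5 → ℂ} {r : Fin 6 → ℂ} {κ : Dual ℂ (Fin 6 → ℂ)}

theorem map_smul_add_smul_add_smul {V : Type*} [AddCommGroup V] [Module ℂ V]
    (K : QuadraticForm ℂ V) (x y z : V) (a b c : ℂ) :
    K (a • x + b • y + c • z) = a * a * K x + b * b * K y + c * c * K z
      + a * b * polar K x y + a * c * polar K x z + b * c * polar K y z := by
  rw [map_add_smul, map_add_smul, polar_add_left, QuadraticMap.map_smul]
  simp only [polar_smul_left, smul_eq_mul]
  ring

/-- A ternary quadratic form vanishing on the conic `A * T + ε * N ^ 2 = 0` is a multiple of the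
equation of the conic. -/
theorem eq_mul_of_vanish_on_conic {V : Type*} [AddCommGroup V] [Module ℂ V]
    (K : QuadraticForm ℂ V) (x y z : V) {ε : ℂ} (hε : ε ≠ 0)
    (h : ∀ A N T : ℂ, A * T + ε * N * N = 0 → K (A • x + N • y + T • z) = 0) :
    ∃ δ, ∀ A N T : ℂ, K (A • x + N • y + T • z) = δ * (A * T + ε * N * N) := by
  simp only [map_smul_add_smul_add_smul] at h ⊢
  have h1 := h 1 0 0 (by ring)
  have h2 := h 0 0 1 (by ring)
  have h3 := h 1 1 (-ε) (by ring)
  have h4 := h 1 (-1) (-ε) (by ring)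
  have h5 := h 1 2 (-4 * ε) (by ring)
  have hx : K x = 0 := by linear_combination h1
  have hz : K z = 0 := by linear_combination h2
  rw [hx, hz] at h3 h4 h5
  have hy : K y = ε * polar K x z := by linear_combination (h3 + h4) / 2
  have hodd : polar K x y = ε * polar K y z := by linear_combination (h3 - h4) / 2
  have hyz : polar K y z = 0 := by
    have : ε * polar K y z = 0 := by
      rw [hy, hodd] at h5
      linear_combination -h5 / 6
    exact (mul_eq_zero.mp this).resolve_left hε
  refine ⟨polar K x z, fun A N T => ?_⟩
  rw [hx, hz, hy, hodd, hyz]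
  ring

/-- The case of a degenerate splitting on a quadric of rank five with `m = α a₀ + β a₁`, `α ≠ 0`.
All components but the one along the radical are forms in the four variables `a 0`, `a 1`, `a 2`,
`τ`, and `m` vanishes on the base locus. At the point `v` where the four variables vanish, the first
order condition of reducedness identifies `m` with the differential of the last component `K`, up to
a scalar, and the second order condition says that on the hyperplane `m = 0` the form `K` vanishes
on the conic `g 1 = 0`. Hence `K - δ g 1 = m ξ`, and the products of `m` with `a 0`, `a 1`, `a 2`,
`τ` and `ξ` are components of `Φ`. -/
theorem IsDegenerateSplitAt.hasLinearInverse_of_radical {f g : Fin 3 → Dual ℂ (Fin 6 → ℂ)}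
    {a : Fin 3 → Dual ℂ (Fin 5 → ℂ)} {m : Dual ℂ (Fin 5 → ℂ)}
    (h : IsDegenerateSplitAt Φ q p f g a m)
    (H : IsQuadricParametrization Φ q) (hp : Φ p = 0)
    (hκ : κ r = 1) (hr : ∀ y, (∀ z, polar q y z = 0) → ∃ c : ℂ, y = c • r)
    {e : Fin 3 → ℂ} (he : e 2 ≠ 0)
    (hg : ∀ y, g 2 y = e 0 * f 0 y + e 1 * f 1 y + e 2 * f 2 y) {α β : ℂ} (hα : α ≠ 0)
    (hm : ∀ x, m x = α * a 0 x + β * a 1 x) : HasLinearInverse Φ := by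
  let n' : Dual ℂ (Fin 5 → ℂ) := e 0 • a 1 - e 1 • a 0 + e 2 • a 2
  have hn' : ∀ x, n' x = e 0 * a 1 x - e 1 * a 0 x + e 2 * a 2 x := fun x => rfl
  have hg2 : ∀ x, g 2 (Φ x) = m x * n' x := fun x => by
    rw [hg, h.comp_zero, h.comp_one, h.comp_two, hn']; ring
  obtain ⟨τ, hτ0, hτ1⟩ := koszul_two (a 1) (a 0)
    (by obtain ⟨x, h0, h1, -⟩ := exists_apply_eq_three h.surj 0 1 0
        exact ⟨x, h0, by simp [h1]⟩)
    (fun h0 => by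
      obtain ⟨x, h1, -⟩ := exists_apply_eq_three h.surj 1 0 0
      simp [h0] at h1)
    ((g 0).compQuadraticMap Φ + β • linMulLin (a 2) n')
    (-((g 1).compQuadraticMap Φ) + α • linMulLin (a 2) n') fun x => by
      have h1 := h.syzygy H x
      rw [hg2, hm] at h1
      simp only [_root_.add_apply, _root_.smul_apply, _root_.neg_apply, linMulLin_apply,
        LinearMap.compQuadraticMap_apply, smul_eq_mul]
      linear_combination h1
  simp only [_root_.add_apply, _root_.smul_apply, _root_.neg_apply, linMulLin_apply,
    LinearMap.compQuadraticMap_apply, smul_eq_mul] at hτ0 hτ1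
  have hγ0 : ∀ x, g 0 (Φ x) = a 0 x * τ x - β * (a 2 x * n' x) := fun x => by
    linear_combination hτ0 x
  have hγ1 : ∀ x, g 1 (Φ x) = a 1 x * τ x + α * (a 2 x * n' x) := fun x => by
    linear_combination -hτ1 x
  clear hτ0 hτ1
  obtain ⟨hap, hmp⟩ := h.apply_base hp
  have hτp : τ p = 1 := by
    obtain ⟨x, hx, -⟩ := exists_apply_eq_three h.surj 1 0 0
    have h1 := h.polar_zero x
    rw [polar, map_sub, map_sub, hp, map_zero, hγ0, hγ0, hx] at h1
    simp only [map_add, hap, hn', hx] at h1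
    linear_combination h1
  have hsurj : Function.Surjective (LinearMap.pi ![a 0, a 1, a 2, τ]) := by
    refine surjective_of_skip _ 3 one_ne_zero (p := p) ?_ fun v => ?_
    · ext i; fin_cases i <;> simp [hap, hτp]
    · obtain ⟨x, h0, h1, h2⟩ := exists_apply_eq_three h.surj (v 0) (v 1) (v 2)
      refine ⟨x, fun i hi => ?_⟩
      fin_cases i
      · exact h0
      · exact h1
      · exact h2
      · exact absurd rfl hi
  -- the components `f`, `g` are forms in `a 0`, `a 1`, `a 2`, `τ`
  have hinv : ∀ v, a 0 v = 0 → a 1 v = 0 → a 2 v = 0 → τ v = 0 →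
      (∀ x i, f i (Φ (x + v)) = f i (Φ x)) ∧ ∀ x i, g i (Φ (x + v)) = g i (Φ x) := by
    intro v h0 h1 h2 h3
    have hmv : m v = 0 := by rw [hm, h0, h1]; ring
    constructor
    · intro x i
      match i with
      | 0 => rw [h.comp_zero, h.comp_zero, map_add, map_add, h1, hmv]; ring
      | 1 => rw [h.comp_one, h.comp_one, map_add, map_add, h0, hmv]; ring
      | 2 => rw [h.comp_two, h.comp_two, map_add, map_add, h2, hmv]; ring
    · intro x i
      match i with
      | 0 => rw [hγ0, hγ0, hn', hn']; simp only [map_add, h0, h1, h2, h3]; ring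
      | 1 => rw [hγ1, hγ1, hn', hn']; simp only [map_add, h0, h1, h2, h3]; ring
      | 2 => rw [hg2, hg2, hn', hn']; simp only [map_add, h0, h1, h2, hmv]; ring
  have hrad : ∀ y, (∀ i, f i y = 0) → (∀ i, g i y = 0) → y = κ y • r := by
    intro y hfy hgy
    obtain ⟨c, hc⟩ := hr y fun z => by
      rw [polar_eq_of_eq_sum_mul h.eq_sum]
      simp [hfy, hgy]
    rw [hc]; simp [hκ]
  have hmΦ : ∀ x, Φ x = 0 → m x = 0 := fun x hx => by
    have h0 := h.comp_zero x
    have h1 := h.comp_one x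
    rw [hx, map_zero] at h0 h1
    have : m x * m x = 0 := by
      nth_rewrite 1 [hm]
      linear_combination -α * -h1 - β * h0
    exact mul_self_eq_zero.mp this
  -- only the component along the radical depends on a direction `v` in which the forms vanish
  have hker : ∀ v, v ≠ 0 → a 0 v = 0 → a 1 v = 0 → a 2 v = 0 → τ v = 0 →
      Φ v = 0 ∧ (∀ x, polar Φ v x = κ (polar Φ v x) • r) ∧
        ∃ c : ℂ, c ≠ 0 ∧ ∀ x, m x = c * κ (polar Φ v x) := by
    intro v hv0 hv1 hv2 hv3 hv4
    obtain ⟨hfv, hgv⟩ := hinv v hv1 hv2 hv3 hv4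
    have hL : ∀ x, polar Φ v x = κ (polar Φ v x) • r := by
      have hf0 : ∀ i, f i (Φ v) = 0 := fun i => by simpa using hfv 0 i
      have hg0 : ∀ i, g i (Φ v) = 0 := fun i => by simpa using hgv 0 i
      intro x
      refine hrad _ (fun i => ?_) fun i => ?_
      · rw [polar, add_comm, map_sub, map_sub, hfv, hf0]; ring
      · rw [polar, add_comm, map_sub, map_sub, hgv, hg0]; ring
    have hΦv : Φ v = 0 := H.map_eq_zero_of_polar hκ fun x => ⟨_, hL x⟩
    obtain ⟨c, hc⟩ := exists_combination ![κ ∘ₗ polarBilin Φ v] m fun u hu =>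
      H.reduced m hmΦ v 0 u hv0 hΦv (polar_zero_right Φ v) (by
        rw [QuadraticMap.map_zero, hL, show κ (polar Φ v u) = 0 from hu 0, zero_smul, add_zero])
    have hc' : ∀ x, m x = c 0 * κ (polar Φ v x) := fun x => by simpa using hc x
    exact ⟨hΦv, hL, c 0, fun h0 => h.ne_zero (LinearMap.ext fun x => by simp [hc', h0]), hc'⟩
  obtain ⟨v, hv0, hv⟩ := exists_ne_zero_of_four_forms ![a 0, a 1, a 2, τ]
  obtain ⟨hΦv, hL', c, hc0, hc'⟩ := hker v hv0 (hv 0) (hv 1) (hv 2) (hv 3)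
  have hmv : m v = 0 := by rw [hm, show a 0 v = 0 from hv 0, show a 1 v = 0 from hv 1]; ring
  let L : Dual ℂ (Fin 5 → ℂ) := κ ∘ₗ polarBilin Φ v
  have hL : ∀ x, polar Φ v x = L x • r := hL'
  have hc : ∀ x, m x = c * L x := hc'
  have hmL : ∀ u, m u = 0 → L u = 0 := fun u hu =>
    (mul_eq_zero.mp ((hc u).symm.trans hu)).resolve_left hc0
  obtain ⟨x₁, hx₁⟩ := exists_apply_eq_one (f := L) fun h0 => h.ne_zero
    (LinearMap.ext fun x => by simp [hc, h0])
  let K : QuadraticForm ℂ (Fin 5 → ℂ) := κ.compQuadraticMap Φ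
  have hK : ∀ x, K x = κ (Φ x) := fun _ => rfl
  -- the second order condition, for the arc `v + ε u - ε² K(u) x₁`
  have hKzero : ∀ u, m u = 0 → g 1 (Φ u) = 0 → K u = 0 := by
    intro u hu hu1
    have hu0 : g 0 (Φ u) = 0 := by
      refine (mul_eq_zero.mp (?_ : α * g 0 (Φ u) = 0)).resolve_left hα
      have h2 : α * g 0 (Φ u) + β * g 1 (Φ u) = m u * τ u := by rw [hγ0, hγ1, hm]; ring
      rw [hu, hu1] at h2
      linear_combination h2
    have hΦu : Φ u = K u • r := hrad _
      (fun i => by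
        match i with
        | 0 => rw [h.comp_zero, hu, mul_zero]
        | 1 => rw [h.comp_one, hu, mul_zero, neg_zero]
        | 2 => rw [h.comp_two, hu, mul_zero])
      (fun i => by
        match i with
        | 0 => exact hu0
        | 1 => exact hu1
        | 2 => rw [hg2, hu, zero_mul])
    have h2 := H.reduced m hmΦ v u (-K u • x₁) hv0 hΦv
      (by rw [hL, hmL u hu, zero_smul])
      (by rw [hΦu, polar_smul_right, hL, hx₁, one_smul, ← add_smul, add_neg_cancel, zero_smul])
    rw [map_smul, hc, hx₁, smul_eq_mul] at h2
    simpa [hc0] using h2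
  -- coordinates on the kernel of `m`, in which the component `g 1` is in diagonal form
  have hw : ∀ A N T : ℂ, ∃ u, m u = 0 ∧ a 1 u = A ∧ a 2 u = N ∧ τ u = T := fun A N T => by
    obtain ⟨u, hu⟩ := hsurj ![-β / α * A, A, N, T]
    have h0 : a 0 u = -β / α * A := congrFun hu 0
    have h1 : a 1 u = A := congrFun hu 1
    exact ⟨u, by rw [hm, h0, h1]; field_simp; ring, h1, congrFun hu 2, congrFun hu 3⟩
  have ha0 : ∀ u, m u = 0 → a 0 u = -β / α * a 1 u := fun u hu => by
    rw [hm] at hu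
    field_simp
    linear_combination hu
  let e' := e 0 + e 1 * β / α
  have hn'' : ∀ u, m u = 0 → n' u = e' * a 1 u + e 2 * a 2 u := fun u hu => by
    rw [hn', ha0 u hu]; simp only [e']; field_simp; ring
  obtain ⟨w₁, hw10, hw11, hw12, hw13⟩ := hw 1 0 0
  obtain ⟨wN, hwN0, hwN1, hwN2, hwN3⟩ := hw 0 1 (-α * e')
  obtain ⟨wT, hwT0, hwT1, hwT2, hwT3⟩ := hw 0 0 1
  have hg1 : ∀ A N T : ℂ, g 1 (Φ (A • w₁ + N • wN + T • wT)) = A * T + α * e 2 * N * N := by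
    intro A N T
    rw [hγ1, hn'']
    · simp only [map_add, map_smul, smul_eq_mul, hw11, hw12, hw13, hwN1, hwN2, hwN3, hwT1, hwT2,
        hwT3]
      ring
    · simp [hw10, hwN0, hwT0]
  obtain ⟨δ, hδ⟩ := eq_mul_of_vanish_on_conic K w₁ wN wT (mul_ne_zero hα he) fun A N T h0 =>
    hKzero _ (by simp [hw10, hwN0, hwT0]) (by rw [hg1, h0])
  have hKδ : ∀ u, m u = 0 → K u - δ * g 1 (Φ u) = 0 := by
    intro u hu
    let u' := a 1 u • w₁ + a 2 u • wN + (τ u + α * e' * a 2 u) • wT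
    -- `u` and `u'` differ by a multiple of `v`
    have hd0 : a 0 (u - u') = 0 ∧ a 1 (u - u') = 0 ∧ a 2 (u - u') = 0 ∧ τ (u - u') = 0 := by
      have h1 : a 1 (u - u') = 0 := by simp [u', hw11, hwN1, hwT1]
      refine ⟨?_, h1, by simp [u', hw12, hwN2, hwT2], ?_⟩
      · rw [ha0 _ (by simp [u', hu, hw10, hwN0, hwT0]), h1, mul_zero]
      · simp only [u', map_sub, map_add, map_smul, smul_eq_mul, hw13, hwN3, hwT3]; ring
    obtain ⟨k1, k2, k3, k4⟩ := hd0
    have hu' : m u' = 0 := by simp [u', hw10, hwN0, hwT0]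
    have hKu : K u = K u' := by
      by_cases hd : u - u' = 0
      · rw [sub_eq_zero.mp hd]
      · obtain ⟨hΦd, -, c₁, hc₁, hmd⟩ := hker _ hd k1 k2 k3 k4
        have h0 : κ (polar Φ (u - u') u') = 0 :=
          (mul_eq_zero.mp ((hmd u').symm.trans hu')).resolve_left hc₁
        have h1 := QuadraticMap.map_add Φ (u - u') u'
        rw [sub_add_cancel, hΦd, zero_add] at h1
        rw [hK, h1, _root_.map_add, h0, add_zero, hK]
    rw [hKu, hδ, hγ1, hn'' u hu]
    ring
  obtain ⟨ξ, hξ⟩ := exists_eq_mul m (K - δ • (g 1).compQuadraticMap Φ) fun u hu => hKδ u hu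
  replace hξ : ∀ x, κ (Φ x) - δ * g 1 (Φ x) = m x * ξ x := hξ
  refine ⟨m, h.ne_zero, fun ξ' => ?_⟩
  -- the five forms separate points, as `Φ` does not forget a direction
  obtain ⟨d, hd⟩ := exists_combination ![a 0, a 1, a 2, τ, ξ] ξ' fun x hx => by
    have hx0 : a 0 x = 0 := hx 0
    have hx1 : a 1 x = 0 := hx 1
    have hx4 : ξ x = 0 := hx 4
    obtain ⟨hfx, hgx⟩ := hinv x hx0 hx1 (hx 2) (hx 3)
    have hmx : m x = 0 := by rw [hm, hx0, hx1]; ring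
    rw [H.eq_zero_of_invariant (v := x) fun y => ?_, map_zero]
    rw [← sub_eq_zero, hrad (Φ (y + x) - Φ y) (fun i => by rw [map_sub, hfx, sub_self])
      (fun i => by rw [map_sub, hgx, sub_self])]
    have h1 := hξ (y + x)
    rw [hgx, _root_.map_add m, _root_.map_add ξ, hmx, hx4] at h1
    rw [map_sub, show κ (Φ (y + x)) - κ (Φ y) = 0 by linear_combination h1 - hξ y, zero_smul]
  refine ⟨(-d 0) • f 1 + d 1 • f 0 + d 2 • f 2 + d 3 • (α • g 0 + β • g 1)
    + d 4 • (κ - δ • g 1), fun x => ?_⟩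
  simp only [LinearMap.add_apply, LinearMap.smul_apply, LinearMap.sub_apply, smul_eq_mul, hξ,
    h.comp_zero, h.comp_one, h.comp_two, hd, Fin.sum_univ_five, Matrix.cons_val, hγ0]
  rw [hγ1]
  linear_combination -d 3 * τ x * hm x

/-- A quadratic parametrization of a quadric of rank five is inverted by a linear projection. The
relation between the `f i` and `g i` excludes a differential of rank three. -/
theorem IsQuadricParametrization.hasLinearInverse (H : IsQuadricParametrization Φ q)
    (hr0 : r ≠ 0) (hr : ∀ z, polar q r z = 0) (hp0 : p ≠ 0) (hp : Φ p = 0) :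
    HasLinearInverse Φ := by
  obtain ⟨κ, hκr⟩ := exists_dual_ne_zero_of_notMem (W := ⊥) (u := r) hr0
  have hκ : ((κ r)⁻¹ • κ) r = 1 := by simp [hκr.1]
  have hr' : ∀ y, (∀ z, polar q y z = 0) → ∃ c : ℂ, y = c • r := fun y hy => by
    have hne : (⟨r, LinearMap.mem_ker.mpr (LinearMap.ext hr)⟩ : LinearMap.ker q.polarBilin) ≠ 0 :=
      fun h0 => hr0 (congrArg Subtype.val h0)
    have h1 := (finrank_eq_one_iff_of_nonzero' _ hne).mp
      (le_antisymm H.finrank_radical (Module.finrank_pos_iff_exists_ne_zero.mpr ⟨_, hne⟩))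
    obtain ⟨c, hc⟩ := h1 ⟨y, LinearMap.mem_ker.mpr (LinearMap.ext hy)⟩
    exact ⟨c, (congrArg Subtype.val hc).symm⟩
  obtain ⟨p, hp0, hp, hpr⟩ := H.exists_polar_ne_zero hκ hr' hp0 hp
  rcases H.exists_split hp hpr with ⟨f, g, h, hsurj⟩ | ⟨f, g, a, m, h⟩
  · exfalso
    obtain ⟨c, d, hd0, hcd⟩ := h.exists_relation hr0 hr
    refine hd0 (not_dependent_of_surjective hsurj fun x => ?_)
    have := hcd (polar Φ p x)
    simp only [h.vanish, mul_zero, Finset.sum_const_zero, zero_add] at this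
    exact this
  · obtain ⟨e, he, hg⟩ := h.exists_eq_combination H hr0 hr
    obtain ⟨α, β, hm⟩ := h.exists_eq_combination_linear H he hg
    by_cases hα : α = 0
    · have hβ : β ≠ 0 := fun hβ => h.ne_zero (LinearMap.ext fun x => by simp [hm, hα, hβ])
      exact h.swap.hasLinearInverse_of_radical H hp hκ hr' (e := ![e 1, e 0, e 2]) he
        (fun y => by simp only [Matrix.cons_val, hg]; ring) (α := -β) (β := -α)
        (neg_ne_zero.mpr hβ) fun x => by simp [hm]
    · exact h.hasLinearInverse_of_radical H hp hκ hr' he hg hα hm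

end Rank5
end QuadBir

open MvPolynomial
namespace QuadBir
open QuadraticMap Module

/-! ### Diagonalization of a pencil of minors -/

section Pencil

variable {Φ : QuadraticMap ℂ (Fin 5 → ℂ) (Fin 6 → ℂ)} {q : QuadraticForm ℂ (Fin 6 → ℂ)}
  {r₁ r₂ : (Fin 5 → ℂ) →ₗ[ℂ] (Fin 4 → ℂ)}

/-- A linear form vanishing on the kernel of `f` factors through `f`. -/
theorem exists_dual_comp_eq {V W : Type*} [AddCommGroup V] [Module ℂ V] [AddCommGroup W]
    [Module ℂ W] (f : V →ₗ[ℂ] W) (g : Dual ℂ V) (h : ∀ x, f x = 0 → g x = 0) :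
    ∃ χ : Dual ℂ W, ∀ x, g x = χ (f x) := by
  have h1 : g ∈ (LinearMap.ker f).dualAnnihilator :=
    (Submodule.mem_dualAnnihilator g).mpr fun x hx => h x hx
  rw [← LinearMap.range_dualMap_eq_dualAnnihilator_ker] at h1
  obtain ⟨χ, hχ⟩ := h1
  exact ⟨χ, fun x => by rw [← hχ]; rfl⟩

/-- Two functionals with a vanishing combined minor `ψ(r₁) χ(r₂) - ψ(r₂) χ(r₁)` are proportional,
because the six minors of a minor form are linearly independent. -/
theorem IsMinorForm.mul_comm_of_wedge (h : IsMinorForm Φ r₁ r₂)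
    (H : IsQuadricParametrization Φ q) {ψ χ : Dual ℂ (Fin 4 → ℂ)}
    (hw : ∀ x, ψ (r₁ x) * χ (r₂ x) = ψ (r₂ x) * χ (r₁ x)) (u v : Fin 4 → ℂ) :
    ψ u * χ v = ψ v * χ u := by
  obtain ⟨Θ, hΘ, e⟩ := h
  let θ : Fin 4 → Fin 4 → Dual ℂ (Fin 6 → ℂ) := fun i j =>
    { toFun := fun y => Θ y i j
      map_add' := fun y z => by simp
      map_smul' := fun c y => by simp }
  have hθ : ∀ i j x, θ i j (Φ x) = r₁ x i * r₂ x j - r₁ x j * r₂ x i := fun i j x => by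
    show Θ (Φ x) i j = _
    rw [e]; rfl
  have hsymm : ∀ i j y, θ j i y = -θ i j y := fun i j y => by
    have := H.spans (θ j i + θ i j) fun x => by
      rw [LinearMap.add_apply, hθ, hθ]; ring
    have h1 := LinearMap.congr_fun this y
    rw [LinearMap.add_apply, LinearMap.zero_apply] at h1
    linear_combination h1
  have hdiag : ∀ i y, θ i i y = 0 := fun i y => by
    have := hsymm i i y
    linear_combination this / 2
  let f : Fin 6 → Dual ℂ (Fin 6 → ℂ) := ![θ 0 1, θ 0 2, θ 0 3, θ 1 2, θ 1 3, θ 2 3]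
  have hinj : Function.Injective (LinearMap.pi f) := by
    rw [injective_iff_map_eq_zero]
    intro y hy
    have k01 : θ 0 1 y = 0 := congrFun hy 0
    have k02 : θ 0 2 y = 0 := congrFun hy 1
    have k03 : θ 0 3 y = 0 := congrFun hy 2
    have k12 : θ 1 2 y = 0 := congrFun hy 3
    have k13 : θ 1 3 y = 0 := congrFun hy 4
    have k23 : θ 2 3 y = 0 := congrFun hy 5
    apply hΘ
    rw [map_zero]
    ext i j
    show θ i j y = 0
    fin_cases i <;> fin_cases j
    · exact hdiag _ y
    · exact k01
    · exact k02
    · exact k03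
    · exact (hsymm 0 1 y).trans (by rw [k01, neg_zero])
    · exact hdiag _ y
    · exact k12
    · exact k13
    · exact (hsymm 0 2 y).trans (by rw [k02, neg_zero])
    · exact (hsymm 1 2 y).trans (by rw [k12, neg_zero])
    · exact hdiag _ y
    · exact k23
    · exact (hsymm 0 3 y).trans (by rw [k03, neg_zero])
    · exact (hsymm 1 3 y).trans (by rw [k13, neg_zero])
    · exact (hsymm 2 3 y).trans (by rw [k23, neg_zero])
    · exact hdiag _ y
  have hsurj : Function.Surjective (LinearMap.pi f) := LinearMap.injective_iff_surjective.mp hinj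
  have hexp : ∀ (η : Dual ℂ (Fin 4 → ℂ)) u, η u = ∑ i, η (Pi.single i 1) * u i := fun η u => by
    conv_lhs => rw [LinearMap.pi_apply_eq_sum_univ η u]
    refine Finset.sum_congr rfl fun i _ => ?_
    rw [smul_eq_mul, mul_comm]
    congr 2
    ext j
    rw [Pi.single_apply]
    exact if_congr eq_comm rfl rfl
  let P := fun i => ψ (Pi.single i 1)
  let C := fun i => χ (Pi.single i 1)
  have hc := H.dependent_of_comp hsurj (c := ![P 0 * C 1 - P 1 * C 0, P 0 * C 2 - P 2 * C 0,
    P 0 * C 3 - P 3 * C 0, P 1 * C 2 - P 2 * C 1, P 1 * C 3 - P 3 * C 1, P 2 * C 3 - P 3 * C 2])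
    fun x => by
      have h1 := hw x
      rw [hexp ψ (r₁ x), hexp ψ (r₂ x), hexp χ (r₁ x), hexp χ (r₂ x)] at h1
      simp only [Fin.sum_univ_four] at h1
      simp only [Fin.sum_univ_six, f, Matrix.cons_val, hθ, P, C]
      linear_combination h1
  have c0 : P 0 * C 1 - P 1 * C 0 = 0 := congrFun hc 0
  have c1 : P 0 * C 2 - P 2 * C 0 = 0 := congrFun hc 1
  have c2 : P 0 * C 3 - P 3 * C 0 = 0 := congrFun hc 2
  have c3 : P 1 * C 2 - P 2 * C 1 = 0 := congrFun hc 3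
  have c4 : P 1 * C 3 - P 3 * C 1 = 0 := congrFun hc 4
  have c5 : P 2 * C 3 - P 3 * C 2 = 0 := congrFun hc 5
  rw [hexp ψ u, hexp χ v, hexp ψ v, hexp χ u]
  simp only [Fin.sum_univ_four]
  linear_combination (u 0 * v 1 - v 0 * u 1) * c0 + (u 0 * v 2 - v 0 * u 2) * c1 +
    (u 0 * v 3 - v 0 * u 3) * c2 + (u 1 * v 2 - v 1 * u 2) * c3 + (u 1 * v 3 - v 1 * u 3) * c4 +
    (u 2 * v 3 - v 2 * u 3) * c5

theorem IsMinorForm.exists_eq_smul_of_map_eq_zero (h : IsMinorForm Φ r₁ r₂) {x : Fin 5 → ℂ}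
    (hx : Φ x = 0) (h1 : r₁ x ≠ 0) : ∃ l : ℂ, r₂ x = l • r₁ x := by
  obtain ⟨i, hi⟩ := Function.ne_iff.mp h1
  refine ⟨r₂ x i / r₁ x i, ?_⟩
  ext j
  obtain ⟨ρ, hρ⟩ := h.exists_component i j
  have := hρ x
  rw [hx, map_zero] at this
  simp only [Pi.zero_apply] at hi
  simp only [Pi.smul_apply, smul_eq_mul]
  field_simp
  linear_combination -this

theorem IsMinorForm.map_eq_zero_of_eq_smul (h : IsMinorForm Φ r₁ r₂) {x : Fin 5 → ℂ} {l : ℂ}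
    (hx : r₂ x = l • r₁ x) : Φ x = 0 := by
  obtain ⟨Θ, hΘ, e⟩ := h
  apply hΘ
  rw [e, hx, map_zero]
  ext i j
  simp; ring

/-- The differential of a minor form at a point where the rows are proportional. -/
theorem IsMinorForm.polar_eq_zero (h : IsMinorForm Φ r₁ r₂) {x u : Fin 5 → ℂ} {l s : ℂ}
    (hx : r₂ x = l • r₁ x) (hu : r₂ u - l • r₁ u = s • r₁ x) : polar Φ x u = 0 := by
  have hu' : r₂ u = l • r₁ u + s • r₁ x := by rw [← hu]; abel
  obtain ⟨Θ, hΘ, e⟩ := h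
  apply hΘ
  rw [polar, map_sub, map_sub, e, e, e, map_add, map_add, hx, hu', map_zero]
  ext i j
  simp; ring

variable {σ : (Fin 4 → ℂ) →ₗ[ℂ] (Fin 5 → ℂ)} {e₀ : Fin 5 → ℂ}

/-- An eigenvector of the transpose of `r₂ ∘ σ` killing `r₂ e₀` (the part of the pencil that does
not depend on the choice of the section `σ`) is detected on the kernel of `r₂ - μ r₁`. This is
where the base locus being reduced enters: for a Jordan block, a linear form `(T - μ) χ` vanishing
on all base points would not vanish on the tangent space at a base point in the kernel. -/
theorem IsMinorForm.exists_apply_ne_zero (h : IsMinorForm Φ r₁ r₂)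
    (H : IsQuadricParametrization Φ q) (hσ : ∀ z, r₁ (σ z) = z) (he₀ : r₁ e₀ = 0)
    (hdec : ∀ x, ∃ t : ℂ, x = σ (r₁ x) + t • e₀) {μ : ℂ} {φ : Dual ℂ (Fin 4 → ℂ)} (hφ0 : φ ≠ 0)
    (hφw : φ (r₂ e₀) = 0) (hφ : ∀ z, φ (r₂ (σ z)) = μ * φ z) :
    ∃ x, r₂ x = μ • r₁ x ∧ φ (r₁ x) ≠ 0 := by
  by_contra! hcon
  let N : Module.End ℂ (Fin 4 → ℂ) := r₂ ∘ₗ σ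
  let T : Module.End ℂ (Dual ℂ (Fin 4 → ℂ)) := N.dualMap
  let S := T - algebraMap ℂ _ μ
  have hT : ∀ (χ : Dual ℂ (Fin 4 → ℂ)) z, T χ z = χ (r₂ (σ z)) := fun χ z => rfl
  have hS : ∀ (χ : Dual ℂ (Fin 4 → ℂ)) z, S χ z = χ (r₂ (σ z)) - μ * χ z := fun χ z => rfl
  have hr₂ : ∀ (χ : Dual ℂ (Fin 4 → ℂ)), χ (r₂ e₀) = 0 → ∀ x, χ (r₂ x) = T χ (r₁ x) := by
    intro χ hχ x
    obtain ⟨t, ht⟩ := hdec x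
    conv_lhs => rw [ht]
    rw [map_add, map_smul, map_add, map_smul, hχ, smul_zero, add_zero, hT]
  -- the functionals on which `T` does not depend on the section, and their generalized eigenspace
  let U : Submodule ℂ (Dual ℂ (Fin 4 → ℂ)) :=
    { carrier := {χ | ∀ i : ℕ, (T ^ i) χ (r₂ e₀) = 0}
      add_mem' := fun ha hb i => by rw [map_add, LinearMap.add_apply, ha, hb, add_zero]
      zero_mem' := fun i => by simp
      smul_mem' := fun c a ha i => by rw [map_smul, LinearMap.smul_apply, ha, smul_zero] }
  have hU0 : ∀ χ ∈ U, χ (r₂ e₀) = 0 := fun χ hχ => hχ 0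
  have hUT : ∀ χ ∈ U, T χ ∈ U := fun χ hχ i => by
    have := hχ (i + 1)
    rwa [pow_succ] at this
  let P := U ⊓ T.maxGenEigenspace μ
  have hPnil : ∀ χ ∈ P, ∃ k : ℕ, (S ^ k) χ = 0 := fun χ hχ => by
    obtain ⟨k, hk⟩ := Module.End.mem_maxGenEigenspace T μ χ |>.mp hχ.2
    exact ⟨k, by rw [← hk]; rfl⟩
  have hPmem : ∀ χ ∈ U, ∀ k : ℕ, (S ^ k) χ = 0 → χ ∈ P := fun χ hχ k hk =>
    ⟨hχ, (Module.End.mem_maxGenEigenspace T μ χ).mpr ⟨k, by rw [← hk]; rfl⟩⟩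
  have hPS : ∀ χ ∈ P, S χ ∈ P := by
    intro χ hχ
    obtain ⟨k, hk⟩ := hPnil χ hχ
    refine hPmem _ (U.sub_mem (hUT χ hχ.1) (U.smul_mem μ hχ.1)) k ?_
    have : (S ^ k) (S χ) = S ((S ^ k) χ) := by
      rw [← Module.End.mul_apply, ← Module.End.mul_apply, ← pow_succ, ← pow_succ']
    rw [this, hk, map_zero]
  -- functionals factoring through `r₂ - μ r₁`
  have hfac : ∀ (χ η : Dual ℂ (Fin 4 → ℂ)), (∀ x, χ (r₁ x) = η (r₂ x - μ • r₁ x)) →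
      η (r₂ e₀) = 0 ∧ S η = χ := by
    intro χ η hχ
    refine ⟨by simpa [he₀] using (hχ e₀).symm, LinearMap.ext fun z => ?_⟩
    have := hχ (σ z)
    rw [hσ, map_sub, map_smul] at this
    exact this.symm
  -- `S` is not surjective on `P`, so some member of `P` is detected on the kernel of `r₂ - μ r₁`
  obtain ⟨χ₀, hχP, x', hx', hχx'⟩ : ∃ χ ∈ P, ∃ x, r₂ x = μ • r₁ x ∧ χ (r₁ x) ≠ 0 := by
    by_contra! hall
    have hsurj : Function.Surjective (S.restrict hPS) := by
      rintro ⟨χ, hχ⟩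
      obtain ⟨η, hη⟩ := exists_dual_comp_eq (r₂ - μ • r₁) (χ ∘ₗ r₁) fun x hx =>
        hall χ hχ x (sub_eq_zero.mp hx)
      obtain ⟨hη0, hSη⟩ := hfac χ η hη
      have hTη : T η = χ + μ • η := by rw [← hSη]; ext z; simp [S]
      have hηU : η ∈ U := by
        intro i
        induction i with
        | zero => exact hη0
        | succ i ih =>
          rw [pow_succ, Module.End.mul_apply, hTη, map_add, map_smul, LinearMap.add_apply,
            LinearMap.smul_apply, ih, hχ.1 i, smul_zero, add_zero]
      obtain ⟨k, hk⟩ := hPnil χ hχ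
      exact ⟨⟨η, hPmem η hηU (k + 1) (by rw [pow_succ, Module.End.mul_apply, hSη, hk])⟩,
        Subtype.ext hSη⟩
    have hTφ : T φ = μ • φ := LinearMap.ext hφ
    have hSφ : S φ = 0 := LinearMap.ext fun z => by rw [hS, hφ, sub_self]; rfl
    have hφU : φ ∈ U := fun i => by
      have : (T ^ i) φ = μ ^ i • φ := by
        induction i with
        | zero => simp
        | succ i ih => rw [pow_succ, Module.End.mul_apply, hTφ, map_smul, ih, smul_smul, pow_succ']
      rw [this, LinearMap.smul_apply, hφw, smul_zero]
    have hφP : φ ∈ P := hPmem φ hφU 1 (by rw [pow_one, hSφ])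
    have h0 : (⟨φ, hφP⟩ : P) = 0 := LinearMap.injective_iff_surjective.mpr hsurj (by
      rw [map_zero]; exact Subtype.ext hSφ)
    exact hφ0 (congrArg Subtype.val h0)
  have hx'0 : x' ≠ 0 := fun h0 => hχx' (by rw [h0, map_zero, map_zero])
  -- at a base point with `r₂ x = l r₁ x`, the operator `S` acts as the scalar `l - μ`, while it is
  -- nilpotent on `P`
  have hzero : ∀ x, Φ x = 0 → S χ₀ (r₁ x) = 0 := by
    intro x hx
    by_cases h1 : r₁ x = 0
    · rw [h1, map_zero]
    obtain ⟨l, hl⟩ := h.exists_eq_smul_of_map_eq_zero hx h1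
    have hSl : ∀ χ ∈ P, S χ (r₁ x) = (l - μ) * χ (r₁ x) := fun χ hχ => by
      have := hr₂ χ (hU0 χ hχ.1) x
      rw [hl, map_smul, smul_eq_mul, hT] at this
      rw [hS, ← this]; ring
    by_cases hlμ : l - μ = 0
    · rw [hSl χ₀ hχP, hlμ, zero_mul]
    have hSk : ∀ k : ℕ, (S ^ k) χ₀ ∈ P ∧ (S ^ k) χ₀ (r₁ x) = (l - μ) ^ k * χ₀ (r₁ x) := by
      intro k
      induction k with
      | zero => exact ⟨hχP, by simp⟩
      | succ k ih =>
        rw [pow_succ', Module.End.mul_apply]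
        exact ⟨hPS _ ih.1, by rw [hSl _ ih.1, ih.2]; ring⟩
    obtain ⟨k, hk⟩ := hPnil χ₀ hχP
    have h2 := (hSk k).2
    rw [hk, LinearMap.zero_apply] at h2
    rw [hSl χ₀ hχP, (mul_eq_zero.mp h2.symm).resolve_left (pow_ne_zero _ hlμ), mul_zero]
  -- by reducedness at `x'`, `S χ₀` factors through `r₂ - μ r₁` modulo `r₁ x'`
  obtain ⟨η', hη'⟩ := exists_dual_comp_eq
    ((Submodule.span ℂ {r₁ x'}).mkQ ∘ₗ (r₂ - μ • r₁)) (S χ₀ ∘ₗ r₁) fun u hu => by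
      have h1 : r₂ u - μ • r₁ u ∈ Submodule.span ℂ {r₁ x'} :=
        (Submodule.Quotient.mk_eq_zero _).mp hu
      obtain ⟨s, hs⟩ := Submodule.mem_span_singleton.mp h1
      exact H.reduced (S χ₀ ∘ₗ r₁) hzero x' 0 u hx'0 (h.map_eq_zero_of_eq_smul hx')
        (polar_zero_right Φ x')
        (by rw [QuadraticMap.map_zero, zero_add]; exact h.polar_eq_zero hx' hs.symm)
  let η : Dual ℂ (Fin 4 → ℂ) := η' ∘ₗ (Submodule.span ℂ {r₁ x'}).mkQ
  have hηx' : η (r₁ x') = 0 := by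
    show η' (Submodule.Quotient.mk (r₁ x')) = 0
    rw [(Submodule.Quotient.mk_eq_zero _).mpr (Submodule.mem_span_singleton_self _), map_zero]
  obtain ⟨hη0, hSη⟩ := hfac (S χ₀) η hη'
  -- so `η - χ₀` is an eigenvector as well, which must be proportional to `φ`
  have hψ : ∀ z, (η - χ₀) (r₂ (σ z)) = μ * (η - χ₀) z := fun z => by
    have := LinearMap.congr_fun hSη z
    rw [hS, hS] at this
    rw [LinearMap.sub_apply, LinearMap.sub_apply]
    linear_combination this
  have hψ0 : (η - χ₀) (r₂ e₀) = 0 := by rw [LinearMap.sub_apply, hη0, hU0 χ₀ hχP.1, sub_zero]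
  obtain ⟨z, hz⟩ := exists_apply_eq_one hφ0
  have hprop := h.mul_comm_of_wedge H (ψ := φ) (χ := η - χ₀)
    (fun x => by rw [hr₂ _ hψ0, hr₂ _ hφw, hT, hT, hφ, hψ]; ring) z (r₁ x')
  rw [hz, hcon x' hx', one_mul, zero_mul, LinearMap.sub_apply, hηx', zero_sub, neg_eq_zero] at hprop
  exact hχx' hprop

end Pencil
end QuadBir

open MvPolynomial
namespace QuadBir
open QuadraticMap Module

/-- In the coordinates `(z, t)` given by `E`, the components of `Φ` span the same space as the
minors of the matrix with rows `z` and `(lᵢ zᵢ + t wᵢ)ᵢ`. -/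
structure IsDiagonalMinorForm (Φ : QuadraticMap ℂ (Fin 5 → ℂ) (Fin 6 → ℂ))
    (E : ((Fin 4 → ℂ) × ℂ) ≃ₗ[ℂ] (Fin 5 → ℂ)) (l w : Fin 4 → ℂ) : Prop where
  injective : Function.Injective l
  ne_zero : w ≠ 0
  exists_eq : ∃ Θ : (Fin 6 → ℂ) →ₗ[ℂ] Matrix (Fin 4) (Fin 4) ℂ, Function.Injective Θ ∧
    ∀ z t, Θ (Φ (E (z, t))) =
      Matrix.of fun i j => z i * (l j * z j + t * w j) - z j * (l i * z i + t * w i)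

section Pencil

variable {Φ : QuadraticMap ℂ (Fin 5 → ℂ) (Fin 6 → ℂ)} {q : QuadraticForm ℂ (Fin 6 → ℂ)}
  {r₁ r₂ : (Fin 5 → ℂ) →ₗ[ℂ] (Fin 4 → ℂ)}

/-- The solutions `ψ l` of `(T - l) (ψ l) = χ`, for all but finitely many `l`, span an invariant
subspace, by the resolvent identity. In particular their span contains an eigenvector of `T`. -/
theorem exists_eigenvector_of_resolvent {D : Type*} [AddCommGroup D] [Module ℂ D]
    [FiniteDimensional ℂ D] (T : Module.End ℂ D) {χ : D} (hχ : χ ≠ 0) (s : Finset ℂ) (ψ : ℂ → D)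
    (hψ : ∀ l, l ∉ s → T (ψ l) - l • ψ l = χ) :
    ∃ v ∈ Submodule.span ℂ (ψ '' {l | l ∉ s}), v ≠ 0 ∧ ∃ μ : ℂ, T v = μ • v := by
  classical
  set W := Submodule.span ℂ (ψ '' {l | l ∉ s}) with hW
  obtain ⟨F, hF, hFW⟩ := Submodule.fg_span_iff_fg_span_finset_subset _ |>.mp
    (IsNoetherian.noetherian W)
  obtain ⟨t, ht, rfl⟩ := Finset.subset_set_image_iff.mp hF
  obtain ⟨l, hl⟩ := Infinite.exists_notMem_finset (s ∪ t)
  simp only [Finset.mem_union, not_or] at hl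
  let R : Module.End ℂ D := T - algebraMap ℂ _ l
  have hR : ∀ v, R v = T v - l • v := fun v => by simp [R]
  have hlW : ψ l ∈ W := Submodule.subset_span ⟨l, hl.1, rfl⟩
  have hle : W ≤ W.map R := by
    rw [hW, hFW, Submodule.span_le]
    intro v hv
    simp only [Finset.coe_image, Set.mem_image, Finset.mem_coe] at hv
    obtain ⟨l', hl', rfl⟩ := hv
    have hne : l - l' ≠ 0 := sub_ne_zero.mpr fun h => hl.2 (h ▸ hl')
    have hl'W : ψ l' ∈ W := Submodule.subset_span ⟨l', ht hl', rfl⟩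
    rw [← hFW, ← hW]
    refine ⟨(l - l')⁻¹ • (ψ l - ψ l'), W.smul_mem _ (W.sub_mem hlW hl'W), ?_⟩
    have h1 : R (ψ l - ψ l') = (l - l') • ψ l' := by
      have e1 := hψ l hl.1
      have e2 := hψ l' (ht hl')
      rw [map_sub, hR, hR, e1, ← e2, sub_smul]
      abel
    rw [map_smul, h1, smul_smul, inv_mul_cancel₀ hne, one_smul]
  have heq : W = W.map R := Submodule.eq_of_le_of_finrank_le hle (Submodule.finrank_map_le R W)
  have hRW : ∀ v ∈ W, R v ∈ W := fun v hv => by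
    have := Submodule.mem_map_of_mem (f := R) hv
    rwa [← heq] at this
  have hχW : χ ∈ W := by rw [← hψ l hl.1, ← hR]; exact hRW _ hlW
  have hnt : Nontrivial W := ⟨⟨χ, hχW⟩, 0, fun h0 => hχ (congrArg Subtype.val h0)⟩
  obtain ⟨μ, hμ⟩ := Module.End.exists_eigenvalue (R.restrict hRW)
  obtain ⟨⟨v, hv⟩, hvμ⟩ := hμ.exists_hasEigenvector
  refine ⟨v, hv, fun h0 => hvμ.2 (Subtype.ext h0), μ + l, ?_⟩
  have h2 : R v = μ • v := congrArg Subtype.val hvμ.apply_eq_smul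
  rw [hR, sub_eq_iff_eq_add] at h2
  rw [h2, add_smul]

variable {σ : (Fin 4 → ℂ) →ₗ[ℂ] (Fin 5 → ℂ)} {e₀ : Fin 5 → ℂ}

/-- There are points `b l` of the base locus with `r₂ (b l) = l • r₁ (b l)`, for four values of `l`,
whose images under `r₁` are linearly independent. One starts with a point for each eigenvalue
independent of the section `σ`, and adds points as long as the images do not span: if no further
point had image outside a hyperplane `χ = 0` containing them, then `χ` would factor through
`r₂ - l r₁` for almost all `l`, and this produces an eigenvector killing all the points. -/
theorem IsMinorForm.exists_eigenbasis (h : IsMinorForm Φ r₁ r₂)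
    (H : IsQuadricParametrization Φ q) (hσ : ∀ z, r₁ (σ z) = z) (he₀ : r₁ e₀ = 0)
    (hdec : ∀ x, ∃ t : ℂ, x = σ (r₁ x) + t • e₀) :
    ∃ (s : Finset ℂ) (b : ℂ → (Fin 5 → ℂ)), s.card = 4 ∧ (∀ l ∈ s, r₂ (b l) = l • r₁ (b l)) ∧
      LinearIndepOn ℂ (fun l => r₁ (b l)) (s : Set ℂ) := by
  let T : Module.End ℂ (Dual ℂ (Fin 4 → ℂ)) := LinearMap.dualMap (r₂ ∘ₗ σ)
  have hT : ∀ (χ : Dual ℂ (Fin 4 → ℂ)) z, T χ z = χ (r₂ (σ z)) := fun χ z => rfl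
  have hr₂ : ∀ (χ : Dual ℂ (Fin 4 → ℂ)), χ (r₂ e₀) = 0 → ∀ x, χ (r₂ x) = χ (r₂ (σ (r₁ x))) := by
    intro χ hχ x
    obtain ⟨t, ht⟩ := hdec x
    conv_lhs => rw [ht]
    rw [map_add, map_smul, map_add, map_smul, hχ, smul_zero, add_zero]
  -- the eigenvectors that do not depend on the section, and points detecting them
  let IsEig : ℂ → Dual ℂ (Fin 4 → ℂ) → Prop := fun μ φ =>
    φ ≠ 0 ∧ φ (r₂ e₀) = 0 ∧ ∀ z, φ (r₂ (σ z)) = μ * φ z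
  have hfin : {μ | ∃ φ, IsEig μ φ}.Finite :=
    (Module.End.finite_hasEigenvalue T).subset fun μ ⟨φ, h0, _, hφ⟩ =>
      Module.End.hasEigenvalue_of_hasEigenvector (x := φ)
        ⟨Module.End.mem_eigenspace_iff.mpr (LinearMap.ext hφ), h0⟩
  have hpt : ∀ μ, ∃ x, (∃ φ, IsEig μ φ) → r₂ x = μ • r₁ x ∧ ∀ ψ, IsEig μ ψ → ψ (r₁ x) ≠ 0 := by
    intro μ
    by_cases hμ : ∃ φ, IsEig μ φ
    · obtain ⟨φ, h0, h1, h2⟩ := hμ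
      obtain ⟨x, hx, hφx⟩ := h.exists_apply_ne_zero H hσ he₀ hdec h0 h1 h2
      refine ⟨x, fun _ => ⟨hx, fun ψ ⟨k0, k1, k2⟩ hψ => k0 (LinearMap.ext fun v => ?_)⟩⟩
      have := h.mul_comm_of_wedge H (ψ := φ) (χ := ψ)
        (fun x => by rw [hr₂ _ h1, hr₂ _ k1, h2, k2]; ring) (r₁ x) v
      rw [hψ, mul_zero] at this
      exact (mul_eq_zero.mp this).resolve_left hφx
    · exact ⟨0, fun h1 => absurd h1 hμ⟩
  choose b₀ hb₀ using hpt
  let E := hfin.toFinset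
  have hE : ∀ μ, μ ∈ E ↔ ∃ φ, IsEig μ φ := fun μ => by simp [E]
  have hstart : LinearIndepOn ℂ (fun l => r₁ (b₀ l)) (E : Set ℂ) := by
    rw [linearIndepOn_finset_iff]
    intro c hc μ hμ
    obtain ⟨φ, hφ⟩ := (hE μ).mp hμ
    have h1 := congrArg φ hc
    rw [map_sum, map_zero, Finset.sum_eq_single μ] at h1
    · rw [map_smul, smul_eq_mul] at h1
      exact (mul_eq_zero.mp h1).resolve_right ((hb₀ μ ⟨φ, hφ⟩).2 φ hφ)
    · intro l hl hne
      have h2 := hr₂ φ hφ.2.1 (b₀ l)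
      rw [(hb₀ l ((hE l).mp hl)).1, map_smul, hφ.2.2, smul_eq_mul] at h2
      have h3 : (l - μ) * φ (r₁ (b₀ l)) = 0 := by linear_combination h2
      rw [map_smul, (mul_eq_zero.mp h3).resolve_left (sub_ne_zero.mpr hne), smul_zero]
    · exact fun h2 => absurd hμ h2
  have hcard : ∀ (s : Finset ℂ) (b : ℂ → (Fin 5 → ℂ)),
      LinearIndepOn ℂ (fun l => r₁ (b l)) (s : Set ℂ) → s.card ≤ 4 := fun s b hs => by
    have := LinearIndependent.fintype_card_le_finrank hs
    simpa using this
  have hstep : ∀ (k : ℕ) (s : Finset ℂ) (b : ℂ → (Fin 5 → ℂ)), s.card + k = 4 → E ⊆ s →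
      (∀ l ∈ E, b l = b₀ l) → (∀ l ∈ s, r₂ (b l) = l • r₁ (b l)) →
      LinearIndepOn ℂ (fun l => r₁ (b l)) (s : Set ℂ) →
      ∃ (s : Finset ℂ) (b : ℂ → (Fin 5 → ℂ)), s.card = 4 ∧ (∀ l ∈ s, r₂ (b l) = l • r₁ (b l)) ∧
        LinearIndepOn ℂ (fun l => r₁ (b l)) (s : Set ℂ) := by
    intro k
    induction k with
    | zero => exact fun s b hs _ _ h1 h2 => ⟨s, b, hs, h1, h2⟩
    | succ k ih =>
      intro s b hs hEs hb h1 h2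
      have hlt : Submodule.span ℂ ((fun l => r₁ (b l)) '' (s : Set ℂ)) < ⊤ := by
        refine Ne.lt_top fun ht => ?_
        have e1 := finrank_span_finset_le_card (R := ℂ) (s.image fun l => r₁ (b l))
        rw [Finset.coe_image, Set.finrank, ht, finrank_top, Module.finrank_fin_fun] at e1
        have e2 := Finset.card_image_le (s := s) (f := fun l => r₁ (b l))
        omega
      obtain ⟨χ, hχ0, hχ⟩ := exists_dual_ne_zero_of_lt_top hlt
      have hχs : ∀ l ∈ s, χ (r₁ (b l)) = 0 := fun l hl => hχ _ (Submodule.subset_span ⟨l, hl, rfl⟩)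
      obtain ⟨l, hl, x, hx, hχx⟩ : ∃ l, l ∉ s ∧ ∃ x, r₂ x = l • r₁ x ∧ χ (r₁ x) ≠ 0 := by
        by_contra! hcon
        have hex : ∀ l, ∃ η : Dual ℂ (Fin 4 → ℂ), l ∉ s → ∀ x, χ (r₁ x) = η (r₂ x - l • r₁ x) := by
          intro l
          by_cases hl : l ∈ s
          · exact ⟨0, fun h => absurd hl h⟩
          · obtain ⟨η, hη⟩ := exists_dual_comp_eq (r₂ - l • r₁) (χ ∘ₗ r₁) fun x hx =>
              hcon l hl x (sub_eq_zero.mp hx)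
            exact ⟨η, fun _ => hη⟩
        choose ψ hψ using hex
        have hψw : ∀ l, l ∉ s → ψ l (r₂ e₀) = 0 := fun l hl => by
          simpa [he₀] using (hψ l hl e₀).symm
        obtain ⟨v, hv, hv0, μ, hμ⟩ := exists_eigenvector_of_resolvent T hχ0 s ψ fun l hl => by
          ext z
          have := hψ l hl (σ (Pi.single z 1))
          rw [hσ, map_sub, map_smul] at this
          exact this.symm
        -- all members of the span kill `r₂ e₀` and the points `r₁ (b l)`, `l ∈ s`
        have hvw : v (r₂ e₀) = 0 := by
          refine Submodule.span_induction (p := fun v _ => v (r₂ e₀) = 0) ?_ rfl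
            (fun x y _ _ hx hy => by rw [LinearMap.add_apply, hx, hy, add_zero])
            (fun c x _ hx => by rw [LinearMap.smul_apply, hx, smul_zero]) hv
          rintro _ ⟨l, hl, rfl⟩
          exact hψw l hl
        have hvb : ∀ m ∈ s, v (r₁ (b m)) = 0 := by
          intro m hm
          refine Submodule.span_induction (p := fun v _ => v (r₁ (b m)) = 0) ?_ rfl
            (fun x y _ _ hx hy => by rw [LinearMap.add_apply, hx, hy, add_zero])
            (fun c x _ hx => by rw [LinearMap.smul_apply, hx, smul_zero]) hv
          rintro _ ⟨l, hl, rfl⟩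
          have e1 := hψ l hl (b m)
          rw [hχs m hm, h1 m hm, ← sub_smul, map_smul, smul_eq_mul] at e1
          exact (mul_eq_zero.mp e1.symm).resolve_left (sub_ne_zero.mpr fun h => hl (h ▸ hm))
        have hv' : IsEig μ v := ⟨hv0, hvw, fun z => LinearMap.congr_fun hμ z⟩
        have hμE : μ ∈ E := (hE μ).mpr ⟨v, hv'⟩
        exact (hb₀ μ ⟨v, hv'⟩).2 v hv' (by rw [← hb μ hμE]; exact hvb μ (hEs hμE))
      have hupd : ∀ m ∈ s, Function.update b l x m = b m := fun m hm =>
        Function.update_of_ne (fun (h : m = l) => hl (h ▸ hm)) _ _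
      refine ih (insert l s) (Function.update b l x)
        (by rw [Finset.card_insert_of_notMem hl]; omega)
        (hEs.trans (Finset.subset_insert l s)) (fun m hm => (hupd m (hEs hm)).trans (hb m hm)) ?_ ?_
      · intro m hm
        rcases Finset.mem_insert.mp hm with rfl | hm
        · rw [Function.update_self, hx]
        · rw [hupd m hm, h1 m hm]
      · rw [Finset.coe_insert, linearIndepOn_insert (by exact_mod_cast hl), Function.update_self]
        refine ⟨h2.congr fun m hm => by simp only [hupd m hm], fun hmem => hχx ?_⟩
        have himg : (fun m => r₁ (Function.update b l x m)) '' (s : Set ℂ)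
            = (fun m => r₁ (b m)) '' (s : Set ℂ) :=
          Set.image_congr fun m hm => by rw [hupd m hm]
        rw [himg] at hmem
        exact hχ _ hmem
  have hE4 := hcard E b₀ hstart
  exact hstep (4 - E.card) E b₀ (by omega) subset_rfl (fun l _ => rfl)
    (fun l hl => (hb₀ l ((hE l).mp hl)).1) hstart

/-- A minor form with one surjective row can be diagonalized. -/
theorem IsMinorForm.exists_diagonal (h : IsMinorForm Φ r₁ r₂)
    (H : IsQuadricParametrization Φ q) (hr₁ : Function.Surjective r₁) :
    ∃ E l w, IsDiagonalMinorForm Φ E l w := by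
  obtain ⟨σ, hσ'⟩ := r₁.exists_rightInverse_of_surjective (LinearMap.range_eq_top.mpr hr₁)
  have hσ : ∀ z, r₁ (σ z) = z := LinearMap.congr_fun hσ'
  have hker : finrank ℂ (LinearMap.ker r₁) = 1 := by
    have := LinearMap.finrank_range_add_finrank_ker r₁
    rw [LinearMap.range_eq_top.mpr hr₁, finrank_top, Module.finrank_fin_fun,
      Module.finrank_fin_fun] at this
    omega
  obtain ⟨⟨e₀, he₀⟩, hne, hspan⟩ := finrank_eq_one_iff'.mp hker
  have hdec : ∀ x, ∃ t : ℂ, x = σ (r₁ x) + t • e₀ := fun x => by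
    obtain ⟨t, ht⟩ := hspan ⟨x - σ (r₁ x), by rw [LinearMap.mem_ker, map_sub, hσ, sub_self]⟩
    have : t • e₀ = x - σ (r₁ x) := congrArg Subtype.val ht
    exact ⟨t, by rw [this]; abel⟩
  have he₀' : r₁ e₀ = 0 := he₀
  have he₀0 : e₀ ≠ 0 := fun h0 => hne (Subtype.ext h0)
  obtain ⟨s, b', hs, hb', hind'⟩ := h.exists_eigenbasis H hσ he₀' hdec
  let ε := (Finset.equivFinOfCardEq hs).symm
  let l : Fin 4 → ℂ := fun i => ε i
  let b : Fin 4 → (Fin 5 → ℂ) := fun i => b' (l i)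
  have hb : ∀ i, r₂ (b i) = l i • r₁ (b i) := fun i => hb' _ (ε i).2
  have hind : LinearIndependent ℂ fun i => r₁ (b i) := hind'.comp ε ε.injective
  let B := basisOfLinearIndependentOfCardEqFinrank hind (by simp)
  have hB : ∀ i, B i = r₁ (b i) := fun i => by simp [B]
  let w := B.equivFun (r₂ e₀)
  let E' : ((Fin 4 → ℂ) × ℂ) →ₗ[ℂ] (Fin 5 → ℂ) :=
    LinearMap.coprod (Fintype.linearCombination ℂ b) (LinearMap.toSpanSingleton ℂ _ e₀)
  have hE' : ∀ z t, E' (z, t) = ∑ i, z i • b i + t • e₀ := fun z t => by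
    simp [E', Fintype.linearCombination_apply]
  have hr₁E : ∀ z t, B.equivFun (r₁ (E' (z, t))) = z := fun z t => by
    rw [hE', map_add, map_smul, he₀', smul_zero, add_zero, map_sum]
    have : ∑ i, r₁ (z i • b i) = B.equivFun.symm z := by
      rw [B.equivFun_symm_apply]
      exact Finset.sum_congr rfl fun i _ => by rw [map_smul, hB]
    rw [this, LinearEquiv.apply_symm_apply]
  have hr₂E : ∀ z t, B.equivFun (r₂ (E' (z, t))) = fun i => l i * z i + t * w i := fun z t => by
    rw [hE', map_add, map_smul, map_add, map_smul, map_sum]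
    have : ∑ i, r₂ (z i • b i) = B.equivFun.symm fun i => l i * z i := by
      rw [B.equivFun_symm_apply]
      exact Finset.sum_congr rfl fun i _ => by rw [map_smul, hb, smul_smul, hB, mul_comm]
    rw [this, LinearEquiv.apply_symm_apply]
    rfl
  have hinj : Function.Injective E' := by
    rw [injective_iff_map_eq_zero]
    rintro ⟨z, t⟩ h0
    have hz : z = 0 := by rw [← hr₁E z t, h0, map_zero, map_zero]
    rw [hE', hz] at h0
    simp only [Pi.zero_apply, zero_smul, Finset.sum_const_zero, zero_add, smul_eq_zero,
      he₀0, or_false] at h0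
    rw [hz, h0]; rfl
  let E := LinearEquiv.ofInjectiveOfFinrankEq E' hinj (by simp)
  obtain ⟨Θ, hΘ, hΘe⟩ := h.mulVec (P := LinearMap.toMatrix' (B.equivFun : _ →ₗ[ℂ] _))
    (P' := LinearMap.toMatrix' (B.equivFun.symm : _ →ₗ[ℂ] _)) (by
      rw [← LinearMap.toMatrix'_comp]; simp)
  refine ⟨E, l, w, fun i j hij => ε.injective (Subtype.ext hij), fun hw => ?_, Θ, hΘ,
    fun z t => ?_⟩
  · have hw' : r₂ e₀ = 0 := by
      apply B.equivFun.injective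
      rw [map_zero]; exact hw
    exact he₀0 (h.eq_zero_of_rows_eq_zero H he₀' hw')
  · rw [hΘe]
    ext i j
    have e1 := hr₁E z t
    have e2 := hr₂E z t
    have e3 : E (z, t) = E' (z, t) := rfl
    simp only [LinearMap.comp_apply, ← Matrix.toLin'_apply', Matrix.toLin'_toMatrix', e3,
      LinearEquiv.coe_coe, e1, e2, Matrix.of_apply]

end Pencil
end QuadBir

open MvPolynomial
namespace QuadBir
open QuadraticMap Module

/-! ### The inverse in the diagonal case -/

section Inverse

variable {R : Type*} [CommRing R]

/-- The linear form `v ↦ D v ∧ w ∧ y` on a space of dimension four, for `D = diag l` and a bivector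
`y` with coordinates `y i j`, `i < j`. -/
def wedgeForm (l w : Fin 4 → R) (y : Fin 4 → Fin 4 → R) : Fin 4 → R :=
  ![l 0 * (w 1 * y 2 3 - w 2 * y 1 3 + w 3 * y 1 2),
    l 1 * (-w 0 * y 2 3 + w 2 * y 0 3 - w 3 * y 0 2),
    l 2 * (w 0 * y 1 3 - w 1 * y 0 3 + w 3 * y 0 1),
    l 3 * (-w 0 * y 1 2 + w 1 * y 0 2 - w 2 * y 0 1)]

/-- The four-form `D a ∧ D b ∧ a ∧ b` in terms of the bivector `y = a ∧ b`. -/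
def wedgeQuad (l : Fin 4 → R) (y : Fin 4 → Fin 4 → R) : R :=
  (l 0 * l 1 + l 2 * l 3) * y 0 1 * y 2 3 - (l 0 * l 2 + l 1 * l 3) * y 0 2 * y 1 3
    + (l 0 * l 3 + l 1 * l 2) * y 0 3 * y 1 2

variable (l w z : Fin 4 → R) (t : R)

/-- The minors of the matrix with rows `z` and `D z + t w`, `D = diag l`. -/
def pencilMinor (i j : Fin 4) : R :=
  z i * (l j * z j + t * w j) - z j * (l i * z i + t * w i)

/-- The four-form `D (D z + t w) ∧ w ∧ z ∧ D z`. -/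
def wedgeFactor : R :=
  ∑ j, wedgeForm l w (pencilMinor l w z t) j * (l j * z j + t * w j)

theorem sum_wedgeForm_mul_self : ∑ j, wedgeForm l w (pencilMinor l w z t) j * z j = 0 := by
  simp only [Fin.sum_univ_four, wedgeForm, pencilMinor, Matrix.cons_val]
  ring

theorem sum_wedgeForm_mul (i : Fin 4) :
    ∑ j, wedgeForm l w (pencilMinor l w z t) j * pencilMinor l w z t i j
      = wedgeFactor l w z t * z i := by
  have h := sum_wedgeForm_mul_self l w z t
  rw [wedgeFactor]
  generalize wedgeForm l w (pencilMinor l w z t) = c at h ⊢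
  simp only [Fin.sum_univ_four, pencilMinor] at h ⊢
  linear_combination (-(l i * z i + t * w i)) * h

theorem wedgeQuad_pencilMinor :
    wedgeQuad l (pencilMinor l w z t) = wedgeFactor l w z t * t := by
  simp only [wedgeQuad, wedgeFactor, Fin.sum_univ_four, wedgeForm, pencilMinor, Matrix.cons_val]
  ring

theorem map_wedgeForm {S : Type*} [CommRing S] (f : R →+* S) (y : Fin 4 → Fin 4 → R) (j : Fin 4) :
    f (wedgeForm l w y j)
      = wedgeForm (fun i => f (l i)) (fun i => f (w i)) (fun i k => f (y i k)) j := by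
  fin_cases j <;> simp [wedgeForm]

theorem map_wedgeQuad {S : Type*} [CommRing S] (f : R →+* S) (y : Fin 4 → Fin 4 → R) :
    f (wedgeQuad l y) = wedgeQuad (fun i => f (l i)) (fun i k => f (y i k)) := by
  simp [wedgeQuad]

theorem map_wedgeFactor {S : Type*} [CommRing S] (f : R →+* S) :
    f (wedgeFactor l w z t)
      = wedgeFactor (fun i => f (l i)) (fun i => f (w i)) (fun i => f (z i)) (f t) := by
  simp [wedgeFactor, map_wedgeForm, pencilMinor]
  rfl

/-- Where `w i ≠ 0`, the factor at the vector `z` with all entries but `z i = 0` equal to one is a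
Vandermonde determinant times `w i`, up to sign. -/
theorem exists_wedgeFactor_ne_zero {l w : Fin 4 → ℂ} (hl : Function.Injective l) (hw : w ≠ 0) :
    ∃ z, wedgeFactor l w z 0 ≠ 0 := by
  obtain ⟨i, hi⟩ := Function.ne_iff.mp hw
  have hd : ∀ j k, j ≠ k → l j - l k ≠ 0 := fun j k hjk => sub_ne_zero.mpr fun h => hjk (hl h)
  have key : ∀ a b c : Fin 4, a ≠ b → a ≠ c → b ≠ c →
      w i * (l a - l b) * (l a - l c) * (l b - l c) ≠ 0 := fun a b c h1 h2 h3 =>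
    mul_ne_zero (mul_ne_zero (mul_ne_zero hi (hd _ _ h1)) (hd _ _ h2)) (hd _ _ h3)
  refine ⟨fun j => if j = i then 0 else 1, fun h0 => ?_⟩
  fin_cases i
  · refine key 1 2 3 (by decide) (by decide) (by decide) ?_
    show w 0 * (l 1 - l 2) * (l 1 - l 3) * (l 2 - l 3) = 0
    simp [wedgeFactor, Fin.sum_univ_four, wedgeForm, pencilMinor] at h0
    linear_combination h0
  · refine key 0 2 3 (by decide) (by decide) (by decide) ?_
    show w 1 * (l 0 - l 2) * (l 0 - l 3) * (l 2 - l 3) = 0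
    simp [wedgeFactor, Fin.sum_univ_four, wedgeForm, pencilMinor] at h0
    linear_combination -h0
  · refine key 0 1 3 (by decide) (by decide) (by decide) ?_
    show w 2 * (l 0 - l 1) * (l 0 - l 3) * (l 1 - l 3) = 0
    simp [wedgeFactor, Fin.sum_univ_four, wedgeForm, pencilMinor] at h0
    linear_combination h0
  · refine key 0 1 2 (by decide) (by decide) (by decide) ?_
    show w 3 * (l 0 - l 1) * (l 0 - l 2) * (l 1 - l 2) = 0
    simp [wedgeFactor, Fin.sum_univ_four, wedgeForm, pencilMinor] at h0
    linear_combination -h0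

end Inverse

section

variable {Φ : QuadraticMap ℂ (Fin 5 → ℂ) (Fin 6 → ℂ)}

/-- Forms `G` of degree `d` that invert `Φ` up to a nonzero polynomial factor. -/
def HasInverse (Φ : QuadraticMap ℂ (Fin 5 → ℂ) (Fin 6 → ℂ)) (d : ℕ) : Prop :=
  ∃ (G : Fin 5 → MvPolynomial (Fin 6) ℂ) (k : MvPolynomial (Fin 5) ℂ),
    (∀ i, (G i).IsHomogeneous d) ∧ k ≠ 0 ∧ ∀ x i, eval (Φ x) (G i) = eval x k * x i

theorem linearEquiv_apply_eq_sum (E : ((Fin 4 → ℂ) × ℂ) ≃ₗ[ℂ] (Fin 5 → ℂ)) (z : Fin 4 → ℂ)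
    (t : ℂ) : E (z, t) = ∑ i, z i • E (Pi.single i 1, 0) + t • E (0, 1) := by
  simp only [← map_smul, ← map_sum, ← map_add]
  congr 1
  ext i
  · simp [Prod.fst_sum, Finset.sum_apply, Pi.single_apply]
  · simp [Prod.snd_sum]

theorem HasLinearInverse.hasInverse (h : HasLinearInverse Φ) : HasInverse Φ 1 := by
  obtain ⟨m, hm, hρ⟩ := h
  choose ρ hρ using hρ
  refine ⟨fun i => linPoly (ρ (LinearMap.proj i)), linPoly m, fun i => isHomogeneous_linPoly _,
    fun h0 => hm (LinearMap.ext fun x => ?_), fun x i => ?_⟩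
  · rw [← eval_linPoly, h0, map_zero, LinearMap.zero_apply]
  · rw [eval_linPoly, hρ, eval_linPoly]; rfl

variable {E : ((Fin 4 → ℂ) × ℂ) ≃ₗ[ℂ] (Fin 5 → ℂ)} {l w : Fin 4 → ℂ}

/-- The inverse has the coordinates `∑ j, wedgeForm j * y i j` for `z i`, and `wedgeQuad` for `t`,
where `y` is the bivector of minors; the common factor is `wedgeFactor`. -/
theorem IsDiagonalMinorForm.hasInverse (h : IsDiagonalMinorForm Φ E l w) : HasInverse Φ 2 := by
  obtain ⟨hl, hw, Θ, hΘ, hΘe⟩ := h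
  let ρ : Fin 4 → Fin 4 → Dual ℂ (Fin 6 → ℂ) := fun i j =>
    { toFun := fun y => Θ y i j
      map_add' := fun y z => by simp
      map_smul' := fun c y => by simp }
  have hρ : ∀ z t, (fun i j => ρ i j (Φ (E (z, t)))) = pencilMinor l w z t := fun z t => by
    ext i j
    show Θ (Φ (E (z, t))) i j = _
    rw [hΘe]; rfl
  let Y : Fin 4 → Fin 4 → MvPolynomial (Fin 6) ℂ := fun i j => linPoly (ρ i j)
  have hY : ∀ y i j, eval y (Y i j) = ρ i j y := fun y i j => eval_linPoly _ _
  have hYh : ∀ i j, (Y i j).IsHomogeneous 1 := fun i j => isHomogeneous_linPoly _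
  let c := wedgeForm (fun i => (C (l i) : MvPolynomial (Fin 6) ℂ)) (fun i => C (w i)) Y
  have hmul : ∀ (a : ℂ) i j, (C a * Y i j).IsHomogeneous 1 := fun a i j => (hYh i j).C_mul a
  have hc : ∀ j, (c j).IsHomogeneous 1 := by
    have hneg : ∀ (a : ℂ) i j, (-C a * Y i j).IsHomogeneous 1 := fun a i j => by
      rw [← map_neg]; exact hmul _ _ _
    intro j
    match j with
    | 0 => exact (((hmul _ _ _).sub (hmul _ _ _)).add (hmul _ _ _)).C_mul _
    | 1 => exact (((hneg _ _ _).add (hmul _ _ _)).sub (hmul _ _ _)).C_mul _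
    | 2 => exact (((hmul _ _ _).sub (hmul _ _ _)).add (hmul _ _ _)).C_mul _
    | 3 => exact (((hneg _ _ _).add (hmul _ _ _)).sub (hmul _ _ _)).C_mul _
  let Gz : Fin 4 → MvPolynomial (Fin 6) ℂ := fun i => ∑ j, c j * Y i j
  let Gt := wedgeQuad (fun i => (C (l i) : MvPolynomial (Fin 6) ℂ)) Y
  have hGz : ∀ i, (Gz i).IsHomogeneous 2 := fun i =>
    IsHomogeneous.sum _ _ _ fun j _ => (hc j).mul (hYh i j)
  have hGt : Gt.IsHomogeneous 2 := by
    have hq : ∀ (a b a' b' : ℂ) i j k m,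
        ((C a * C b + C a' * C b') * Y i j * Y k m).IsHomogeneous 2 := fun a b a' b' i j k m => by
      rw [← map_mul, ← map_mul, ← _root_.map_add]
      exact (hmul _ _ _).mul (hYh _ _)
    exact ((hq _ _ _ _ _ _ _ _).sub (hq _ _ _ _ _ _ _ _)).add (hq _ _ _ _ _ _ _ _)
  have hGze : ∀ z t i, eval (Φ (E (z, t))) (Gz i) = wedgeFactor l w z t * z i := by
    intro z t i
    rw [← sum_wedgeForm_mul]
    simp only [Gz, map_sum, map_mul, c, map_wedgeForm, eval_C, hY, ← hρ]
  have hGte : ∀ z t, eval (Φ (E (z, t))) Gt = wedgeFactor l w z t * t := by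
    intro z t
    rw [← wedgeQuad_pencilMinor]
    simp only [Gt, map_wedgeQuad, eval_C, hY, ← hρ]
  let Z : Fin 4 → MvPolynomial (Fin 5) ℂ := fun i =>
    linPoly (LinearMap.proj i ∘ₗ LinearMap.fst ℂ (Fin 4 → ℂ) ℂ ∘ₗ E.symm.toLinearMap)
  let T : MvPolynomial (Fin 5) ℂ := linPoly (LinearMap.snd ℂ (Fin 4 → ℂ) ℂ ∘ₗ E.symm.toLinearMap)
  let k := wedgeFactor (fun i => (C (l i) : MvPolynomial (Fin 5) ℂ)) (fun i => C (w i)) Z T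
  have hk : ∀ z t, eval (E (z, t)) k = wedgeFactor l w z t := fun z t => by
    simp only [k, map_wedgeFactor, eval_C, Z, T, eval_linPoly]
    simp
  refine ⟨fun m => ∑ i, C (E (Pi.single i 1, 0) m) * Gz i + C (E (0, 1) m) * Gt, k,
    fun m => ((IsHomogeneous.sum _ _ _ fun i _ => (hGz i).C_mul _).add (hGt.C_mul _)),
    fun h0 => ?_, fun x m => ?_⟩
  · obtain ⟨z, hz⟩ := exists_wedgeFactor_ne_zero hl hw
    exact hz (by rw [← hk, h0, map_zero])
  · obtain ⟨⟨z, t⟩, rfl⟩ := E.surjective x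
    rw [hk]
    conv_rhs => rw [linearEquiv_apply_eq_sum]
    simp only [map_add, map_sum, map_mul, eval_C, hGze, hGte, Pi.add_apply, Finset.sum_apply,
      Pi.smul_apply, smul_eq_mul]
    rw [mul_add, Finset.mul_sum]
    congr 1
    · exact Finset.sum_congr rfl fun i _ => by ring
    · ring

end
end QuadBir

open MvPolynomial
namespace QuadBir
open QuadraticMap Module

/-! ### Quadratic forms as polynomials -/

section Hessian

variable {n : ℕ}

/-- The Hessian matrix of a quadratic form. -/
noncomputable def hessian (P : MvPolynomial (Fin n) ℂ) : Matrix (Fin n) (Fin n) ℂ :=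
  Matrix.of fun i j => constantCoeff (pderiv i (pderiv j P))

theorem pderiv_comm (i j : Fin n) (P : MvPolynomial (Fin n) ℂ) :
    pderiv i (pderiv j P) = pderiv j (pderiv i P) := by
  have h : ⁅(pderiv i : Derivation ℂ (MvPolynomial (Fin n) ℂ) (MvPolynomial (Fin n) ℂ)),
      (pderiv j : Derivation ℂ (MvPolynomial (Fin n) ℂ) (MvPolynomial (Fin n) ℂ))⁆ = 0 := by
    refine MvPolynomial.derivation_ext fun k => ?_
    rw [Derivation.commutator_apply, pderiv_X, pderiv_X]
    simp [Pi.single_apply, apply_ite]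
  have := congrArg (fun D => D P) h
  simp only [Derivation.commutator_apply] at this
  exact sub_eq_zero.mp this

theorem hessian_symm (P : MvPolynomial (Fin n) ℂ) (i j : Fin n) :
    hessian P i j = hessian P j i := by
  simp only [hessian, Matrix.of_apply, pderiv_comm i j P]

theorem eval_pderiv {P : MvPolynomial (Fin n) ℂ} (hP : P.IsHomogeneous 2) (x : Fin n → ℂ)
    (j : Fin n) : eval x (pderiv j P) = ∑ i, x i * hessian P i j := by
  have h1 : (pderiv j P).IsHomogeneous 1 := hP.pderiv
  have h2 := congrArg (eval x) h1.sum_X_mul_pderiv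
  rw [map_sum, one_smul] at h2
  rw [← h2]
  refine Finset.sum_congr rfl fun i _ => ?_
  rw [map_mul, eval_X, exists_eq_C_of_isHomogeneous_zero (P := pderiv i (pderiv j P)) h1.pderiv,
    eval_C]
  rfl

/-- The quadratic form given by a quadratic polynomial. -/
noncomputable def toQuadraticForm (P : MvPolynomial (Fin n) ℂ) : QuadraticForm ℂ (Fin n → ℂ) :=
  (2⁻¹ : ℂ) • LinearMap.BilinMap.toQuadraticMap (Matrix.toLinearMap₂' ℂ (hessian P))

theorem toQuadraticForm_apply {P : MvPolynomial (Fin n) ℂ} (hP : P.IsHomogeneous 2)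
    (x : Fin n → ℂ) : toQuadraticForm P x = eval x P := by
  have h2 := congrArg (eval x) hP.sum_X_mul_pderiv
  rw [map_sum, map_nsmul, nsmul_eq_mul] at h2
  simp only [map_mul, eval_X, eval_pderiv hP] at h2
  rw [toQuadraticForm, _root_.smul_apply, LinearMap.BilinMap.toQuadraticMap_apply,
    Matrix.toLinearMap₂'_apply, Finset.sum_comm]
  simp only [smul_eq_mul, Finset.mul_sum] at h2 ⊢
  rw [← mul_right_inj' (two_ne_zero (α := ℂ)), Finset.mul_sum]
  push_cast at h2
  rw [← h2]
  refine Finset.sum_congr rfl fun i _ => ?_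
  rw [Finset.mul_sum]
  exact Finset.sum_congr rfl fun j _ => by ring

theorem polar_toQuadraticForm (P : MvPolynomial (Fin n) ℂ) (x y : Fin n → ℂ) :
    polar (toQuadraticForm P) x y = ∑ j, y j * ∑ i, x i * hessian P i j := by
  have h1 : ∀ x y : Fin n → ℂ, Matrix.toLinearMap₂' ℂ (hessian P) x y
      = ∑ j, y j * ∑ i, x i * hessian P i j := fun x y => by
    rw [Matrix.toLinearMap₂'_apply, Finset.sum_comm]
    refine Finset.sum_congr rfl fun j _ => ?_
    rw [Finset.mul_sum]
    exact Finset.sum_congr rfl fun i _ => by simp only [smul_eq_mul]; ring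
  have h2 : Matrix.toLinearMap₂' ℂ (hessian P) y x = Matrix.toLinearMap₂' ℂ (hessian P) x y := by
    rw [Matrix.toLinearMap₂'_apply, Matrix.toLinearMap₂'_apply, Finset.sum_comm]
    refine Finset.sum_congr rfl fun j _ => Finset.sum_congr rfl fun i _ => ?_
    rw [hessian_symm]
    simp only [smul_eq_mul]; ring
  rw [toQuadraticForm, FunLike.coe_smul, polar_smul, LinearMap.BilinMap.polar_toQuadraticMap,
    h2, ← h1, smul_eq_mul]
  ring

/-- The radical of the polar form is the kernel of the Hessian. -/
theorem quadricRank_add_finrank_radical (P : MvPolynomial (Fin n) ℂ) :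
    quadricRank P + finrank ℂ (LinearMap.ker (toQuadraticForm P).polarBilin) = n := by
  have h1 : LinearMap.ker (toQuadraticForm P).polarBilin
      = LinearMap.ker (hessian P).mulVecLin := by
    ext x
    simp only [LinearMap.mem_ker]
    have hx : ∀ j, (hessian P).mulVecLin x j = ∑ i, x i * hessian P i j := fun j => by
      rw [Matrix.mulVecLin_apply, Matrix.mulVec, dotProduct]
      exact Finset.sum_congr rfl fun i _ => by rw [hessian_symm, mul_comm]
    constructor
    · intro h
      ext j
      have := LinearMap.congr_fun h (Pi.single j 1)
      rw [polarBilin_apply_apply, polar_toQuadraticForm] at this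
      rw [hx]
      simpa [Pi.single_apply] using this
    · intro h
      ext y
      simp [polar_toQuadraticForm, ← hx, h]
  have h2 := LinearMap.finrank_range_add_finrank_ker (hessian P).mulVecLin
  rw [Module.finrank_fin_fun] at h2
  rw [h1]
  exact h2

end Hessian

/-! ### From a left inverse to an inverse -/

section RightInverse

variable {n : ℕ} {F : Fin (n + 2) → MvPolynomial (Fin (n + 1)) ℂ}
  {q : MvPolynomial (Fin (n + 2)) ℂ}

theorem eval_bind₁ {σ τ : Type*} (x : τ → ℂ) (f : σ → MvPolynomial τ ℂ) (P : MvPolynomial σ ℂ) :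
    eval x (bind₁ f P) = eval (fun i => eval x (f i)) P := by
  have := aeval_bind₁ x f P
  simpa [MvPolynomial.aeval_eq_eval] using this

theorem mem_imageIdeal_iff {P : MvPolynomial (Fin (n + 2)) ℂ} :
    P ∈ imageIdeal F ↔ ∀ x, eval (fun j => eval x (F j)) P = 0 := by
  rw [imageIdeal, RingHom.mem_ker]
  constructor
  · intro h x
    have := congrArg (eval x) h
    rwa [map_zero, ← eval_bind₁] at *
  · intro h
    refine MvPolynomial.funext fun x => ?_
    rw [map_zero, ← h x]
    exact eval_bind₁ _ _ _

/-- A polynomial is determined modulo two variables by its restriction to their common zeros. -/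
theorem exists_eq_X_mul_add (i j : Fin n) (P : MvPolynomial (Fin n) ℂ) :
    ∃ a b, P = X i * a + X j * b + bind₁ (fun k => if k = i ∨ k = j then 0 else X k) P := by
  induction P using MvPolynomial.induction_on with
  | C c => exact ⟨0, 0, by simp⟩
  | add P Q hP hQ =>
    obtain ⟨a, b, h⟩ := hP
    obtain ⟨a', b', h'⟩ := hQ
    refine ⟨a + a', b + b', ?_⟩
    rw [map_add]
    linear_combination h + h'
  | mul_X P k hP =>
    obtain ⟨a, b, h⟩ := hP
    rw [map_mul, bind₁_X_right]
    by_cases h1 : k = i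
    · exact ⟨P, 0, by simp [h1, mul_comm]⟩
    · by_cases h2 : k = j
      · exact ⟨0, P, by simp [h2, mul_comm]⟩
      · refine ⟨a * X k, b * X k, ?_⟩
        rw [if_neg (by tauto)]
        linear_combination X k * h

/-- A rational map inverting `F` on the left, onto an irreducible hypersurface not containing a
coordinate subspace of codimension two, also inverts `F` on the right. On the hypersurface the
vector `K = F ∘ G` is proportional to `X`; the assumption on the subspace `X 0 = X 1 = 0` serves to
divide `K 0` by `X 0` modulo `q`. -/
theorem isInverseOfDegree_of_left_inverse (hF : ∀ j, (F j).IsHomogeneous 2)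
    (hq : q.IsHomogeneous 2) (hq0 : q ≠ 0)
    (hqX : ∀ a b, q ≠ X 0 * a + X 1 * b) (himage : imageIdeal F = Ideal.span {q})
    {d : ℕ} {G : Fin (n + 1) → MvPolynomial (Fin (n + 2)) ℂ} (hG : ∀ i, (G i).IsHomogeneous d)
    {h : MvPolynomial (Fin (n + 1)) ℂ} (h0 : h ≠ 0) (hGF : ∀ i, bind₁ F (G i) = h * X i) :
    IsInverseOfDegree F q d G := by
  refine ⟨hG, ⟨h, h0, hGF⟩, ?_⟩
  have hmem : ∀ P, P ∈ Ideal.span {q} ↔ bind₁ F P = 0 := fun P => by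
    rw [← himage]; exact RingHom.mem_ker
  let K := fun j => bind₁ G (F j)
  have hFK : ∀ j, bind₁ F (K j) = h ^ 2 * F j := by
    intro j
    refine MvPolynomial.funext fun x => ?_
    have h1 : (fun i => eval (fun k => eval x (F k)) (G i)) = eval x h • x := by
      ext i
      rw [← eval_bind₁, hGF, map_mul, eval_X, Pi.smul_apply, smul_eq_mul]
    rw [eval_bind₁, eval_bind₁, h1, ← toQuadraticForm_apply (hF j), QuadraticMap.map_smul,
      toQuadraticForm_apply (hF j), map_mul, map_pow, smul_eq_mul]
    ring
  have hX0 : X 0 ∉ Ideal.span {q} := by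
    rw [Ideal.mem_span_singleton]
    rintro ⟨c, hc⟩
    have hc0 : c ≠ 0 := fun h => X_ne_zero (R := ℂ) (0 : Fin (n + 2)) (by rw [hc, h, mul_zero])
    have h1 := totalDegree_mul_of_isDomain hq0 hc0
    rw [← hc, totalDegree_X, hq.totalDegree hq0] at h1
    omega
  have hF0 : F 0 ≠ 0 := fun h1 => hX0 ((hmem _).mpr (by rw [bind₁_X_right, h1]))
  have hK : ∀ i j, K i * X j - K j * X i ∈ Ideal.span {q} := fun i j => by
    rw [hmem, map_sub, map_mul, map_mul, hFK, hFK, bind₁_X_right, bind₁_X_right]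
    ring
  obtain ⟨m, hm⟩ := Ideal.mem_span_singleton.mp (hK 0 1)
  let π := bind₁ (R := ℂ) fun k : Fin (n + 2) => if k = 0 ∨ k = 1 then 0 else X k
  have hπ0 : π (X 0) = 0 := by simp [π]
  have hπ1 : π (X 1) = 0 := by simp [π]
  have hπq : π q ≠ 0 := fun h1 => by
    obtain ⟨a, b, h2⟩ := exists_eq_X_mul_add 0 1 q
    exact hqX a b (by rw [← add_zero (X 0 * a + X 1 * b), ← h1]; exact h2)
  have hπm : π m = 0 := by
    have := congrArg π hm
    rw [map_sub, map_mul, map_mul, map_mul, hπ0, hπ1, mul_zero, mul_zero, sub_zero] at this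
    exact (mul_eq_zero.mp this.symm).resolve_left hπq
  obtain ⟨a, b, hab⟩ := exists_eq_X_mul_add 0 1 m
  have hab' : m = X 0 * a + X 1 * b := by
    rw [← add_zero (X 0 * a + X 1 * b), ← hπm]; exact hab
  have h01 : ¬ (X 0 : MvPolynomial (Fin (n + 2)) ℂ) ∣ X 1 := by
    rw [X_dvd_X]; simp
  have hdvd : X 0 ∣ X 1 * (K 0 - q * b) := ⟨K 1 + q * a, by
    rw [hab'] at hm
    linear_combination hm⟩
  obtain ⟨k, hk⟩ := (X_dvd_mul_iff.mp hdvd).resolve_left h01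
  have hprime : ∀ P Q, P * Q ∈ Ideal.span {q} → P ∉ Ideal.span {q} → Q ∈ Ideal.span {q} :=
    fun P Q h1 h2 => by
      rw [hmem, map_mul] at h1
      rw [hmem] at h2 ⊢
      exact (mul_eq_zero.mp h1).resolve_left h2
  have hfin : ∀ j, K j - k * X j ∈ Ideal.span {q} := fun j => by
    refine hprime (X 0) _ ?_ hX0
    have h1 : X 0 * (K j - k * X j) = (K j * X 0 - K 0 * X j) + q * (b * X j) := by
      linear_combination X j * hk
    rw [h1]
    exact Ideal.add_mem _ (hK j 0) (Ideal.mul_mem_right _ _ (Ideal.mem_span_singleton_self q))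
  refine ⟨k, fun hk' => ?_, hfin⟩
  have h1 : K 0 ∈ Ideal.span {q} := by
    have := Ideal.add_mem _ (hfin 0) (Ideal.mul_mem_right (X 0) _ hk')
    rwa [sub_add_cancel] at this
  rw [hmem, hFK] at h1
  exact mul_ne_zero (pow_ne_zero 2 h0) hF0 h1

theorem not_isInverseOfDegree_zero {G : Fin (n + 1) → MvPolynomial (Fin (n + 2)) ℂ} :
    ¬ IsInverseOfDegree F q 0 G := by
  rintro ⟨hG, ⟨h, h0, hh⟩, -⟩
  have h1 := hh 0
  rw [exists_eq_C_of_isHomogeneous_zero (hG 0), bind₁_C_right] at h1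
  have h2 := congrArg (eval 0) h1
  rw [eval_C, map_mul, eval_X, Pi.zero_apply, mul_zero] at h2
  rw [h2, map_zero] at h1
  exact mul_ne_zero h0 (X_ne_zero 0) h1.symm

end RightInverse
end QuadBir

open MvPolynomial
namespace QuadBir
open QuadraticMap Module

/-! ### The quadratic map of a quadratic birational map -/

section Interface

/-- The quadratic map of affine spaces given by a tuple of quadratic polynomials. -/
noncomputable def toQuadraticMap (F : Fin 6 → MvPolynomial (Fin 5) ℂ) :
    QuadraticMap ℂ (Fin 5 → ℂ) (Fin 6 → ℂ) where
  toFun x j := toQuadraticForm (F j) x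
  toFun_smul a x := by
    ext j
    rw [QuadraticMap.map_smul]; rfl
  exists_companion' :=
    ⟨LinearMap.mk₂ ℂ (fun x y j => polar (toQuadraticForm (F j)) x y)
      (fun x x' y => by ext j; exact polar_add_left _ x x' y)
      (fun c x y => by ext j; exact polar_smul_left _ c x y)
      (fun x y y' => by ext j; exact polar_add_right _ x y y')
      (fun c x y => by ext j; exact polar_smul_right _ c x y),
    fun x y => by ext j; exact QuadraticMap.map_add _ x y⟩

theorem linPoly_ne_zero {n : ℕ} {ξ : Dual ℂ (Fin n → ℂ)} (hξ : ξ ≠ 0) : linPoly ξ ≠ 0 :=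
  fun h => hξ <| LinearMap.ext fun y => by
    rw [← eval_linPoly, h, map_zero, LinearMap.zero_apply]

theorem ne_zero_of_quadricRank_pos {n : ℕ} {P : MvPolynomial (Fin n) ℂ} (h : 0 < quadricRank P) :
    P ≠ 0 := by
  rintro rfl
  have : (Matrix.of fun i j : Fin n => constantCoeff (pderiv i (pderiv j
    (0 : MvPolynomial (Fin n) ℂ)))) = 0 := by ext; simp
  rw [quadricRank, this, Matrix.rank_zero] at h
  exact lt_irrefl _ h

theorem aeval_mul_of_isHomogeneous {A : Type*} [CommRing A] [Algebra ℂ A] {n m : ℕ}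
    {P : MvPolynomial (Fin n) ℂ} (hP : P.IsHomogeneous m) (s : A) (y : Fin n → A) :
    aeval (fun i => s * y i) P = s ^ m * aeval y P := by
  rw [aeval_def, aeval_def, eval₂_eq, eval₂_eq, Finset.mul_sum]
  refine Finset.sum_congr rfl fun d hd => ?_
  have hdeg : d.degree = m := by
    by_contra h
    exact mem_support_iff.mp hd (hP.coeff_eq_zero h)
  simp only [mul_pow, Finset.prod_mul_distrib, Finset.prod_pow_eq_pow_sum]
  rw [← hdeg, Finsupp.degree_apply]
  ring

variable {F : Fin 6 → MvPolynomial (Fin 5) ℂ} {q : MvPolynomial (Fin 6) ℂ}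

theorem toQuadraticMap_apply (hF : ∀ j, (F j).IsHomogeneous 2) (x : Fin 5 → ℂ) :
    toQuadraticMap F x = fun j => eval x (F j) :=
  funext fun j => toQuadraticForm_apply (hF j) x

/-- A linear form vanishing on the base locus vanishes on arcs of second order. On an affine chart
it belongs to the ideal of the base scheme, by the Nullstellensatz and reducedness, and all members
of this ideal vanish to order three along the arc. -/
theorem apply_eq_zero_of_reduced (hF : ∀ j, (F j).IsHomogeneous 2) (hred : HasReducedBaseLocus F)
    {ξ : Dual ℂ (Fin 5 → ℂ)} (hξ : ∀ x, toQuadraticMap F x = 0 → ξ x = 0) {v u₁ u₂ : Fin 5 → ℂ}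
    (hv : v ≠ 0) (h0 : toQuadraticMap F v = 0) (h1 : polar (toQuadraticMap F) v u₁ = 0)
    (h2 : toQuadraticMap F u₁ + polar (toQuadraticMap F) v u₂ = 0) : ξ u₂ = 0 := by
  obtain ⟨i, hi⟩ := Function.ne_iff.mp hv
  rw [Pi.zero_apply] at hi
  set I := Ideal.span (Set.range F) ⊔ Ideal.span {X i - 1} with hI
  have hmem : linPoly ξ ∈ I := by
    have hrad := (hred i).radical
    rw [← hI, ← vanishingIdeal_zeroLocus_eq_radical (K := ℂ)] at hrad
    rw [← hrad, mem_vanishingIdeal_iff]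
    intro x hx
    rw [aeval_eq_eval, eval_linPoly]
    refine hξ x ?_
    rw [toQuadraticMap_apply hF]
    ext j
    have := hx (F j) (Ideal.mem_sup_left (Ideal.subset_span ⟨j, rfl⟩))
    rwa [aeval_eq_eval] at this
  -- the arc, as a power series, normalized to lie on the chart
  let p : Fin 5 → Polynomial ℂ := fun a =>
    Polynomial.C (v a) + Polynomial.X * Polynomial.C (u₁ a) + Polynomial.X ^ 2 * Polynomial.C (u₂ a)
  have hp : ∀ t a, (p a).eval t = (v + t • (u₁ + t • u₂)) a := fun t a => by
    simp [p]; ring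
  have hunit : IsUnit (p i : PowerSeries ℂ) := by
    rw [PowerSeries.isUnit_iff_constantCoeff, ← PowerSeries.coeff_zero_eq_constantCoeff_apply,
      Polynomial.coeff_coe]
    simp [p, Polynomial.mul_coeff_zero, hi]
  obtain ⟨s, hs⟩ := hunit.exists_left_inv
  let φ : MvPolynomial (Fin 5) ℂ →ₐ[ℂ] PowerSeries ℂ := aeval fun a => s * (p a : PowerSeries ℂ)
  let ψ : MvPolynomial (Fin 5) ℂ →ₐ[ℂ] Polynomial ℂ := aeval p
  have hψ : ∀ P t, (ψ P).eval t = eval (v + t • (u₁ + t • u₂)) P := fun P t => by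
    induction P using MvPolynomial.induction_on with
    | C c => simp [ψ]
    | add P Q hP hQ => simp [hP, hQ]
    | mul_X P k hP =>
      rw [map_mul, Polynomial.eval_mul, hP, map_mul, eval_X, ← hp]
      simp [ψ]
  have hφ : ∀ {m : ℕ} (P : MvPolynomial (Fin 5) ℂ), P.IsHomogeneous m →
      φ P = s ^ m * (ψ P : PowerSeries ℂ) := fun P hP => by
    have h1 := comp_aeval_apply (B := PowerSeries ℂ) p
      (Polynomial.coeToPowerSeries.algHom (R := ℂ) ℂ) P
    rw [show φ P = _ from aeval_mul_of_isHomogeneous hP s _]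
    congr 1
    simpa [ψ, Polynomial.coeToPowerSeries.algHom_apply] using h1.symm
  have hFj : ∀ j, (Polynomial.X ^ 3) ∣ ψ (F j) := by
    intro j
    refine ⟨Polynomial.C (polar (toQuadraticMap F) u₁ u₂ j)
      + Polynomial.X * Polynomial.C (toQuadraticMap F u₂ j), Polynomial.funext fun t => ?_⟩
    rw [hψ]
    have e1 := congrFun (toQuadraticMap_apply hF (v + t • (u₁ + t • u₂))) j
    rw [map_add_smul, map_add_smul, h0, polar_add_right, h1, polar_smul_right,
      eq_neg_of_add_eq_zero_left h2] at e1
    rw [← e1]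
    simp
    ring
  have hIφ : ∀ P ∈ I, PowerSeries.X ^ 3 ∣ φ P := by
    intro P hP
    have : I ≤ (Ideal.span {(PowerSeries.X : PowerSeries ℂ) ^ 3}).comap φ := by
      rw [hI, sup_le_iff, Ideal.span_le, Ideal.span_le]
      constructor
      · rintro _ ⟨j, rfl⟩
        rw [SetLike.mem_coe, Ideal.mem_comap, Ideal.mem_span_singleton, hφ _ (hF j)]
        obtain ⟨c, hc⟩ := hFj j
        refine Dvd.intro (s ^ 2 * (c : PowerSeries ℂ)) ?_
        rw [hc]
        push_cast
        ring
      · rintro _ rfl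
        rw [SetLike.mem_coe, Ideal.mem_comap, map_sub, map_one]
        have : φ (X i) = 1 := by rw [← hs]; simp [φ]
        rw [this, sub_self]
        exact Ideal.zero_mem _
    exact Ideal.mem_span_singleton.mp (this hP)
  have h3 := hIφ _ hmem
  rw [hφ _ (isHomogeneous_linPoly ξ), pow_one] at h3
  have h4 : PowerSeries.X ^ 3 ∣ (ψ (linPoly ξ) : PowerSeries ℂ) := by
    have := h3.mul_left (p i : PowerSeries ℂ)
    rwa [← mul_assoc, mul_comm (p i : PowerSeries ℂ) s, hs, one_mul] at this
  have h5 := PowerSeries.X_pow_dvd_iff.mp h4 2 (by norm_num)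
  have h6 : ψ (linPoly ξ) = Polynomial.C (ξ v) + Polynomial.X * Polynomial.C (ξ u₁)
      + Polynomial.X ^ 2 * Polynomial.C (ξ u₂) := Polynomial.funext fun t => by
    rw [hψ, eval_linPoly]
    simp
    ring
  rw [Polynomial.coeff_coe, h6] at h5
  simpa [Polynomial.coeff_C, Polynomial.coeff_X_pow_mul'] using h5

theorem isQuadricParametrization (hq : q.IsHomogeneous 2) (hrank : 5 ≤ quadricRank q)
    (hF : IsQuadraticBirationalOnto F q) (hred : HasReducedBaseLocus F) :
    IsQuadricParametrization (toQuadraticMap F) (toQuadraticForm q) := by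
  have hΦ := toQuadraticMap_apply hF.homogeneous
  have hq0 : q ≠ 0 := ne_zero_of_quadricRank_pos (by omega)
  have hmem : ∀ P, P ∈ Ideal.span {q} ↔ ∀ x, eval (toQuadraticMap F x) P = 0 := fun P => by
    simp_rw [← hF.image_closure, mem_imageIdeal_iff, hΦ]
  refine ⟨fun x => ?_, fun ρ hρ => ?_, fun ξ η hξ hη => ?_, ?_, ?_⟩
  · rw [toQuadraticForm_apply hq]
    exact (hmem q).mp (Ideal.mem_span_singleton_self q) x
  · have h1 : linPoly ρ ∈ Ideal.span {q} := (hmem _).mpr fun x => by rw [eval_linPoly, hρ]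
    obtain ⟨c, hc⟩ := Ideal.mem_span_singleton.mp h1
    by_contra hρ0
    have h2 := linPoly_ne_zero hρ0
    have hc0 : c ≠ 0 := fun h => h2 (by rw [hc, h, mul_zero])
    have h3 := totalDegree_mul_of_isDomain hq0 hc0
    rw [← hc, (isHomogeneous_linPoly ρ).totalDegree h2, hq.totalDegree hq0] at h3
    omega
  · obtain ⟨d, G, -, ⟨h, h0, hh⟩, -⟩ := hF.birational
    have hprod := mul_ne_zero (mul_ne_zero h0 (linPoly_ne_zero hξ)) (linPoly_ne_zero hη)
    obtain ⟨x, hx⟩ : ∃ x, eval x (h * linPoly ξ * linPoly η) ≠ 0 := by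
      by_contra! hc
      exact hprod (MvPolynomial.funext fun x => by rw [hc, map_zero])
    rw [map_mul, map_mul, eval_linPoly, eval_linPoly] at hx
    have hξx := right_ne_zero_of_mul (left_ne_zero_of_mul hx)
    refine ⟨x, hξx, right_ne_zero_of_mul hx, fun x' hx' => ?_⟩
    have hG : ∀ x i, eval (toQuadraticMap F x) (G i) = eval x h * x i := fun x i => by
      rw [hΦ, ← eval_bind₁, hh, map_mul, eval_X]
    have he : ∀ i, eval x' h * x' i = eval x h * x i := fun i => by rw [← hG, ← hG, hx']
    have hhx := left_ne_zero_of_mul (left_ne_zero_of_mul hx)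
    have hx'h : eval x' h ≠ 0 := fun h1 => hξx <| by
      have : x = 0 := funext fun i => by
        have := he i
        rw [h1, zero_mul] at this
        exact (mul_eq_zero.mp this.symm).resolve_left hhx
      rw [this, map_zero]
    refine ⟨eval x h / eval x' h, funext fun i => ?_⟩
    rw [Pi.smul_apply, smul_eq_mul]
    field_simp
    linear_combination he i
  · exact fun ξ hξ v u₁ u₂ => apply_eq_zero_of_reduced hF.homogeneous hred hξ
  · have := quadricRank_add_finrank_radical q
    omega

/-- A left inverse of the quadratic map defines an inverse rational map. A quadric containing the
subspace `X 0 = X 1 = 0` of codimension two would have rank at most four. -/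
theorem HasInverse.exists_isInverseOfDegree (hq : q.IsHomogeneous 2) (hrank : 5 ≤ quadricRank q)
    (hF : IsQuadraticBirationalOnto F q) {d : ℕ} (h : HasInverse (toQuadraticMap F) d) :
    ∃ G, IsInverseOfDegree F q d G := by
  obtain ⟨G, k, hG, hk, hGk⟩ := h
  refine ⟨G, isInverseOfDegree_of_left_inverse hF.homogeneous hq
    (ne_zero_of_quadricRank_pos (by omega)) (fun a b hab => ?_)
    hF.image_closure hG hk fun i => MvPolynomial.funext fun x => ?_⟩
  · obtain ⟨g, hg⟩ := exists_eq_sum_mul (V := Fin 6 → ℂ) ![LinearMap.proj 0, LinearMap.proj 1]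
      (toQuadraticForm q) fun y hy => by
        have h0 : y 0 = 0 := hy 0
        have h1 : y 1 = 0 := hy 1
        rw [toQuadraticForm_apply hq, hab]
        simp [h0, h1]
    have h1 := quadricRank_add_finrank_radical q
    have h2 := finrank_le_of_eq_sum_mul _ (by omega) _ _ hg
    rw [Module.finrank_fin_fun] at h2
    omega
  · rw [eval_bind₁, map_mul, eval_X, ← hGk, toQuadraticMap_apply hF.homogeneous]

end Interface
end QuadBir

open MvPolynomial
namespace QuadBir
open QuadraticMap Module

/-! ### The zeros of a diagonal minor form -/

section Zeros

variable {Φ : QuadraticMap ℂ (Fin 5 → ℂ) (Fin 6 → ℂ)}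
  {E : ((Fin 4 → ℂ) × ℂ) ≃ₗ[ℂ] (Fin 5 → ℂ)} {l w : Fin 4 → ℂ}

/-- Diagonal minor forms can be reordered. -/
theorem IsDiagonalMinorForm.reindex (h : IsDiagonalMinorForm Φ E l w) (σ : Equiv.Perm (Fin 4)) :
    ∃ E', IsDiagonalMinorForm Φ E' (l ∘ σ) (w ∘ σ) := by
  obtain ⟨hl, hw, Θ, hΘ, e⟩ := h
  refine ⟨((LinearEquiv.funCongrLeft ℂ ℂ σ.symm).prodCongr (LinearEquiv.refl ℂ ℂ)).trans E,
    hl.comp σ.injective, fun h0 => hw ?_,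
    (Matrix.reindexLinearEquiv ℂ ℂ σ.symm σ.symm).toLinearMap ∘ₗ Θ,
    (Matrix.reindexLinearEquiv ℂ ℂ σ.symm σ.symm).injective.comp hΘ, fun z t => ?_⟩
  · ext i
    simpa using congrFun h0 (σ.symm i)
  · have h1 : (((LinearEquiv.funCongrLeft ℂ ℂ σ.symm).prodCongr (LinearEquiv.refl ℂ ℂ)).trans E)
        (z, t) = E (z ∘ σ.symm, t) := rfl
    rw [h1, LinearMap.comp_apply, e]
    ext i j
    simp

/-- The nonzero `w i` can be placed first. -/
theorem IsDiagonalMinorForm.exists_sorted (h : IsDiagonalMinorForm Φ E l w) :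
    ∃ E' l' w', IsDiagonalMinorForm Φ E' l' w' ∧ ∀ i j : Fin 4, i ≤ j → w' j ≠ 0 → w' i ≠ 0 := by
  let f : Fin 4 → ℕ := fun i => if w i = 0 then 1 else 0
  obtain ⟨E', h'⟩ := h.reindex (Tuple.sort f)
  refine ⟨E', _, _, h', fun i j hij hj hi => ?_⟩
  have h1 : f (Tuple.sort f i) ≤ f (Tuple.sort f j) := Tuple.monotone_sort f hij
  have hi' : w (Tuple.sort f i) = 0 := hi
  have hj' : w (Tuple.sort f j) ≠ 0 := hj
  simp [f, hi', hj'] at h1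

/-- The zeros are the points with proportional rows. -/
theorem IsDiagonalMinorForm.map_eq_zero_iff (h : IsDiagonalMinorForm Φ E l w) (z : Fin 4 → ℂ)
    (t : ℂ) : Φ (E (z, t)) = 0 ↔ z = 0 ∨ ∃ s, ∀ i, (s - l i) * z i = t * w i := by
  obtain ⟨-, -, Θ, hΘ, e⟩ := h
  have h1 : Φ (E (z, t)) = 0 ↔
      ∀ i j, z i * (l j * z j + t * w j) - z j * (l i * z i + t * w i) = 0 := by
    rw [← _root_.map_eq_zero_iff Θ hΘ, e]
    exact ⟨fun h i j => congrFun (congrFun h i) j, fun h => by ext i j; exact h i j⟩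
  rw [h1]
  constructor
  · intro h2
    by_cases hz : z = 0
    · exact Or.inl hz
    right
    obtain ⟨i, hi⟩ := Function.ne_iff.mp hz
    rw [Pi.zero_apply] at hi
    refine ⟨(l i * z i + t * w i) / z i, fun j => ?_⟩
    field_simp
    linear_combination -h2 i j
  · rintro (rfl | ⟨s, hs⟩) i j
    · simp
    · linear_combination -z i * hs j + z j * hs i

/-- The points of the curve traced by the kernels of `r₂ - s r₁`, where `r₁`, `r₂` are the rows of a
diagonal pencil and `S` is the set of indices with `w i ≠ 0`. -/
noncomputable def curvePoint (E : ((Fin 4 → ℂ) × ℂ) ≃ₗ[ℂ] (Fin 5 → ℂ)) (l w : Fin 4 → ℂ)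
    (S : Finset (Fin 4)) (s τ : ℂ) : Fin 5 → ℂ :=
  E (fun i => τ * w i * ∏ j ∈ S.erase i, (s - l j * τ), ∏ j ∈ S, (s - l j * τ))

theorem IsDiagonalMinorForm.map_curvePoint (h : IsDiagonalMinorForm Φ E l w) {S : Finset (Fin 4)}
    (hS : ∀ i, i ∈ S ↔ w i ≠ 0) (s τ : ℂ) : Φ (curvePoint E l w S s τ) = 0 := by
  rw [curvePoint, h.map_eq_zero_iff]
  by_cases hτ : τ = 0
  · left; ext i; simp [hτ]
  · refine Or.inr ⟨s / τ, fun i => ?_⟩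
    by_cases hi : i ∈ S
    · rw [← Finset.mul_prod_erase S _ hi]
      field_simp
    · have : w i = 0 := by simpa [hS] using hi
      simp [this]

theorem IsDiagonalMinorForm.exists_eq_curvePoint (h : IsDiagonalMinorForm Φ E l w)
    {S : Finset (Fin 4)} (hS : ∀ i, i ∈ S ↔ w i ≠ 0) {z : Fin 4 → ℂ} {t : ℂ}
    (h0 : Φ (E (z, t)) = 0) (hz : ∀ i, i ∉ S → z i = 0) :
    ∃ s τ c : ℂ, E (z, t) = c • curvePoint E l w S s τ := by
  have hext : ∀ s τ c : ℂ, (∀ i, z i = c * (τ * w i * ∏ j ∈ S.erase i, (s - l j * τ))) →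
      t = c * ∏ j ∈ S, (s - l j * τ) → E (z, t) = c • curvePoint E l w S s τ := by
    intro s τ c h1 h2
    rw [curvePoint, ← map_smul]
    congr 1
    exact Prod.ext (funext h1) h2
  rcases (h.map_eq_zero_iff z t).mp h0 with rfl | ⟨s, hs⟩
  · exact ⟨1, 0, t, hext _ _ _ (fun i => by simp) (by simp)⟩
  by_cases hj : ∃ j ∈ S, s = l j
  · obtain ⟨j, hjS, rfl⟩ := hj
    have hne : ∀ i, i ≠ j → l j - l i ≠ 0 := fun i hi =>
      sub_ne_zero.mpr fun h' => hi (h.injective h').symm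
    have ht : t = 0 := by
      have := hs j
      rw [sub_self, zero_mul] at this
      exact (mul_eq_zero.mp this.symm).resolve_right ((hS j).mp hjS)
    have hprod : w j * ∏ i ∈ S.erase j, (l j - l i) ≠ 0 :=
      mul_ne_zero ((hS j).mp hjS) (Finset.prod_ne_zero_iff.mpr fun i hi =>
        hne i (Finset.ne_of_mem_erase hi))
    refine ⟨l j, 1, z j / (w j * ∏ i ∈ S.erase j, (l j - l i)), hext _ _ _ (fun i => ?_) ?_⟩
    · by_cases hij : i = j
      · subst hij
        simp only [one_mul, mul_one]
        rw [div_mul_cancel₀ _ hprod]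
      · have hzi : z i = 0 := by
          have := hs i
          rw [ht, zero_mul] at this
          exact (mul_eq_zero.mp this).resolve_left (hne i hij)
        rw [hzi, Finset.prod_eq_zero (Finset.mem_erase.mpr ⟨Ne.symm hij, hjS⟩) (by ring)]
        ring
    · rw [ht, Finset.prod_eq_zero hjS (by ring), mul_zero]
  · push Not at hj
    have hprod : ∏ j ∈ S, (s - l j) ≠ 0 :=
      Finset.prod_ne_zero_iff.mpr fun j hj' => sub_ne_zero.mpr (hj j hj')
    refine ⟨s, 1, t / ∏ j ∈ S, (s - l j), hext _ _ _ (fun i => ?_) ?_⟩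
    · by_cases hi : i ∈ S
      · simp only [one_mul, mul_one]
        have h1 : s - l i ≠ 0 := sub_ne_zero.mpr (hj i hi)
        rw [← Finset.mul_prod_erase S _ hi] at hprod ⊢
        have h2 := right_ne_zero_of_mul hprod
        field_simp
        linear_combination hs i
      · have : w i = 0 := by simpa [hS] using hi
        rw [hz i hi, this]
        ring
    · simp only [mul_one]
      rw [div_mul_cancel₀ _ hprod]

theorem IsDiagonalMinorForm.map_eq_zero_of_line (h : IsDiagonalMinorForm Φ E l w) {j : Fin 4}
    (hj : w j = 0) {z : Fin 4 → ℂ} {t : ℂ} (hz : ∀ i, i ≠ j → z i = t * (w i / (l j - l i))) :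
    Φ (E (z, t)) = 0 := by
  refine (h.map_eq_zero_iff z t).mpr (Or.inr ⟨l j, fun i => ?_⟩)
  by_cases hij : i = j
  · subst hij
    simp [hj]
  · have hne : l j - l i ≠ 0 := sub_ne_zero.mpr fun h' => hij (h.injective h').symm
    rw [hz i hij]
    field_simp

theorem IsDiagonalMinorForm.line_of_map_eq_zero (h : IsDiagonalMinorForm Φ E l w) {j : Fin 4}
    (hj : w j = 0) {z : Fin 4 → ℂ} {t : ℂ} (h0 : Φ (E (z, t)) = 0) (hzj : z j ≠ 0) (i : Fin 4)
    (hij : i ≠ j) : z i = t * (w i / (l j - l i)) := by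
  have hne : l j - l i ≠ 0 := sub_ne_zero.mpr fun h' => hij (h.injective h').symm
  rcases (h.map_eq_zero_iff z t).mp h0 with rfl | ⟨s, hs⟩
  · exact absurd rfl hzj
  · have h1 := hs j
    rw [hj, mul_zero] at h1
    have h2 : s = l j := sub_eq_zero.mp ((mul_eq_zero.mp h1).resolve_right hzj)
    have h3 := hs i
    rw [h2] at h3
    field_simp
    linear_combination h3

/-! ### The base locus as a subset of projective space -/

theorem mem_of_submodule_le {W : Submodule ℂ (Fin 5 → ℂ)} (p : ProjSpace 4) :
    p.submodule ≤ W ↔ p.rep ∈ W := by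
  rw [Projectivization.submodule_eq, Submodule.span_singleton_le_iff_mem]

theorem submodule_eq_span_of_smul {p : ProjSpace 4} {x : Fin 5 → ℂ} {c : ℂ} (h : p.rep = c • x) :
    p.submodule = Submodule.span ℂ {x} := by
  have hc : c ≠ 0 := fun hc => p.rep_nonzero (by rw [h, hc, zero_smul])
  rw [Projectivization.submodule_eq, h]
  exact Submodule.span_singleton_smul_eq (isUnit_iff_ne_zero.mpr hc) x

theorem exists_rep_eq_smul {p : ProjSpace 4} {x : Fin 5 → ℂ}
    (h : p.submodule = Submodule.span ℂ {x}) : ∃ c : ℂ, p.rep = c • x := by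
  have : p.rep ∈ p.submodule := by
    rw [Projectivization.submodule_eq]; exact Submodule.mem_span_singleton_self _
  rw [h] at this
  obtain ⟨c, hc⟩ := Submodule.mem_span_singleton.mp this
  exact ⟨c, hc.symm⟩

theorem mem_baseLocus_iff {F : Fin 6 → MvPolynomial (Fin 5) ℂ} (hF : ∀ j, (F j).IsHomogeneous 2)
    (p : ProjSpace 4) : p ∈ baseLocus F ↔ toQuadraticMap F p.rep = 0 := by
  constructor
  · intro h
    rw [toQuadraticMap_apply hF]
    ext j
    refine h (F j) ⟨j, rfl⟩ p.rep ?_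
    rw [Projectivization.submodule_eq]
    exact Submodule.mem_span_singleton_self _
  · rintro h _ ⟨j, rfl⟩ v hv
    rw [Projectivization.submodule_eq] at hv
    obtain ⟨c, rfl⟩ := Submodule.mem_span_singleton.mp hv
    have h1 := congrFun (toQuadraticMap_apply hF (c • p.rep)) j
    rw [← h1, QuadraticMap.map_smul, h, smul_zero, Pi.zero_apply]

/-- The curve component of the zeros of a diagonal minor form. As `p.submodule` has dimension one,
parameters `s`, `τ` with `curvePoint E l w S s τ = 0` contribute nothing. -/
def curve (E : ((Fin 4 → ℂ) × ℂ) ≃ₗ[ℂ] (Fin 5 → ℂ)) (l w : Fin 4 → ℂ) (S : Finset (Fin 4)) :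
    Set (ProjSpace 4) :=
  {p | ∃ s τ, p.submodule = Submodule.span ℂ {curvePoint E l w S s τ}}

/-- The plane over the line that is a component of the zeros of a diagonal minor form, for each
index `j` with `w j = 0`. -/
def linePlane (E : ((Fin 4 → ℂ) × ℂ) ≃ₗ[ℂ] (Fin 5 → ℂ)) (l w : Fin 4 → ℂ) (j : Fin 4) :
    Submodule ℂ (Fin 5 → ℂ) :=
  Submodule.span ℂ (Set.range ![E (Pi.single j 1, 0), E (fun i => w i / (l j - l i), 1)])

theorem mem_linePlane_iff {j : Fin 4} (hj : w j = 0) (z : Fin 4 → ℂ) (t : ℂ) :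
    E (z, t) ∈ linePlane E l w j ↔ ∀ i, i ≠ j → z i = t * (w i / (l j - l i)) := by
  rw [linePlane, Submodule.mem_span_range_iff_exists_fun]
  simp only [Fin.sum_univ_two, Matrix.cons_val_zero, Matrix.cons_val_one, ← map_smul, ← map_add,
    E.injective.eq_iff]
  constructor
  · rintro ⟨c, hc⟩ i hij
    have h1 := congrArg Prod.snd hc
    have h2 := congrFun (congrArg Prod.fst hc) i
    simp [hij] at h1 h2
    rw [← h1, h2]
  · intro h
    refine ⟨![z j, t], ?_⟩
    ext i
    · by_cases hij : i = j
      · subst hij; simp [hj]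
      · simp [hij, h i hij]
    · simp

theorem finrank_linePlane (j : Fin 4) : finrank ℂ (linePlane E l w j) = 2 := by
  rw [linePlane, finrank_span_eq_card, Fintype.card_fin]
  rw [LinearIndependent.pair_iff]
  intro a b hab
  rw [← map_smul, ← map_smul, ← map_add, map_eq_zero_iff E E.injective] at hab
  have h1 := congrArg Prod.snd hab
  have h2 := congrFun (congrArg Prod.fst hab) j
  have hb : b = 0 := by simpa using h1
  subst hb
  simpa using h2

/-- The line components of the zeros of a diagonal minor form. -/
def lineAt (E : ((Fin 4 → ℂ) × ℂ) ≃ₗ[ℂ] (Fin 5 → ℂ)) (l w : Fin 4 → ℂ) (j : Fin 4) :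
    Set (ProjSpace 4) :=
  {p | p.submodule ≤ linePlane E l w j}

theorem isLine_lineAt (j : Fin 4) : IsLine (lineAt E l w j) :=
  ⟨linePlane E l w j, finrank_linePlane j, rfl⟩

theorem mem_curve_iff (h : IsDiagonalMinorForm Φ E l w) {S : Finset (Fin 4)}
    (hS : ∀ i, i ∈ S ↔ w i ≠ 0) (p : ProjSpace 4) : p ∈ curve E l w S ↔
      Φ p.rep = 0 ∧ ∀ i, i ∉ S → (E.symm p.rep).1 i = 0 := by
  constructor
  · rintro ⟨s, τ, hp⟩
    obtain ⟨c, hc⟩ := exists_rep_eq_smul hp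
    refine ⟨by rw [hc, QuadraticMap.map_smul, h.map_curvePoint hS, smul_zero], fun i hi => ?_⟩
    have : w i = 0 := by simpa [hS] using hi
    rw [hc, map_smul, curvePoint, E.symm_apply_apply]
    simp [this]
  · rintro ⟨h0, hz⟩
    have he : p.rep = E ((E.symm p.rep).1, (E.symm p.rep).2) := (E.apply_symm_apply _).symm
    rw [he] at h0
    obtain ⟨s, τ, c, hc⟩ := h.exists_eq_curvePoint hS h0 hz
    exact ⟨s, τ, submodule_eq_span_of_smul (he.trans hc)⟩

theorem mem_lineAt_iff {j : Fin 4} (hj : w j = 0) (p : ProjSpace 4) : p ∈ lineAt E l w j ↔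
    ∀ i, i ≠ j → (E.symm p.rep).1 i = (E.symm p.rep).2 * (w i / (l j - l i)) := by
  rw [← mem_linePlane_iff hj, Prod.mk.eta, E.apply_symm_apply]
  exact mem_of_submodule_le p

/-- A zero at which the row `z` has an entry `z j ≠ 0` with `w j = 0` has proportionality factor
`l j`, hence lies on the corresponding line; all other zeros lie on the curve. -/
theorem map_rep_eq_zero_iff (h : IsDiagonalMinorForm Φ E l w) {S : Finset (Fin 4)}
    (hS : ∀ i, i ∈ S ↔ w i ≠ 0) (p : ProjSpace 4) : Φ p.rep = 0 ↔
      p ∈ curve E l w S ∨ ∃ j, j ∉ S ∧ p ∈ lineAt E l w j := by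
  have he : E ((E.symm p.rep).1, (E.symm p.rep).2) = p.rep := E.apply_symm_apply _
  have hw : ∀ j, j ∉ S → w j = 0 := fun j hj => by simpa [hS] using hj
  rw [mem_curve_iff h hS]
  constructor
  · intro h0
    by_cases hz : ∀ i, i ∉ S → (E.symm p.rep).1 i = 0
    · exact Or.inl ⟨h0, hz⟩
    · push Not at hz
      obtain ⟨j, hj, hne⟩ := hz
      rw [← he] at h0
      exact Or.inr ⟨j, hj, (mem_lineAt_iff (hw j hj) p).mpr
        (h.line_of_map_eq_zero (hw j hj) h0 hne)⟩
  · rintro (⟨h0, -⟩ | ⟨j, hj, hp⟩)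
    · exact h0
    · rw [← he]
      exact h.map_eq_zero_of_line (hw j hj) ((mem_lineAt_iff (hw j hj) p).mp hp)

theorem disjoint_lineAt (h : IsDiagonalMinorForm Φ E l w) {j k : Fin 4} (hjk : j ≠ k)
    (hj : w j = 0) (hk : w k = 0) : Disjoint (lineAt E l w j) (lineAt E l w k) := by
  rw [Set.disjoint_left]
  intro p hpj hpk
  rw [mem_lineAt_iff hj] at hpj
  rw [mem_lineAt_iff hk] at hpk
  obtain ⟨i, hi⟩ := Function.ne_iff.mp h.ne_zero
  rw [Pi.zero_apply] at hi
  have hij : i ≠ j := fun h' => hi (h' ▸ hj)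
  have hik : i ≠ k := fun h' => hi (h' ▸ hk)
  have hne : ∀ a b, a ≠ b → l a - l b ≠ 0 := fun a b hab =>
    sub_ne_zero.mpr fun h' => hab (h.injective h')
  have ht : (E.symm p.rep).2 = 0 := by
    have h1 := (hpj i hij).symm.trans (hpk i hik)
    have h2 := hne j i hij.symm
    have h3 := hne k i hik.symm
    field_simp at h1
    have h4 : (E.symm p.rep).2 * (l k - l j) = 0 := by linear_combination h1
    exact (mul_eq_zero.mp h4).resolve_right (hne k j hjk.symm)
  refine p.rep_nonzero (E.symm.injective ?_)
  rw [map_zero]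
  refine Prod.ext (funext fun m => ?_) ht
  by_cases hmj : m = j
  · rw [hpk m (hmj ▸ hjk), ht, zero_mul]; rfl
  · rw [hpj m hmj, ht, zero_mul]; rfl

/-- The line meets the curve in the point with `z j = 0` and `t = 1`. -/
theorem lineAt_inter_curve_nonempty (h : IsDiagonalMinorForm Φ E l w) {S : Finset (Fin 4)}
    (hS : ∀ i, i ∈ S ↔ w i ≠ 0) {j : Fin 4} (hj : j ∉ S) :
    (lineAt E l w j ∩ curve E l w S).Nonempty := by
  have hwj : w j = 0 := by simpa [hS] using hj
  let x := E (fun i => w i / (l j - l i), 1)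
  have hx : x ≠ 0 := fun h0 => by
    have := congrArg Prod.snd ((map_eq_zero_iff E E.injective).mp h0)
    simp at this
  let p := Projectivization.mk ℂ x hx
  obtain ⟨c, hc⟩ := exists_rep_eq_smul (p := p) (Projectivization.submodule_mk x hx)
  have hc' : E.symm p.rep = c • (fun i => w i / (l j - l i), 1) := by
    rw [hc, map_smul, E.symm_apply_apply]
  have hp : p ∈ lineAt E l w j := by
    rw [mem_lineAt_iff hwj, hc']
    intro i _
    simp
  refine ⟨p, hp, (mem_curve_iff h hS p).mpr
    ⟨(map_rep_eq_zero_iff h hS p).mpr (Or.inr ⟨j, hj, hp⟩), fun i hi => ?_⟩⟩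
  have : w i = 0 := by simpa [hS] using hi
  rw [hc']
  simp [this]

end Zeros
end QuadBir

open MvPolynomial
namespace QuadBir
open QuadraticMap Module

/-! ### The curve component -/

section Curves

variable {E : ((Fin 4 → ℂ) × ℂ) ≃ₗ[ℂ] (Fin 5 → ℂ)} {l w : Fin 4 → ℂ}

/-- A curve parametrized by `d + 1` linearly independent binary forms `P a` of degree `d` is a
rational normal curve. The matrix `M` holds the coefficients of these forms. -/
theorem isRationalNormalCurve_of_param {d : ℕ} {b : Fin (d + 1) → (Fin 5 → ℂ)}
    (hb : LinearIndependent ℂ b) (P : Fin (d + 1) → ℂ → ℂ → ℂ)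
    (M : Matrix (Fin (d + 1)) (Fin (d + 1)) ℂ)
    (hM : ∀ a s t, P a s t = ∑ m, M a m * (s ^ (d - (m : ℕ)) * t ^ (m : ℕ)))
    (hP : ∀ c : Fin (d + 1) → ℂ, (∀ s t, ∑ a, c a * P a s t = 0) → c = 0) :
    IsRationalNormalCurve d
      {p : ProjSpace 4 | ∃ s t, p.submodule = Submodule.span ℂ {∑ a, P a s t • b a}} := by
  have hunit : IsUnit M := by
    rw [← Matrix.vecMul_injective_iff_isUnit]
    refine (injective_iff_map_eq_zero M.vecMulLinear).mpr fun c hc => hP c fun s t => ?_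
    have h1 : ∀ m, ∑ a, c a * M a m = 0 := fun m => congrFun hc m
    simp only [hM, Finset.mul_sum]
    rw [Finset.sum_comm]
    refine Finset.sum_eq_zero fun m _ => ?_
    simp only [← mul_assoc, ← Finset.sum_mul, h1, zero_mul]
  refine ⟨fun m => ∑ a, M a m • b a, ?_, ?_⟩
  · rw [Fintype.linearIndependent_iff] at hb ⊢
    intro c hc
    have h1 : M.mulVec c = 0 := by
      ext a
      refine hb (M.mulVec c) ?_ a
      rw [← hc]
      simp only [Matrix.mulVec, dotProduct, Finset.sum_smul, Finset.smul_sum, smul_smul]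
      rw [Finset.sum_comm]
      exact Finset.sum_congr rfl fun m _ => Finset.sum_congr rfl fun a _ => by rw [mul_comm]
    have h2 := Matrix.mulVec_injective_iff_isUnit.mpr hunit (h1.trans (Matrix.mulVec_zero M).symm)
    exact fun m => congrFun h2 m
  · have : ∀ s t : ℂ, ∑ a, P a s t • b a
        = ∑ i : Fin (d + 1), (s ^ (d - (i : ℕ)) * t ^ (i : ℕ)) • ∑ a, M a i • b a := fun s t => by
      simp only [hM, Finset.sum_smul, Finset.smul_sum, smul_smul]
      rw [Finset.sum_comm]
      exact Finset.sum_congr rfl fun m _ => Finset.sum_congr rfl fun a _ => by rw [mul_comm]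
    simp only [this]

theorem sub_ne_zero_of_injective (hl : Function.Injective l) {i j : Fin 4} (h : i ≠ j) :
    l i - l j ≠ 0 :=
  sub_ne_zero.mpr fun h' => h (hl h')

/-- Up to scalars, the forms parametrizing the curve are the products of four out of the five linear
forms `s - l i t`, `t`; their independence is seen by evaluating at the five zeros. -/
theorem isRationalNormalCurve_four (hl : Function.Injective l) (hw : ∀ i, w i ≠ 0) :
    IsRationalNormalCurve 4 (curve E l w Finset.univ) := by
  let b : Fin 5 → (Fin 5 → ℂ) := ![E (Pi.single 0 1, 0), E (Pi.single 1 1, 0), E (Pi.single 2 1, 0),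
    E (Pi.single 3 1, 0), E (0, 1)]
  have hb : LinearIndependent ℂ b := by
    rw [Fintype.linearIndependent_iff]
    intro c hc
    have h1 : E (![c 0, c 1, c 2, c 3], c 4) = 0 := by
      rw [linearEquiv_apply_eq_sum, ← hc]
      simp [Fin.sum_univ_succ, b, add_assoc]
    rw [map_eq_zero_iff E E.injective] at h1
    have h2 := congrArg Prod.fst h1
    intro i
    match i with
    | 0 => exact congrFun h2 0
    | 1 => exact congrFun h2 1
    | 2 => exact congrFun h2 2
    | 3 => exact congrFun h2 3
    | 4 => exact congrArg Prod.snd h1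
  let P : Fin 5 → ℂ → ℂ → ℂ := ![
    fun s t => t * w 0 * ((s - l 1 * t) * (s - l 2 * t) * (s - l 3 * t)),
    fun s t => t * w 1 * ((s - l 0 * t) * (s - l 2 * t) * (s - l 3 * t)),
    fun s t => t * w 2 * ((s - l 0 * t) * (s - l 1 * t) * (s - l 3 * t)),
    fun s t => t * w 3 * ((s - l 0 * t) * (s - l 1 * t) * (s - l 2 * t)),
    fun s t => (s - l 0 * t) * (s - l 1 * t) * (s - l 2 * t) * (s - l 3 * t)]
  have hcurve : ∀ s t, curvePoint E l w Finset.univ s t = ∑ a, P a s t • b a := by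
    intro s t
    rw [curvePoint, linearEquiv_apply_eq_sum]
    have e0 : (Finset.univ.erase 0 : Finset (Fin 4)) = {1, 2, 3} := by decide
    have e1 : (Finset.univ.erase 1 : Finset (Fin 4)) = {0, 2, 3} := by decide
    have e2 : (Finset.univ.erase 2 : Finset (Fin 4)) = {0, 1, 3} := by decide
    have e3 : (Finset.univ.erase 3 : Finset (Fin 4)) = {0, 1, 2} := by decide
    simp [Fin.sum_univ_succ, Fin.prod_univ_succ, b, P, e0, e1, e2, e3, add_assoc, mul_assoc]
  have hne := fun i j => @sub_ne_zero_of_injective l hl i j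
  have := isRationalNormalCurve_of_param (d := 4) hb P
    !![0, w 0, -w 0 * (l 1 + l 2 + l 3), w 0 * (l 1 * l 2 + l 1 * l 3 + l 2 * l 3),
        -w 0 * (l 1 * l 2 * l 3);
      0, w 1, -w 1 * (l 0 + l 2 + l 3), w 1 * (l 0 * l 2 + l 0 * l 3 + l 2 * l 3),
        -w 1 * (l 0 * l 2 * l 3);
      0, w 2, -w 2 * (l 0 + l 1 + l 3), w 2 * (l 0 * l 1 + l 0 * l 3 + l 1 * l 3),
        -w 2 * (l 0 * l 1 * l 3);
      0, w 3, -w 3 * (l 0 + l 1 + l 2), w 3 * (l 0 * l 1 + l 0 * l 2 + l 1 * l 2),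
        -w 3 * (l 0 * l 1 * l 2);
      1, -(l 0 + l 1 + l 2 + l 3),
        l 0 * l 1 + l 0 * l 2 + l 0 * l 3 + l 1 * l 2 + l 1 * l 3 + l 2 * l 3,
        -(l 0 * l 1 * l 2 + l 0 * l 1 * l 3 + l 0 * l 2 * l 3 + l 1 * l 2 * l 3),
        l 0 * l 1 * l 2 * l 3]
    (fun a s t => by
      fin_cases a <;> simp [P, Fin.sum_univ_succ] <;> ring)
    (fun c hc => by
      ext i
      match i with
      | 0 => simpa [Fin.sum_univ_succ, P, hw, hne] using hc (l 0) 1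
      | 1 => simpa [Fin.sum_univ_succ, P, hw, hne] using hc (l 1) 1
      | 2 => simpa [Fin.sum_univ_succ, P, hw, hne] using hc (l 2) 1
      | 3 => simpa [Fin.sum_univ_succ, P, hw, hne] using hc (l 3) 1
      | 4 => simpa [Fin.sum_univ_succ, P] using hc 1 0)
  simpa only [curve, hcurve] using this

theorem isRationalNormalCurve_three (hl : Function.Injective l) (h0 : w 0 ≠ 0) (h1 : w 1 ≠ 0)
    (h2 : w 2 ≠ 0) (h3 : w 3 = 0) : IsRationalNormalCurve 3 (curve E l w {0, 1, 2}) := by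
  let b : Fin 4 → (Fin 5 → ℂ) := ![E (Pi.single 0 1, 0), E (Pi.single 1 1, 0), E (Pi.single 2 1, 0),
    E (0, 1)]
  have hb : LinearIndependent ℂ b := by
    rw [Fintype.linearIndependent_iff]
    intro c hc
    have h1 : E (![c 0, c 1, c 2, 0], c 3) = 0 := by
      rw [linearEquiv_apply_eq_sum, ← hc]
      simp [Fin.sum_univ_succ, b, add_assoc]
    rw [map_eq_zero_iff E E.injective] at h1
    have h2 := congrArg Prod.fst h1
    intro i
    match i with
    | 0 => exact congrFun h2 0
    | 1 => exact congrFun h2 1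
    | 2 => exact congrFun h2 2
    | 3 => exact congrArg Prod.snd h1
  let P : Fin 4 → ℂ → ℂ → ℂ := ![
    fun s t => t * w 0 * ((s - l 1 * t) * (s - l 2 * t)),
    fun s t => t * w 1 * ((s - l 0 * t) * (s - l 2 * t)),
    fun s t => t * w 2 * ((s - l 0 * t) * (s - l 1 * t)),
    fun s t => (s - l 0 * t) * (s - l 1 * t) * (s - l 2 * t)]
  have hcurve : ∀ s t, curvePoint E l w {0, 1, 2} s t = ∑ a, P a s t • b a := by
    intro s t
    rw [curvePoint, linearEquiv_apply_eq_sum]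
    have e0 : ({0, 1, 2} : Finset (Fin 4)).erase 0 = {1, 2} := by decide
    have e1 : ({0, 1, 2} : Finset (Fin 4)).erase 1 = {0, 2} := by decide
    have e2 : ({0, 1, 2} : Finset (Fin 4)).erase 2 = {0, 1} := by decide
    simp [Fin.sum_univ_succ, b, P, e0, e1, e2, h3, add_assoc, mul_assoc]
  have hne := fun i j => @sub_ne_zero_of_injective l hl i j
  have := isRationalNormalCurve_of_param (d := 3) hb P
    !![0, w 0, -w 0 * (l 1 + l 2), w 0 * (l 1 * l 2);
      0, w 1, -w 1 * (l 0 + l 2), w 1 * (l 0 * l 2);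
      0, w 2, -w 2 * (l 0 + l 1), w 2 * (l 0 * l 1);
      1, -(l 0 + l 1 + l 2), l 0 * l 1 + l 0 * l 2 + l 1 * l 2, -(l 0 * l 1 * l 2)]
    (fun a s t => by
      fin_cases a <;> simp [P, Fin.sum_univ_succ] <;> ring)
    (fun c hc => by
      ext i
      match i with
      | 0 => simpa [Fin.sum_univ_succ, P, h0, hne] using hc (l 0) 1
      | 1 => simpa [Fin.sum_univ_succ, P, h1, hne] using hc (l 1) 1
      | 2 => simpa [Fin.sum_univ_succ, P, h2, hne] using hc (l 2) 1
      | 3 => simpa [Fin.sum_univ_succ, P] using hc 1 0)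
  simpa only [curve, hcurve] using this

variable {Φ : QuadraticMap ℂ (Fin 5 → ℂ) (Fin 6 → ℂ)}

theorem isLine_curve (h : IsDiagonalMinorForm Φ E l w) (h0 : w 0 ≠ 0) (h1 : w 1 = 0)
    (h2 : w 2 = 0) (h3 : w 3 = 0) : IsLine (curve E l w {0}) := by
  have hS : ∀ i, i ∈ ({0} : Finset (Fin 4)) ↔ w i ≠ 0 := fun i => by
    fin_cases i <;> simp [h0, h1, h2, h3]
  refine ⟨Submodule.span ℂ (Set.range ![E (Pi.single 0 1, 0), E (0, 1)]), ?_, ?_⟩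
  · rw [finrank_span_eq_card, Fintype.card_fin]
    rw [LinearIndependent.pair_iff]
    intro a c hac
    rw [← map_smul, ← map_smul, ← map_add, map_eq_zero_iff E E.injective] at hac
    have e1 := congrArg Prod.snd hac
    have e2 := congrFun (congrArg Prod.fst hac) 0
    exact ⟨by simpa using e2, by simpa using e1⟩
  · ext p
    rw [mem_curve_iff h hS, Set.mem_ofPred_eq, mem_of_submodule_le,
      Submodule.mem_span_range_iff_exists_fun]
    have he : E ((E.symm p.rep).1, (E.symm p.rep).2) = p.rep := E.apply_symm_apply _
    constructor
    · rintro ⟨-, hz⟩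
      refine ⟨![(E.symm p.rep).1 0, (E.symm p.rep).2], ?_⟩
      conv_rhs => rw [← he, linearEquiv_apply_eq_sum, Fin.sum_univ_four, hz 1 (by decide),
        hz 2 (by decide), hz 3 (by decide)]
      simp
    · rintro ⟨c, hc⟩
      have hp : p.rep = E (![c 0, 0, 0, 0], c 1) := by
        rw [← hc, linearEquiv_apply_eq_sum E ![c 0, 0, 0, 0]]
        simp [Fin.sum_univ_succ]
      refine ⟨?_, fun i hi => ?_⟩
      · rw [hp, h.map_eq_zero_iff]
        by_cases hc0 : c 0 = 0
        · left
          ext i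
          fin_cases i <;> simp [hc0]
        · refine Or.inr ⟨(l 0 * c 0 + c 1 * w 0) / c 0, fun i => ?_⟩
          match i with
          | 0 =>
            simp only [Matrix.cons_val]
            field_simp
            ring
          | 1 => simp [h1]
          | 2 => simp [h2]
          | 3 => simp [h3]
      · rw [hp, E.symm_apply_apply]
        fin_cases i
        · simp at hi
        all_goals rfl

/-- The quadric `c xy + (a x + b y) z` is linear in `z` with coprime coefficients. -/
theorem irreducible_conic {a b c : ℂ} (ha : a ≠ 0) (hb : b ≠ 0) (hc : c ≠ 0) :
    Irreducible ((C a * X 0 + C b * X 1) * X 2 + C c * (X 0 * X 1) : MvPolynomial (Fin 3) ℂ) := by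
  have hX : ∀ i : Fin 3, (i = 0 ∨ i = 1) →
      IsRelPrime (C a * X 0 + C b * X 1 : MvPolynomial (Fin 3) ℂ) (X i) := by
    intro i hi
    rw [isRelPrime_comm, X_prime.irreducible.isRelPrime_iff_not_dvd]
    rintro ⟨g, hg⟩
    rcases hi with rfl | rfl
    · have := congrArg (eval ![0, 1, 0]) hg
      simp [hb] at this
    · have := congrArg (eval ![1, 0, 0]) hg
      simp [ha] at this
  refine irreducible_mul_X_add _ _ 2 ?_ ?_ ?_ ?_
  · intro h
    have := congrArg (eval ![1, 0, 0]) h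
    simp [ha] at this
  · intro h
    have := vars_add_subset _ _ h
    simp [vars_C_mul, ha, hb, vars_X] at this
  · intro h
    rw [vars_C_mul _ hc] at h
    have := vars_mul _ _ h
    simp [vars_X] at this
  · exact IsRelPrime.mul_right (((isUnit_iff_ne_zero.mpr hc).map C).isRelPrime_right)
      (IsRelPrime.mul_right (hX 0 (Or.inl rfl)) (hX 1 (Or.inr rfl)))

theorem isIrreducibleConic_curve (h : IsDiagonalMinorForm Φ E l w) (h0 : w 0 ≠ 0) (h1 : w 1 ≠ 0)
    (h2 : w 2 = 0) (h3 : w 3 = 0) : IsIrreducibleConic (curve E l w {0, 1}) := by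
  have hS : ∀ i, i ∈ ({0, 1} : Finset (Fin 4)) ↔ w i ≠ 0 := fun i => by
    fin_cases i <;> simp [h0, h1, h2, h3]
  let v : Fin 3 → (Fin 5 → ℂ) := ![E (Pi.single 0 1, 0), E (Pi.single 1 1, 0), E (0, 1)]
  have hv : ∀ c : Fin 3 → ℂ, ∑ i, c i • v i = E (![c 0, c 1, 0, 0], c 2) := fun c => by
    rw [linearEquiv_apply_eq_sum]
    simp [Fin.sum_univ_succ, v, add_assoc]
  refine ⟨v, ?_, _, ?_, irreducible_conic (a := w 1) (b := -w 0) (c := l 1 - l 0) h1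
    (neg_ne_zero.mpr h0) (sub_ne_zero_of_injective h.injective (by decide)), ?_⟩
  · rw [Fintype.linearIndependent_iff]
    intro c hc
    rw [hv, map_eq_zero_iff E E.injective] at hc
    have e2 := congrArg Prod.fst hc
    intro i
    match i with
    | 0 => exact congrFun e2 0
    | 1 => exact congrFun e2 1
    | 2 => exact congrArg Prod.snd hc
  · refine IsHomogeneous.add (n := 2) ?_ ?_
    · exact ((isHomogeneous_C_mul_X _ _).add (isHomogeneous_C_mul_X _ _)).mul (isHomogeneous_X _ _)
    · exact ((isHomogeneous_X _ _).mul (isHomogeneous_X _ _)).C_mul _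
  · have hzero : ∀ z0 z1 t : ℂ, Φ (E (![z0, z1, 0, 0], t)) = 0 ↔
        (w 1 * z0 + -w 0 * z1) * t + (l 1 - l 0) * (z0 * z1) = 0 := by
      intro z0 z1 t
      rw [h.map_eq_zero_iff]
      constructor
      · rintro (hz | ⟨s, hs⟩)
        · have e0 : z0 = 0 := congrFun hz 0
          have e1 : z1 = 0 := congrFun hz 1
          simp [e0, e1]
        · have e0 : (s - l 0) * z0 = t * w 0 := hs 0
          have e1 : (s - l 1) * z1 = t * w 1 := hs 1
          linear_combination z1 * e0 - z0 * e1
      · intro hz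
        by_cases e0 : z0 = 0
        · by_cases e1 : z1 = 0
          · left
            ext i
            fin_cases i <;> simp [e0, e1]
          · refine Or.inr ⟨(l 1 * z1 + t * w 1) / z1, fun i => ?_⟩
            match i with
            | 0 =>
              simp only [Matrix.cons_val]
              field_simp
              linear_combination hz
            | 1 =>
              simp only [Matrix.cons_val]
              field_simp
              ring
            | 2 => simp [h2]
            | 3 => simp [h3]
        · refine Or.inr ⟨(l 0 * z0 + t * w 0) / z0, fun i => ?_⟩
          match i with
          | 0 =>
            simp only [Matrix.cons_val]
            field_simp
            ring
          | 1 =>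
            simp only [Matrix.cons_val]
            field_simp
            linear_combination -hz
          | 2 => simp [h2]
          | 3 => simp [h3]
    ext p
    rw [mem_curve_iff h hS]
    have he : E ((E.symm p.rep).1, (E.symm p.rep).2) = p.rep := E.apply_symm_apply _
    constructor
    · rintro ⟨hp, hz⟩
      have hp' : p.rep = E (![(E.symm p.rep).1 0, (E.symm p.rep).1 1, 0, 0], (E.symm p.rep).2) := by
        conv_lhs => rw [← he]
        congr 2
        ext i
        match i with
        | 0 => rfl
        | 1 => rfl
        | 2 => exact hz 2 (by decide)
        | 3 => exact hz 3 (by decide)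
      refine ⟨![(E.symm p.rep).1 0, (E.symm p.rep).1 1, (E.symm p.rep).2], ?_, ?_⟩
      · rw [hp', hzero] at hp
        simpa using hp
      · rw [hv]
        exact submodule_eq_span_of_smul (c := 1) (by rw [one_smul]; exact hp')
    · rintro ⟨a, ha, hp⟩
      obtain ⟨c, hc⟩ := exists_rep_eq_smul hp
      rw [hv] at hc
      refine ⟨?_, fun i hi => ?_⟩
      · rw [hc, QuadraticMap.map_smul, (hzero _ _ _).mpr (by simpa using ha), smul_zero]
      · rw [hc, map_smul, E.symm_apply_apply]
        fin_cases i
        · simp at hi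
        · simp at hi
        · simp
        · simp

end Curves
end QuadBir

open MvPolynomial
namespace QuadBir
open QuadraticMap Module

/-! ### The classification -/

section Classification

variable {F : Fin 6 → MvPolynomial (Fin 5) ℂ} {q : MvPolynomial (Fin 6) ℂ}

theorem isSmoothHypersurface_of_radical_eq_bot (hq : q.IsHomogeneous 2)
    (h : LinearMap.ker (toQuadraticForm q).polarBilin = ⊥) : IsSmoothHypersurface q := by
  intro y hy0 _
  by_contra! hc
  have : y ∈ LinearMap.ker (toQuadraticForm q).polarBilin := by
    rw [LinearMap.mem_ker]
    ext z
    simp [polar_toQuadraticForm, ← eval_pderiv hq, hc]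
  rw [h, Submodule.mem_bot] at this
  exact hy0 this

/-- Either the map is inverted by a linear projection, or the quadric is smooth and the map is
given by the minors of a diagonal pencil. -/
theorem hasLinearInverse_or_diagonal (hq : q.IsHomogeneous 2) (hrank : 5 ≤ quadricRank q)
    (hF : IsQuadraticBirationalOnto F q) (hne : (baseLocus F).Nonempty)
    (hred : HasReducedBaseLocus F) :
    HasLinearInverse (toQuadraticMap F) ∨ (IsSmoothHypersurface q ∧
      ∃ E l w, IsDiagonalMinorForm (toQuadraticMap F) E l w ∧
        ∀ i j : Fin 4, i ≤ j → w j ≠ 0 → w i ≠ 0) := by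
  have H := isQuadricParametrization hq hrank hF hred
  obtain ⟨p, hp⟩ := hne
  have hp := (mem_baseLocus_iff hF.homogeneous p).mp hp
  by_cases hrad : LinearMap.ker (toQuadraticForm q).polarBilin = ⊥
  · rcases H.exists_minorForm hrad p.rep_nonzero hp with h | ⟨r₁, r₂, h, hr₁⟩
    · exact Or.inl h
    · obtain ⟨E, l, w, h⟩ := h.exists_diagonal H hr₁
      exact Or.inr ⟨isSmoothHypersurface_of_radical_eq_bot hq hrad, h.exists_sorted⟩
  · obtain ⟨r, hr, hr0⟩ := Submodule.exists_mem_ne_zero_of_ne_bot hrad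
    exact Or.inl (H.hasLinearInverse hr0
      (fun z => LinearMap.congr_fun (LinearMap.mem_ker.mp hr) z) p.rep_nonzero hp)

variable {E : ((Fin 4 → ℂ) × ℂ) ≃ₗ[ℂ] (Fin 5 → ℂ)} {l w : Fin 4 → ℂ}

theorem baseLocus_eq (hF : ∀ j, (F j).IsHomogeneous 2)
    (h : IsDiagonalMinorForm (toQuadraticMap F) E l w) {S : Finset (Fin 4)}
    (hS : ∀ i, i ∈ S ↔ w i ≠ 0) :
    baseLocus F = curve E l w S ∪ {p | ∃ j, j ∉ S ∧ p ∈ lineAt E l w j} := by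
  ext p
  rw [mem_baseLocus_iff hF, map_rep_eq_zero_iff h hS]
  rfl

theorem finrank_ker_coord_three (E : ((Fin 4 → ℂ) × ℂ) ≃ₗ[ℂ] (Fin 5 → ℂ)) :
    finrank ℂ (LinearMap.ker (LinearMap.proj (R := ℂ) (φ := fun _ : Fin 4 => ℂ) 3 ∘ₗ
      LinearMap.fst ℂ (Fin 4 → ℂ) ℂ ∘ₗ E.symm.toLinearMap)) = 4 := by
  have h1 := LinearMap.finrank_range_add_finrank_ker
    (LinearMap.proj (R := ℂ) (φ := fun _ : Fin 4 => ℂ) 3 ∘ₗ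
      LinearMap.fst ℂ (Fin 4 → ℂ) ℂ ∘ₗ E.symm.toLinearMap)
  rw [LinearMap.range_eq_top.mpr fun c => ⟨E (fun _ => c, 0), by simp⟩, finrank_top,
    Module.finrank_self, Module.finrank_fin_fun] at h1
  omega

end Classification
end QuadBir

open QuadBir in
theorem proposition7p4
    (F : Fin 6 → MvPolynomial (Fin 5) ℂ) (q : MvPolynomial (Fin 6) ℂ)
    (hq : q.IsHomogeneous 2) (hrank : 5 ≤ QuadBir.quadricRank q)
    (hF : QuadBir.IsQuadraticBirationalOnto F q)
    (hne : (QuadBir.baseLocus F).Nonempty)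
    (hred : QuadBir.HasReducedBaseLocus F) :
    QuadBir.IsOfType F q 1 ∨
    (QuadBir.IsOfType F q 2 ∧ QuadBir.IsSmoothHypersurface q ∧
      -- the rational normal quartic curve
      (QuadBir.IsRationalNormalCurve 4 (QuadBir.baseLocus F) ∨
      -- a twisted cubic in a hyperplane `H`, and a line not in `H` that meets it
      (∃ H C L : Set (QuadBir.ProjSpace 4),
        QuadBir.IsLinearSubspace 3 H ∧ QuadBir.IsRationalNormalCurve 3 C ∧ C ⊆ H ∧
        QuadBir.IsLine L ∧ ¬ L ⊆ H ∧ (L ∩ C).Nonempty ∧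
        QuadBir.baseLocus F = C ∪ L) ∨
      -- an irreducible conic, and two skew lines that meet it
      (∃ C L₁ L₂ : Set (QuadBir.ProjSpace 4),
        QuadBir.IsIrreducibleConic C ∧ QuadBir.IsLine L₁ ∧ QuadBir.IsLine L₂ ∧
        Disjoint L₁ L₂ ∧ (L₁ ∩ C).Nonempty ∧ (L₂ ∩ C).Nonempty ∧
        QuadBir.baseLocus F = C ∪ L₁ ∪ L₂) ∨
      -- three pairwise skew lines, and another line that meets them
      (∃ L₁ L₂ L₃ T : Set (QuadBir.ProjSpace 4),
        QuadBir.IsLine L₁ ∧ QuadBir.IsLine L₂ ∧ QuadBir.IsLine L₃ ∧ QuadBir.IsLine T ∧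
        Disjoint L₁ L₂ ∧ Disjoint L₁ L₃ ∧ Disjoint L₂ L₃ ∧
        (T ∩ L₁).Nonempty ∧ (T ∩ L₂).Nonempty ∧ (T ∩ L₃).Nonempty ∧
        QuadBir.baseLocus F = L₁ ∪ L₂ ∪ L₃ ∪ T))) := by
  -- degree zero is impossible, so a linear inverse is one of least degree
  by_cases h1 : ∃ G, IsInverseOfDegree F q 1 G
  · refine Or.inl ⟨h1, fun d hd => ?_⟩
    obtain ⟨G, hG⟩ := hd
    rcases Nat.eq_zero_or_pos d with rfl | hd
    · exact absurd hG not_isInverseOfDegree_zero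
    · exact hd
  right
  rcases hasLinearInverse_or_diagonal hq hrank hF hne hred with h | ⟨hsmooth, E, l, w, h, hw⟩
  · exact absurd (h.hasInverse.exists_isInverseOfDegree hq hrank hF) h1
  refine ⟨⟨h.hasInverse.exists_isInverseOfDegree hq hrank hF, fun d ⟨G, hG⟩ => ?_⟩, hsmooth, ?_⟩
  · rcases d with _ | _ | d
    · exact absurd hG not_isInverseOfDegree_zero
    · exact absurd ⟨G, hG⟩ h1
    · omega
  have hw0 : w 0 ≠ 0 := by
    obtain ⟨i, hi⟩ := Function.ne_iff.mp h.ne_zero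
    exact hw 0 i (Fin.zero_le i) hi
  -- the nonzero `w i` come first, so their number is decided by the first zero
  by_cases hw1 : w 1 = 0
  · have hw2 : w 2 = 0 := by by_contra h2; exact hw 1 2 (by decide) h2 hw1
    have hw3 : w 3 = 0 := by by_contra h3; exact hw 1 3 (by decide) h3 hw1
    have hS : ∀ i, i ∈ ({0} : Finset (Fin 4)) ↔ w i ≠ 0 := fun i => by
      fin_cases i <;> simp [hw0, hw1, hw2, hw3]
    have hmeet : ∀ j, j ∉ ({0} : Finset (Fin 4)) →
        (curve E l w {0} ∩ lineAt E l w j).Nonempty := fun j hj => by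
      rw [Set.inter_comm]; exact lineAt_inter_curve_nonempty h hS hj
    refine Or.inr (Or.inr (Or.inr ⟨lineAt E l w 1, lineAt E l w 2, lineAt E l w 3,
      curve E l w {0}, isLine_lineAt 1, isLine_lineAt 2, isLine_lineAt 3,
      isLine_curve h hw0 hw1 hw2 hw3, disjoint_lineAt h (by decide) hw1 hw2,
      disjoint_lineAt h (by decide) hw1 hw3, disjoint_lineAt h (by decide) hw2 hw3,
      hmeet 1 (by decide), hmeet 2 (by decide), hmeet 3 (by decide), ?_⟩))
    rw [baseLocus_eq hF.homogeneous h hS]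
    ext p
    simp [Fin.exists_fin_succ]
    tauto
  by_cases hw2 : w 2 = 0
  · have hw3 : w 3 = 0 := by by_contra h3; exact hw 2 3 (by decide) h3 hw2
    have hS : ∀ i, i ∈ ({0, 1} : Finset (Fin 4)) ↔ w i ≠ 0 := fun i => by
      fin_cases i <;> simp [hw0, hw1, hw2, hw3]
    refine Or.inr (Or.inr (Or.inl ⟨curve E l w {0, 1}, lineAt E l w 2, lineAt E l w 3,
      isIrreducibleConic_curve h hw0 hw1 hw2 hw3, isLine_lineAt 2, isLine_lineAt 3,
      disjoint_lineAt h (by decide) hw2 hw3, lineAt_inter_curve_nonempty h hS (by decide),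
      lineAt_inter_curve_nonempty h hS (by decide), ?_⟩))
    rw [baseLocus_eq hF.homogeneous h hS]
    ext p
    simp [Fin.exists_fin_succ]
    tauto
  by_cases hw3 : w 3 = 0
  · have hS : ∀ i, i ∈ ({0, 1, 2} : Finset (Fin 4)) ↔ w i ≠ 0 := fun i => by
      fin_cases i <;> simp [hw0, hw1, hw2, hw3]
    refine Or.inr (Or.inl ⟨{p | p.submodule ≤ _}, curve E l w {0, 1, 2}, lineAt E l w 3,
      ⟨_, finrank_ker_coord_three E, rfl⟩, isRationalNormalCurve_three h.injective hw0 hw1 hw2 hw3,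
      fun p hp => ?_, isLine_lineAt 3, fun hsub => ?_,
      lineAt_inter_curve_nonempty h hS (by decide), ?_⟩)
    · exact (mem_of_submodule_le p).mpr (((mem_curve_iff h hS p).mp hp).2 3 (by decide))
    · have hx : E (Pi.single 3 1, 0) ≠ 0 := fun h0 => by
        have := congrFun (congrArg Prod.fst ((map_eq_zero_iff E E.injective).mp h0)) 3
        simp at this
      have hp : Projectivization.mk ℂ _ hx ∈ lineAt E l w 3 := by
        rw [lineAt, Set.mem_ofPred_eq, Projectivization.submodule_mk,
          Submodule.span_singleton_le_iff_mem, mem_linePlane_iff hw3]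
        intro i hi
        simp [hi]
      have h2 := hsub hp
      rw [Set.mem_ofPred_eq, Projectivization.submodule_mk, Submodule.span_singleton_le_iff_mem,
        LinearMap.mem_ker] at h2
      simp at h2
    · rw [baseLocus_eq hF.homogeneous h hS]
      ext p
      simp [Fin.exists_fin_succ]
  · left
    have hS : ∀ i, i ∈ (Finset.univ : Finset (Fin 4)) ↔ w i ≠ 0 := fun i => by
      fin_cases i <;> simp [hw0, hw1, hw2, hw3]
    rw [baseLocus_eq hF.homogeneous h hS]
    simp
    exact isRationalNormalCurve_four h.injective fun i => (hS i).mp (Finset.mem_univ i)
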